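/- Let $K$ be an arbitrary field, let $r\ge 0$, $k\ge 0$ be integers, $n=r+2$, and let $R=K[x_0,\dots,x_r,t,u]$ be the homogeneous coordinate ring of $\mathbb P^n_K$. Let $L\subset\mathbb P^n$ be the line with homogeneous ideal $I_L=(x_0,\dots,x_r)$ and coordinate ring $S=K[t,u]$. Let $C\subset\mathbb P^n$ be a rope supported on $L$, i.e. a locally Cohen--Macaulay closed subscheme of pure dimension one with support $L$ whose homogeneous ideal satisfies $I_L^2\subseteq I_C$. Assume that $C$ has degree $n-k>2$ and arithmetic genus $g$, i.e. Hilbert polynomial $(n-k)m+1-g$. Let $A$ and $B$ be matrices associated to $C$: $A=(a_{lj})_{0\le l\le r-k,\,0\le j\le r}$ and $B=(b_{js})_{0\le j\le r,\,1\le s\le k}$ have entries in $S$, with $a_{lj}$ homogeneous of degree $\alpha_l\geq 0$ and $b_{js}$ homogeneous of degree $\beta_s\ge 0$, such that $I_C=(I_L^2,\,F_1,\dots,F_k)$ with $F_s=\sum_{j=0}^r x_j b_{js}$, and such that $$0\to\bigoplus_{s=1}^k\mathcal O_{L}(-\beta_s-1)\xrightarrow{\;B\;}\mathcal O_{L}^{\,r+1}(-1)\xrightarrow{\;A\;}\bigoplus_{l=0}^{r-k}\mathcal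 O_{L}(\alpha_l-1)\to 0$$ is exact. Assume that $\alpha_l\ge 2$ for all $l$ (equivalently $\alpha_0\ge 2$ if the rows are ordered so that $\alpha_0\le\dots\le\alpha_{r-k}$). Let $\mathcal N_C=\mathcal Hom(\mathcal I_C/\mathcal I_C^2,\mathcal O_C)$ be the normal sheaf of $C$ and $h^0(C,\mathcal N_C)=\dim_K H^0(C,\mathcal N_C)$, and set $$E:=(r+1)(2+k-g)-k^2+\sum_{l,h=0}^{r-k}\ \sum_{v=h}^{r-k}\max(0,\ \alpha_l-\alpha_h-\alpha_v+2).$$ Then: 1. $h^0(C,\mathcal N_C)$ is finite and $h^0(C,\mathcal N_C)\ \ge\ E$. 2. For $\varphi\in H^0(C,\mathcal N_C)$ let $P^s\in S$ be the form of degree $\beta_s+1$ that is the restriction to $L$ of the section $\varphi(F_s)\in H^0(C,\mathcal O_C(\beta_s+1))$, for $s=1,\dots,k$. If for every $\varphi\in H^0(C,\mathcal N_C)$ the vector $(P^1,\dots,P^k)^t$ is of the form $B^t\lambda$ with $\lambda=(\lambda_0,\dots,\lambda_r)^t\in S^{r+1}$, then $h^0(C,\mathcal N_C)=E$. -/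

import Mathlib

noncomputable section

namespace LineRope

open MvPolynomial

/-! ### Closed subschemes of projective space and the normal sheaf

A closed subscheme `C` of the projective space with homogeneous coordinates `X i`, `i : σ`, over `K`
is given by its saturated homogeneous ideal `I` in `MvPolynomial σ K`. The constructions that only
use the grading are written for a graded `K`-algebra `R = ⨁ 𝒜 m`. -/

section Graded

variable {K R : Type*} [Field K] [CommRing R] [Algebra K R]
variable (𝒜 : ℕ → Submodule K R) [GradedAlgebra 𝒜]

/-- The ring `R_(f)` of elements of degree `0` in `R_f`: the coordinate ring of the basic
affine open subset `D₊(f)` of `Proj R`, for `f` homogeneous of positive degree. -/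
abbrev ChartRing (f : R) : Type _ := HomogeneousLocalization.Away 𝒜 f

/-- The `K`-algebra structure on `R_(f)`, with the scalar multiplication that
`HomogeneousLocalization` already carries. -/
instance chartAlgebra (f : R) : Algebra K (ChartRing 𝒜 f) where
  algebraMap := (algebraMap (𝒜 0) (ChartRing 𝒜 f)).comp (algebraMap K (𝒜 0))
  commutes' := fun _ _ => mul_comm _ _
  smul_def' := fun c a => by
    apply HomogeneousLocalization.val_injective
    rw [HomogeneousLocalization.val_smul, HomogeneousLocalization.val_mul, Algebra.smul_def]
    rfl

/-- The ideal `I_(f)` of `R_(f)`, that is `I R_f ∩ R_(f)`: the sections over `D₊(f)` of the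
ideal sheaf of the closed subscheme defined by `I`. -/
def chartIdeal (I : Ideal R) (f : R) : Ideal (ChartRing 𝒜 f) :=
  (I.map (algebraMap R (Localization.Away f))).comap
    (algebraMap (ChartRing 𝒜 f) (Localization.Away f))

lemma chartIdeal_mono {I J : Ideal R} (h : I ≤ J) (f : R) :
    chartIdeal 𝒜 I f ≤ chartIdeal 𝒜 J f :=
  Ideal.comap_mono (Ideal.map_mono h)

/-- A homogeneous element of positive degree, indexing the basic open subset `D₊(val)`. -/
structure PosHomog where
  deg : ℕ
  val : R
  deg_pos : 0 < deg
  mem : val ∈ 𝒜 deg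

variable {𝒜}

/-- The restriction map from `D₊(f)` to `D₊(h) = D₊(f) ∩ D₊(g)`, where `h = f g`. -/
def restrict {f g h : PosHomog 𝒜} (hx : h.val = f.val * g.val) :
    ChartRing 𝒜 f.val →+* ChartRing 𝒜 h.val :=
  HomogeneousLocalization.awayMap 𝒜 g.mem hx

lemma mem_chartIdeal {I : Ideal R} {f : R} {a : ChartRing 𝒜 f} :
    a ∈ chartIdeal 𝒜 I f ↔ a.val ∈ I.map (algebraMap R (Localization.Away f)) :=
  Iff.rfl

lemma chartIdeal_le_comap (I : Ideal R) {f g h : PosHomog 𝒜} (hx : h.val = f.val * g.val) :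
    chartIdeal 𝒜 I f.val ≤ (chartIdeal 𝒜 I h.val).comap (restrict hx) := by
  intro a ha
  rw [Ideal.mem_comap, mem_chartIdeal]
  rw [mem_chartIdeal] at ha
  have key : ∀ ψ : Localization.Away f.val →+* Localization.Away h.val,
      ψ.comp (algebraMap R _) = algebraMap R _ → ψ a.val ∈ I.map (algebraMap R _) := by
    intro ψ hψ
    rw [← hψ, ← Ideal.map_map]
    exact Ideal.mem_map_of_mem _ ha
  rw [restrict, HomogeneousLocalization.val_awayMap]
  exact key _ (IsLocalization.lift_comp _)

/-- Restriction of sections of the ideal sheaf from `D₊(f)` to `D₊(h)`, `h = f g`. -/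
def restrictIdeal (I : Ideal R) {f g h : PosHomog 𝒜} (hx : h.val = f.val * g.val)
    (a : chartIdeal 𝒜 I f.val) : chartIdeal 𝒜 I h.val :=
  ⟨restrict hx a, chartIdeal_le_comap I hx a.2⟩

/-- Restriction of sections of the structure sheaf of the subscheme from `D₊(f)` to `D₊(h)`,
`h = f g`. -/
def restrictQuot (I : Ideal R) {f g h : PosHomog 𝒜} (hx : h.val = f.val * g.val) :
    (ChartRing 𝒜 f.val ⧸ chartIdeal 𝒜 I f.val) →+*
      (ChartRing 𝒜 h.val ⧸ chartIdeal 𝒜 I h.val) :=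
  Ideal.quotientMap _ (restrict hx) (chartIdeal_le_comap I hx)

lemma restrict_smul {f g h : PosHomog 𝒜} (hx : h.val = f.val * g.val) (c : K)
    (a : ChartRing 𝒜 f.val) : restrict hx (c • a) = c • restrict hx a := by
  refine (congrArg (restrict hx) (Algebra.smul_def c a)).trans ?_
  refine Eq.trans ?_ (Algebra.smul_def c (restrict hx a)).symm
  rw [map_mul]
  exact congrArg (· * restrict hx a)
    (HomogeneousLocalization.awayMap_fromZeroRingHom 𝒜 g.mem hx (algebraMap K (𝒜 0) c))

lemma restrictQuot_smul (I : Ideal R) {f g h : PosHomog 𝒜} (hx : h.val = f.val * g.val) (c : K)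
    (a : ChartRing 𝒜 f.val ⧸ chartIdeal 𝒜 I f.val) :
    restrictQuot I hx (c • a) = c • restrictQuot I hx a := by
  obtain ⟨a, rfl⟩ := Ideal.Quotient.mk_surjective a
  exact congrArg (Ideal.Quotient.mk (chartIdeal 𝒜 I h.val)) (restrict_smul hx c a)

variable (𝒜) in
/-- The space `H⁰(C, N_C)` of global sections of the normal sheaf
`N_C = ℋom(𝓘_C / 𝓘_C², 𝒪_C) = ℋom(𝓘_C, 𝒪_C)` of the closed subscheme `C ⊆ Proj R` defined by `I`.
A global section is a homomorphism of sheaves `𝓘_C → 𝒪_C`, i.e. a family of linear maps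
`I_(f) → R_(f) / I_(f)` over all basic affine open subsets that commutes with restriction. -/
def gradedNormalSections (I : Ideal R) :
    Submodule K (∀ f : PosHomog 𝒜,
      chartIdeal 𝒜 I f.val →ₗ[ChartRing 𝒜 f.val]
        (ChartRing 𝒜 f.val ⧸ chartIdeal 𝒜 I f.val)) where
  carrier := {φ | ∀ (f g h : PosHomog 𝒜) (hx : h.val = f.val * g.val) (a : chartIdeal 𝒜 I f.val),
    φ h (restrictIdeal I hx a) = restrictQuot I hx (φ f a)}
  add_mem' := fun {φ ψ} hφ hψ f g h hx a => by
    simp only [Pi.add_apply, LinearMap.add_apply, map_add, hφ f g h hx a, hψ f g h hx a]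
  zero_mem' := fun f g h hx a => by
    simp only [Pi.zero_apply, LinearMap.zero_apply, map_zero]
  smul_mem' := fun c φ hφ f g h hx a =>
    (congrArg (c • ·) (hφ f g h hx a)).trans (restrictQuot_smul I hx c (φ f a)).symm

end Graded

section Projective

attribute [local instance] MvPolynomial.gradedAlgebra

variable {σ K : Type*} [Field K]

/-- `H⁰(C, N_C)` for the closed subscheme `C` of projective space with homogeneous ideal `I`. -/
abbrev normalSections (I : Ideal (MvPolynomial σ K)) :=
  gradedNormalSections (homogeneousSubmodule σ K) I

/-- `I` is the homogeneous ideal of a curve, i.e. of a locally Cohen-Macaulay closed subscheme of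
pure dimension one: `I` is a proper homogeneous ideal each of whose associated primes `P` has
`dim K[X] / P = 2`. This says that `I` is saturated, and that the subscheme has pure dimension one
and no embedded points. -/
structure IsCurveIdeal (I : Ideal (MvPolynomial σ K)) : Prop where
  homogeneous : I.IsHomogeneous (homogeneousSubmodule σ K)
  ne_top : I ≠ ⊤
  unmixed : ∀ P ∈ associatedPrimes (MvPolynomial σ K) (MvPolynomial σ K ⧸ I),
    ringKrullDim (MvPolynomial σ K ⧸ P) = 2

/-- The Hilbert function `m ↦ dim_K [K[X] / I]_m`. -/
def hilbertFunction (I : Ideal (MvPolynomial σ K)) (m : ℕ) : ℕ :=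
  Module.finrank K ((homogeneousSubmodule σ K m).map (Ideal.Quotient.mkₐ K I).toLinearMap)

/-- The one-dimensional subscheme defined by `I` has degree `d` and arithmetic genus `g`: its Hilbert
polynomial is `d m + 1 - g`. -/
def HasDegreeAndGenus (I : Ideal (MvPolynomial σ K)) (d : ℕ) (g : ℤ) : Prop :=
  ∀ᶠ m : ℕ in Filter.atTop, (hilbertFunction I m : ℤ) = d * m + 1 - g

/-- Let `J ⊇ I` define a closed subscheme `L` of `C`, and let `F ∈ I` be homogeneous of degree `d`.
The section `φ` of `N_C` maps `F` to an element `φ(F)` of `H⁰(C, 𝒪_C(d))`. This predicate says that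
on `D₊(f)`, for a linear form `f`, the restriction of `φ(F)` to `L` is given by
the polynomial `P` of degree `d`: the image of `φ(F / f ^ d)` in `K[X]_(f) / J_(f)` is the class of
`P / f ^ d`. -/
def ValueOnChart {I J : Ideal (MvPolynomial σ K)} (hIJ : I ≤ J) (φ : normalSections I)
    (d : ℕ) (F P f : MvPolynomial σ K) : Prop :=
  ∃ (hf : f ∈ homogeneousSubmodule σ K 1) (hF : F ∈ homogeneousSubmodule σ K (d • 1))
    (hP : P ∈ homogeneousSubmodule σ K (d • 1))
    (hmem : HomogeneousLocalization.Away.mk _ hf d F hF ∈ chartIdeal (homogeneousSubmodule σ K) I f),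
    Ideal.Quotient.factor (chartIdeal_mono _ hIJ f)
        (φ.1 ⟨1, f, Nat.one_pos, hf⟩ ⟨HomogeneousLocalization.Away.mk _ hf d F hF, hmem⟩) =
      Ideal.Quotient.mk (chartIdeal (homogeneousSubmodule σ K) J f) (HomogeneousLocalization.Away.mk _ hf d P hP)

end Projective

/-! ### Ropes supported on a line

The coordinates of `ℙⁿ`, `n = r + 2`, are `x_j = X (Sum.inl j)`, `j = 0, …, r`, and
`t = X (Sum.inr 0)`, `u = X (Sum.inr 1)`; the line `L` is `x_0 = ⋯ = x_r = 0`. -/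

section Rope

variable {K : Type*} [Field K] {r k : ℕ}

/-- The coordinate ring `K[x_0, …, x_r, t, u]` of `ℙⁿ`, `n = r + 2`. -/
abbrev CoordRing (K : Type*) [Field K] (r : ℕ) : Type _ :=
  MvPolynomial (Fin (r + 1) ⊕ Fin 2) K

/-- The coordinate ring `S = K[t, u]` of the line `L`. -/
abbrev LineRing (K : Type*) [Field K] : Type _ := MvPolynomial (Fin 2) K

/-- The inclusion `K[t, u] ⊆ K[x_0, …, x_r, t, u]`. -/
def incl (K : Type*) [Field K] (r : ℕ) : LineRing K →ₐ[K] CoordRing K r :=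
  rename Sum.inr

/-- The ideal `I_L = (x_0, …, x_r)` of the line `L`. -/
def lineIdeal (K : Type*) [Field K] (r : ℕ) : Ideal (CoordRing K r) :=
  Ideal.span (Set.range fun j : Fin (r + 1) => X (Sum.inl j))

/-- `I` is the homogeneous ideal of a rope supported on the line `L`: a curve whose support is `L`
and whose homogeneous ideal contains `I_L ^ 2`. -/
structure IsRope (I : Ideal (CoordRing K r)) : Prop where
  curve : IsCurveIdeal I
  support : I.radical = lineIdeal K r
  sq_le : lineIdeal K r ^ 2 ≤ I

lemma IsRope.le_lineIdeal {I : Ideal (CoordRing K r)} (h : IsRope I) : I ≤ lineIdeal K r :=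
  h.support ▸ Ideal.le_radical

/-- The entry with index `s` of the row `[x_0, …, x_r] B`. -/
def formOfColumn (B : Matrix (Fin (r + 1)) (Fin k) (LineRing K)) (s : Fin k) :
    CoordRing K r :=
  ∑ j, X (Sum.inl j) * incl K r (B j s)

/-- The matrices `A`, `B` over `S = K[t, u]` are associated to the rope with homogeneous ideal `I`,
with row degrees `α_0, …, α_{r-k}` of `A` and column degrees `β_1, …, β_k` of `B`: one has
`I = (I_L ^ 2, [x_0, …, x_r] B)`, and `B`, `A` give an exact sequence of sheaves on `L = ℙ¹`
`0 → ⨁ 𝒪(-β_s - 1) → 𝒪(-1)^(r+1) → ⨁ 𝒪(α_l - 1) → 0`. Exactness of the sheaf sequence is exactness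
over the two standard affine charts, i.e. after inverting `t` and after inverting `u`. -/
structure IsAssociated (I : Ideal (CoordRing K r)) (α : Fin (r - k + 1) → ℕ) (β : Fin k → ℕ)
    (A : Matrix (Fin (r - k + 1)) (Fin (r + 1)) (LineRing K))
    (B : Matrix (Fin (r + 1)) (Fin k) (LineRing K)) : Prop where
  degA : ∀ l j, A l j ∈ homogeneousSubmodule (Fin 2) K (α l)
  degB : ∀ j s, B j s ∈ homogeneousSubmodule (Fin 2) K (β s)
  ideal_eq : I = lineIdeal K r ^ 2 ⊔ Ideal.span (Set.range (formOfColumn B))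
  injective : ∀ i : Fin 2, Function.Injective
    (B.map (algebraMap (LineRing K) (Localization.Away (X i : LineRing K)))).mulVec
  exact : ∀ i : Fin 2, Function.Exact
    (B.map (algebraMap (LineRing K) (Localization.Away (X i : LineRing K)))).mulVec
    (A.map (algebraMap (LineRing K) (Localization.Away (X i : LineRing K)))).mulVec
  surjective : ∀ i : Fin 2, Function.Surjective
    (A.map (algebraMap (LineRing K) (Localization.Away (X i : LineRing K)))).mulVec

/-- The section `φ` of the normal sheaf has components `P¹, …, P^k ∈ S`: for each `s`, the polynomial
`P^s` is homogeneous of degree `β_s + 1` and is the restriction to `L` of the section `φ(F_s)` of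
`𝒪_C(β_s + 1)`, where `(F_1, …, F_k) = [x_0, …, x_r] B`. Equivalently,
`φ(F_s) = P^s + ∑ Q^s_l z_l` where the sections `z_l` vanish on `L`. -/
def HasComponents {I : Ideal (CoordRing K r)} (hI : IsRope I)
    (β : Fin k → ℕ) (B : Matrix (Fin (r + 1)) (Fin k) (LineRing K)) (φ : normalSections I)
    (P : Fin k → LineRing K) : Prop :=
  ∀ (s : Fin k) (i : Fin 2), ValueOnChart hI.le_lineIdeal φ (β s + 1)
    (formOfColumn B s) (incl K r (P s)) (X (Sum.inr i))

/-- The condition that the vector `(P¹, …, P^k)` of the section `φ` is an `S`-linear combination of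
the rows of `B`, i.e. `P = Bᵗ λ` for some `λ_0, …, λ_r ∈ S`. -/
def SatisfiesRowCondition {I : Ideal (CoordRing K r)} (hI : IsRope I)
    (β : Fin k → ℕ) (B : Matrix (Fin (r + 1)) (Fin k) (LineRing K)) (φ : normalSections I) : Prop :=
  ∃ P : Fin k → LineRing K, HasComponents hI β B φ P ∧
    ∃ lam : Fin (r + 1) → LineRing K, P = B.transpose.mulVec lam

/-- `(r+1)(2+k-g) - k² + ∑_{l,h=0}^{r-k} ∑_{v=h}^{r-k} max(0, α_l - α_h - α_v + 2)`. -/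
def expectedDim (r k : ℕ) (g : ℤ) (α : Fin (r - k + 1) → ℕ) : ℤ :=
  (r + 1) * (2 + k - g) - k ^ 2 +
    ∑ l, ∑ h, ∑ v ∈ Finset.Ici h, max 0 ((α l : ℤ) - α h - α v + 2)

end Rope

end LineRope

end

/-! Write `z_l` for the generators of the ideal sheaf of `L` in `𝒪_C`. The sheaf `𝒪_C` is the split
extension of `𝒪_L` by `⨁ 𝒪_L(α_l - 1)`, so `⨁ H⁰(C, 𝒪_C(d))` is the square-zero extension `T = S ⊕ ⨁
S z_l`, with `z_l` of degree `1 - α_l`. The map `K[x,t,u] → T`, `x_j ↦ ∑ a_{lj} z_l`, has kernel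
`I_C` (`toThick_eq_zero_iff`), and its cokernel dies on every chart.

A section `φ` of the normal sheaf is then a degree-zero homomorphism `I_C → T`. It is determined by
`φ(F_s) = P_s + ∑ Q_{sl} z_l` and `φ(x_i x_j) = ∑ (ψ_l)_{ij} z_l`; the latter has no part in `S`,
because `x_i φ(x_j x_m) = x_j φ(x_i x_m)` and `A` has two independent rows. The matrices `ψ_l` are
symmetric, and `x_i F_s = ∑ b_{js} x_i x_j` forces `ψ_l B = A_l Pᵀ`, where `A_l` is the row `l` of
`A`, written as a column. Conversely every such triple `(P, Q, ψ)` defines a section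
(`sectionOfData_bijective`).

It remains to count triples. If `P = 0`, then `ψ_l B = 0`, and exactness together with symmetry
gives `ψ_l = Aᵀ N_l A` for a unique symmetric `N_l` with entries of degree `α_l + 1 - α_h - α_v`;
the `Q_{sl}` are free forms of degree `α_l + β_s` (`map_paramMap`). The possible `P` include all `Bᵀ
λ` with `λ` a vector of linear forms (`map_rowMap_le`), a space of dimension `2(r+1)` since `α_l ≥
2` (`finrank_map_rowMap`). With `∑ α_l = ∑ β_s = -g`, read off from Hilbert functions, these
contributions add up to `E`. Hence `h⁰ ≥ E`, with equality as soon as no other `P` occur. -/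

namespace LineRope

open MvPolynomial

/-! ### Forms of integer degree in polynomial rings -/

section Forms

variable {σ K : Type*} [Field K]

/-- Forms of degree `e : ℤ`; there are no nonzero forms of negative degree. -/
noncomputable def form (σ K : Type*) [Field K] (e : ℤ) : Submodule K (MvPolynomial σ K) :=
  if 0 ≤ e then homogeneousSubmodule σ K e.toNat else ⊥

/-- The homogeneous component of degree `e : ℤ`. -/
noncomputable def formProj (e : ℤ) : MvPolynomial σ K →ₗ[K] MvPolynomial σ K :=
  if 0 ≤ e then homogeneousComponent e.toNat else 0

lemma mem_form {e : ℤ} {p : MvPolynomial σ K} :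
    p ∈ form σ K e ↔ ∀ d, coeff d p ≠ 0 → (d.degree : ℤ) = e := by
  unfold form
  split_ifs with h
  · rw [mem_homogeneousSubmodule, IsHomogeneous, IsWeightedHomogeneous]
    refine forall_congr' fun d => imp_congr_right fun _ => ?_
    rw [show Finsupp.weight 1 d = d.degree by rw [Finsupp.degree_eq_weight_one]; rfl]
    omega
  · rw [Submodule.mem_bot]
    refine ⟨fun hp d hd => by simp [hp] at hd, fun hp => ?_⟩
    ext d
    by_contra hd
    have := hp d (by simpa using hd)
    omega

open Classical in
lemma coeff_formProj (e : ℤ) (p : MvPolynomial σ K) (d : σ →₀ ℕ) :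
    coeff d (formProj e p) = if (d.degree : ℤ) = e then coeff d p else 0 := by
  unfold formProj
  split_ifs with h h' h'
  · rw [coeff_homogeneousComponent, if_pos (by omega)]
  · rw [coeff_homogeneousComponent, if_neg (by omega)]
  · omega
  · simp

lemma form_natCast (n : ℕ) : form σ K (n : ℤ) = homogeneousSubmodule σ K n := by
  simp [form]

lemma mem_form_natCast {n : ℕ} {p : MvPolynomial σ K} :
    p ∈ form σ K (n : ℤ) ↔ p.IsHomogeneous n := by
  rw [form_natCast, mem_homogeneousSubmodule]

lemma form_of_neg {e : ℤ} (h : e < 0) : form σ K e = ⊥ := by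
  simp [form, h]

lemma formProj_mem (e : ℤ) (p : MvPolynomial σ K) : formProj e p ∈ form σ K e := by
  classical
  rw [mem_form]
  intro d hd
  rw [coeff_formProj] at hd
  by_contra h
  simp [h] at hd

lemma formProj_of_mem {e : ℤ} {p : MvPolynomial σ K} (h : p ∈ form σ K e) :
    formProj e p = p := by
  classical
  ext d
  rw [coeff_formProj]
  rw [mem_form] at h
  split_ifs with h'
  · rfl
  · by_contra h0
    exact h' (h d (Ne.symm h0))

lemma formProj_of_mem_ne {e e' : ℤ} {p : MvPolynomial σ K} (h : p ∈ form σ K e) (hne : e ≠ e') :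
    formProj e' p = 0 := by
  classical
  ext d
  rw [coeff_formProj, coeff_zero]
  rw [mem_form] at h
  split_ifs with h'
  · by_contra h0
    exact hne ((h d h0).symm.trans h')
  · rfl

lemma monomial_mem_form (d : σ →₀ ℕ) (a : K) : monomial d a ∈ form σ K (d.degree : ℤ) := by
  rw [mem_form_natCast]
  exact isHomogeneous_monomial a rfl

lemma X_mem_form (i : σ) : (X i : MvPolynomial σ K) ∈ form σ K 1 := by
  have := mem_form_natCast.2 (isHomogeneous_X K i)
  simpa using this

lemma X_pow_mem_form (i : σ) (n : ℕ) : (X i ^ n : MvPolynomial σ K) ∈ form σ K n :=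
  mem_form_natCast.2 (isHomogeneous_X_pow i n)

lemma mul_mem_form {a b c : ℤ} {p q : MvPolynomial σ K} (hp : p ∈ form σ K a)
    (hq : q ∈ form σ K b) (h : a + b = c) : p * q ∈ form σ K c := by
  subst h
  rcases lt_or_ge a 0 with ha | ha
  · rw [form_of_neg ha, Submodule.mem_bot] at hp
    simp [hp]
  rcases lt_or_ge b 0 with hb | hb
  · rw [form_of_neg hb, Submodule.mem_bot] at hq
    simp [hq]
  lift a to ℕ using ha
  lift b to ℕ using hb
  rw [mem_form_natCast] at hp hq
  rw [← Nat.cast_add, mem_form_natCast]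
  exact hp.mul hq

/-- This is what allows a solution of a homogeneous linear system to be replaced by its components
of the right degrees. -/
lemma formProj_mul {b : ℤ} {p : MvPolynomial σ K} (hp : p ∈ form σ K b) (d : ℤ)
    (q : MvPolynomial σ K) : formProj d (p * q) = p * formProj (d - b) q := by
  induction q using MvPolynomial.induction_on' with
  | monomial m a =>
    have hm := monomial_mem_form m a
    by_cases h : (m.degree : ℤ) = d - b
    · rw [formProj_of_mem (mul_mem_form hp hm (by omega)), formProj_of_mem (h ▸ hm)]
    · rw [formProj_of_mem_ne (mul_mem_form hp hm rfl) (by omega), formProj_of_mem_ne hm h, mul_zero]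
  | add q q' h h' => rw [mul_add, map_add, h, h', map_add, mul_add]

lemma mem_form_of_mul_mem {b d : ℤ} {p q : MvPolynomial σ K} (hp : p ∈ form σ K b) (hp0 : p ≠ 0)
    (h : p * q ∈ form σ K d) : q ∈ form σ K (d - b) := by
  have h1 := formProj_mul hp d q
  rw [formProj_of_mem h] at h1
  rw [mul_left_cancel₀ hp0 h1]
  exact formProj_mem _ _

instance finite_form [Finite σ] (e : ℤ) : Module.Finite K (form σ K e) := by
  rcases lt_or_ge e 0 with h | h
  · rw [form_of_neg h]
    infer_instance
  · lift e to ℕ using h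
    rw [form_natCast]
    exact Module.Finite.of_fg (homogeneousSubmodule_fg _ _ _)

lemma finrank_homogeneousSubmodule_fin_two (n : ℕ) :
    Module.finrank K (homogeneousSubmodule (Fin 2) K n) = n + 1 := by
  let e : Fin (n + 1) ≃ {d : Fin 2 →₀ ℕ | d.degree = n} :=
    { toFun := fun i => ⟨Finsupp.equivFunOnFinite.symm ![i, n - i], by
        simp [Finsupp.degree_eq_sum, Fin.sum_univ_two]; omega⟩
      invFun := fun d => ⟨d.1 0, by
        have := d.2
        simp [Finsupp.degree_eq_sum, Fin.sum_univ_two] at this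
        omega⟩
      left_inv := fun i => by simp
      right_inv := fun d => by
        have := d.2
        simp [Finsupp.degree_eq_sum, Fin.sum_univ_two] at this
        ext j
        fin_cases j
        · simp
        · simp; omega }
  have h : homogeneousSubmodule (Fin 2) K n =
      Submodule.span K (Set.range fun i => monomial (e i).1 (1 : K)) := by
    rw [homogeneousSubmodule_eq_finsupp_supported, AddMonoidAlgebra.supported_eq_span_single]
    congr 1
    ext p
    constructor
    · rintro ⟨d, hd, rfl⟩
      exact ⟨e.symm ⟨d, hd⟩, by simp; rfl⟩
    · rintro ⟨i, rfl⟩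
      exact ⟨(e i).1, (e i).2, rfl⟩
  rw [h, finrank_span_eq_card]
  · simp
  · exact (basisMonomials (Fin 2) K).linearIndependent.comp (fun i => (e i).1)
      (Subtype.val_injective.comp e.injective)

lemma finrank_form (e : ℤ) : (Module.finrank K (form (Fin 2) K e) : ℤ) = max 0 (e + 1) := by
  rcases lt_or_ge e 0 with h | h
  · rw [form_of_neg h]
    simp; omega
  · lift e to ℕ using h
    rw [form_natCast, finrank_homogeneousSubmodule_fin_two]
    push_cast
    omega

/-- In a monomial of degree at least `2N` in two variables one exponent is at least `N`. The
cokernel of `A`, killed by powers of `t` and `u`, therefore vanishes in large degrees. -/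
lemma exists_pow_mul_add_pow_mul {N : ℕ} {e : ℤ} (he : 2 * N ≤ e) {p : LineRing K}
    (hp : p ∈ form (Fin 2) K e) : ∃ a b, p = X 0 ^ N * a + X 1 ^ N * b := by
  have : p ∈ Ideal.span {(X 0 : LineRing K) ^ N, X 1 ^ N} := by
    rw [p.as_sum]
    refine Ideal.sum_mem _ fun d hd => ?_
    have hd' := mem_form.1 hp d (by simpa using hd)
    rw [Finsupp.degree_eq_sum, Fin.sum_univ_two] at hd'
    have hmon : monomial d (coeff d p) = C (coeff d p) * (X 0 ^ d 0 * X 1 ^ d 1) := by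
      rw [monomial_eq, Finsupp.prod_fintype _ _ (by simp), Fin.prod_univ_two]
    rw [hmon]
    refine Ideal.mul_mem_left _ _ ?_
    rcases le_or_gt N (d 0) with h | h
    · exact Ideal.mul_mem_right _ _ (Ideal.mem_of_dvd _ (pow_dvd_pow _ h)
        (Ideal.subset_span (by simp)))
    · exact Ideal.mul_mem_left _ _ (Ideal.mem_of_dvd _ (pow_dvd_pow _ (by omega : N ≤ d 1))
        (Ideal.subset_span (by simp)))
  obtain ⟨a, b, h⟩ := Ideal.mem_span_pair.1 this
  exact ⟨a, b, by rw [← h]; ring⟩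

/-- Powers of distinct variables are coprime. For `t` and `u` this is the gluing statement that a
fraction regular on both charts of the line is a polynomial. -/
lemma exists_eq_mul_of_pow_mul_eq {i j : σ} (hij : i ≠ j) {N M : ℕ} {p q : MvPolynomial σ K}
    (h : X i ^ N * p = X j ^ M * q) : ∃ c, p = X j ^ M * c ∧ q = X i ^ N * c := by
  have hrel : IsRelPrime (X i ^ N : MvPolynomial σ K) (X j ^ M) := by
    exact IsRelPrime.pow (X_prime.irreducible.isRelPrime_iff_not_dvd.2 fun h => hij (X_dvd_X.1 h))
  have hd : X j ^ M ∣ p := hrel.symm.dvd_of_dvd_mul_left ⟨q, h⟩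
  obtain ⟨c, rfl⟩ := hd
  refine ⟨c, rfl, ?_⟩
  have h0 : (X j ^ M : MvPolynomial σ K) ≠ 0 := pow_ne_zero _ (X_ne_zero j)
  exact mul_left_cancel₀ h0 (by rw [← h]; ring)

end Forms

end LineRope

namespace LineRope

open MvPolynomial

/-! ### From exactness on the two charts to exactness over `S` -/

section Exact

variable {K : Type*} [Field K] {ι κ τ : Type*}

/-- The consequences over `S = K[t, u]` of the exactness over the line of
`0 → ⨁ 𝒪(-β_s - 1) → 𝒪(-1)^(r+1) → ⨁ 𝒪(α_l - 1) → 0` and of the dual sequence. -/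
structure IsLineExact [Fintype ι] [Fintype κ] [Fintype τ] (A : Matrix ι κ (LineRing K)) (B : Matrix κ τ (LineRing K)) : Prop where
  inj : ∀ c, B.mulVec c = 0 → c = 0
  comp : ∀ c, A.mulVec (B.mulVec c) = 0
  exact : ∀ v, A.mulVec v = 0 → ∃ c, v = B.mulVec c
  surj : ∃ N : ℕ, ∀ (i : Fin 2) (w : ι → LineRing K), ∃ v,
    A.mulVec v = (X i ^ N : LineRing K) • w
  dual_inj : ∀ w, Matrix.vecMul w A = 0 → w = 0
  dual_exact : ∀ y, Matrix.vecMul y B = 0 → ∃ w, y = Matrix.vecMul w A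

lemma exists_eq_smul_of_pow_smul_eq {N M : ℕ} {p q : τ → LineRing K}
    (h : (X 0 ^ N : LineRing K) • p = (X 1 ^ M : LineRing K) • q) :
    ∃ c : τ → LineRing K, p = (X 1 ^ M : LineRing K) • c ∧ q = (X 0 ^ N : LineRing K) • c := by
  have h1 : ∀ s, ∃ c, p s = X 1 ^ M * c ∧ q s = X 0 ^ N * c := fun s =>
    exists_eq_mul_of_pow_mul_eq (by decide) (by simpa using congrFun h s)
  choose c hc using h1
  exact ⟨c, funext fun s => (hc s).1, funext fun s => (hc s).2⟩

lemma exists_pow_smul_eq_algebraMap [Finite τ] (i : Fin 2)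
    (v : τ → Localization.Away (X i : LineRing K)) :
    ∃ (N : ℕ) (w : τ → LineRing K),
      (algebraMap (LineRing K) (Localization.Away (X i : LineRing K)) (X i ^ N)) • v =
        algebraMap (LineRing K) (Localization.Away (X i : LineRing K)) ∘ w := by
  obtain ⟨⟨b, N, rfl⟩, hb⟩ := IsLocalization.exist_integer_multiples_of_finite
    (Submonoid.powers (X i : LineRing K)) v
  choose w hw using hb
  refine ⟨N, w, funext fun s => ?_⟩
  have := hw s
  simp only [Algebra.smul_def] at this
  simpa using this.symm

lemma algebraMap_away_X_injective (i : Fin 2) : Function.Injective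
    (algebraMap (LineRing K) (Localization.Away (X i : LineRing K))) :=
  IsLocalization.injective _ (powers_le_nonZeroDivisors_of_noZeroDivisors (X_ne_zero i))

lemma algebraMap_away_X_comp_injective (i : Fin 2) {v w : τ → LineRing K}
    (h : algebraMap (LineRing K) (Localization.Away (X i : LineRing K)) ∘ v =
      algebraMap (LineRing K) (Localization.Away (X i : LineRing K)) ∘ w) : v = w :=
  (algebraMap_away_X_injective i).comp_left h

lemma map_mulVec_comp [Fintype κ] (M : Matrix ι κ (LineRing K)) (i : Fin 2) (v : κ → LineRing K) :
    (M.map (algebraMap (LineRing K) (Localization.Away (X i : LineRing K)))).mulVec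
      (algebraMap (LineRing K) (Localization.Away (X i : LineRing K)) ∘ v) =
    algebraMap (LineRing K) (Localization.Away (X i : LineRing K)) ∘ M.mulVec v :=
  funext fun s => (RingHom.map_mulVec _ M v s).symm

/-- Clearing denominators gives solutions up to a power of `t` and up to a power of `u`. They are
unique, so they glue to a solution over `S`. Dual exactness holds because on each chart the
surjection `A` onto a free module splits. -/
theorem isLineExact_of_localized [Fintype ι] [Fintype κ] [Fintype τ] [DecidableEq ι]
    {A : Matrix ι κ (LineRing K)}
    {B : Matrix κ τ (LineRing K)}
    (injective : ∀ i : Fin 2, Function.Injective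
      (B.map (algebraMap (LineRing K) (Localization.Away (X i : LineRing K)))).mulVec)
    (exact : ∀ i : Fin 2, Function.Exact
      (B.map (algebraMap (LineRing K) (Localization.Away (X i : LineRing K)))).mulVec
      (A.map (algebraMap (LineRing K) (Localization.Away (X i : LineRing K)))).mulVec)
    (surjective : ∀ i : Fin 2, Function.Surjective
      (A.map (algebraMap (LineRing K) (Localization.Away (X i : LineRing K)))).mulVec) :
    IsLineExact A B := by
  have inj : ∀ c, B.mulVec c = 0 → c = 0 := by
    intro c hc
    apply algebraMap_away_X_comp_injective 0
    apply injective 0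
    rw [map_mulVec_comp, map_mulVec_comp, hc, Matrix.mulVec_zero]
  have comp : ∀ c, A.mulVec (B.mulVec c) = 0 := by
    intro c
    apply algebraMap_away_X_comp_injective 0
    rw [← map_mulVec_comp, ← map_mulVec_comp, (exact 0).apply_apply_eq_zero]
    ext; simp
  have ex : ∀ i v, A.mulVec v = 0 → ∃ (N : ℕ) (c : _), (X i ^ N : LineRing K) • v = B.mulVec c := by
    intro i v hv
    have h1 := map_mulVec_comp A i v
    rw [hv] at h1
    obtain ⟨c, hc⟩ := (exact i _).1 (h1.trans (by ext; simp))
    obtain ⟨N, c', hc'⟩ := exists_pow_smul_eq_algebraMap i c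
    refine ⟨N, c', algebraMap_away_X_comp_injective i ?_⟩
    rw [← map_mulVec_comp, ← hc', Matrix.mulVec_smul, hc]
    ext; simp
  have sj : ∀ (i : Fin 2), ∃ N, ∀ (w : ι → LineRing K), ∃ v,
      A.mulVec v = (X i ^ N : LineRing K) • w := by
    intro i
    have h1 : ∀ l : ι, ∃ (N : ℕ) (v : _), A.mulVec v = (X i ^ N : LineRing K) • Pi.single l 1 := by
      intro l
      obtain ⟨c, hc⟩ := surjective i (algebraMap (LineRing K) _ ∘ Pi.single l 1)
      obtain ⟨N, c', hc'⟩ := exists_pow_smul_eq_algebraMap i c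
      refine ⟨N, c', algebraMap_away_X_comp_injective i ?_⟩
      rw [← map_mulVec_comp, ← hc', Matrix.mulVec_smul, hc]
      ext; simp
    choose N v hv using h1
    -- The sum of the exponents found for the basis vectors is an exponent that serves for all of
    -- them.
    refine ⟨∑ l, N l, fun w => ⟨∑ l, (X i ^ (∑ l, N l - N l) * w l : LineRing K) • v l, ?_⟩⟩
    rw [Matrix.mulVec_sum]
    simp_rw [Matrix.mulVec_smul, hv]
    ext1 l
    have hle : ∀ l, N l ≤ ∑ l, N l := fun l => Finset.single_le_sum (by simp) (Finset.mem_univ l)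
    simp only [Finset.sum_apply, Pi.smul_apply, smul_eq_mul, Pi.single_apply, mul_ite, mul_one,
      mul_zero, Finset.sum_ite_eq, Finset.mem_univ, if_true]
    rw [mul_right_comm, ← pow_add, Nat.sub_add_cancel (hle l)]
  have surj : ∃ N : ℕ, ∀ (i : Fin 2) (w : ι → LineRing K), ∃ v,
    A.mulVec v = (X i ^ N : LineRing K) • w := by
    choose N hN using sj
    refine ⟨∑ i, N i, fun i w => ?_⟩
    have hle : N i ≤ ∑ i, N i := Finset.single_le_sum (by simp) (Finset.mem_univ i)
    obtain ⟨v, hv⟩ := hN i ((X i ^ (∑ i, N i - N i) : LineRing K) • w)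
    exact ⟨v, by rw [hv, smul_smul, ← pow_add, Nat.add_sub_cancel' hle]⟩
  have dual_inj : ∀ w, Matrix.vecMul w A = 0 → w = 0 := by
    intro w hw
    obtain ⟨N, hN⟩ := surj
    ext1 l
    obtain ⟨v, hv⟩ := hN 0 (Pi.single l 1)
    have h1 := congrArg (dotProduct w) hv
    rw [Matrix.dotProduct_mulVec, hw, zero_dotProduct, dotProduct_smul, dotProduct_single,
      smul_eq_mul, mul_one] at h1
    exact (mul_eq_zero.1 h1.symm).resolve_left (pow_ne_zero _ (X_ne_zero 0))
  refine ⟨inj, comp, ?_, surj, dual_inj, ?_⟩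
  · intro v hv
    obtain ⟨N, c, hc⟩ := ex 0 v hv
    obtain ⟨M, c', hc'⟩ := ex 1 v hv
    -- Both sides are sent by `B` to `t^N u^M v`, and `B` is injective.
    have h1 : (X 0 ^ N : LineRing K) • c' = (X 1 ^ M : LineRing K) • c := by
      rw [← sub_eq_zero]
      apply inj
      rw [Matrix.mulVec_sub, Matrix.mulVec_smul, Matrix.mulVec_smul, ← hc, ← hc', smul_comm, sub_self]
    obtain ⟨d, hd, hd'⟩ := exists_eq_smul_of_pow_smul_eq h1
    refine ⟨d, ?_⟩
    rw [hd', Matrix.mulVec_smul] at hc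
    exact smul_right_injective _ (pow_ne_zero N (X_ne_zero (R := K) (0 : Fin 2))) hc
  · intro y hy
    have h1 : ∀ i : Fin 2, ∃ (N : ℕ) (w : ι → LineRing K),
        (X i ^ N : LineRing K) • y = Matrix.vecMul w A := by
      intro i
      obtain ⟨N, hN⟩ := surj
      choose V hV using fun l => hN i (Pi.single l 1)
      have hAV : ∀ x, A.mulVec (∑ l, x l • V l) = (X i ^ N : LineRing K) • x := by
        intro x
        rw [Matrix.mulVec_sum]
        simp_rw [Matrix.mulVec_smul, hV]
        ext1 l
        simp [Pi.single_apply, mul_comm]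
      -- The map `x ↦ ∑ x_l V_l` splits `A` up to the factor `X_i^N`. The defect `X_i^N v - ∑ (A
      -- v)_l V_l` lies in `ker A`, so a power of `X_i` times it lies in the image of `B`, which `y`
      -- annihilates.
      have key : ∀ v, dotProduct y ((X i ^ N : LineRing K) • v) =
          dotProduct (fun l => dotProduct y (V l)) (A.mulVec v) := by
        intro v
        have h2 : A.mulVec ((X i ^ N : LineRing K) • v - ∑ l, A.mulVec v l • V l) = 0 := by
          rw [Matrix.mulVec_sub, hAV, Matrix.mulVec_smul, sub_self]
        obtain ⟨M, c, hc⟩ := ex i _ h2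
        have h3 : dotProduct y (B.mulVec c) = 0 := by
          rw [Matrix.dotProduct_mulVec, hy, zero_dotProduct]
        rw [← hc, dotProduct_smul, smul_eq_mul] at h3
        have h4 := (mul_eq_zero.1 h3).resolve_left (pow_ne_zero _ (X_ne_zero i))
        rw [dotProduct_sub, sub_eq_zero] at h4
        rw [h4, dotProduct_sum, dotProduct]
        simp [mul_comm]
      refine ⟨N, fun l => dotProduct y (V l), ?_⟩
      classical
      ext1 j
      have := key (Pi.single j 1)
      rw [dotProduct_smul, dotProduct_single, Matrix.dotProduct_mulVec, dotProduct_single] at this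
      simpa using this
    obtain ⟨N, w, hw⟩ := h1 0
    obtain ⟨M, w', hw'⟩ := h1 1
    have h1 : (X 0 ^ N : LineRing K) • w' = (X 1 ^ M : LineRing K) • w := by
      rw [← sub_eq_zero]
      apply dual_inj
      rw [Matrix.sub_vecMul, Matrix.smul_vecMul, Matrix.smul_vecMul, ← hw, ← hw', smul_comm,
        sub_self]
    obtain ⟨d, hd, hd'⟩ := exists_eq_smul_of_pow_smul_eq h1
    refine ⟨d, ?_⟩
    rw [hd', Matrix.smul_vecMul] at hw
    exact smul_right_injective _ (pow_ne_zero N (X_ne_zero (R := K) (0 : Fin 2))) hw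

end Exact

end LineRope

namespace LineRope

set_option linter.unusedSectionVars false

open MvPolynomial

/-! ### Vectors of forms: graded exactness and dimension counts -/

section Homogeneous

variable {K : Type*} [Field K] {ι κ τ : Type*}

/-- Vectors of forms of prescribed degrees. -/
noncomputable def formPi (K : Type*) [Field K] (e : ι → ℤ) : Submodule K (ι → LineRing K) :=
  Submodule.pi Set.univ fun l => form (Fin 2) K (e l)

lemma mem_formPi {e : ι → ℤ} {v : ι → LineRing K} :
    v ∈ formPi K e ↔ ∀ l, v l ∈ form (Fin 2) K (e l) := by
  simp [formPi, Submodule.mem_pi]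

/-- A vector of forms is a family of forms. -/
noncomputable def formPiEquiv (e : ι → ℤ) : formPi K e ≃ₗ[K] ∀ l, form (Fin 2) K (e l) where
  toFun v l := ⟨v.1 l, mem_formPi.1 v.2 l⟩
  map_add' _ _ := rfl
  map_smul' _ _ := rfl
  invFun w := ⟨fun l => (w l).1, mem_formPi.2 fun l => (w l).2⟩
  left_inv _ := rfl
  right_inv _ := rfl

instance [Finite ι] (e : ι → ℤ) : Module.Finite K (formPi K e) :=
  Module.Finite.equiv (formPiEquiv e).symm

lemma finrank_formPi [Fintype ι] (e : ι → ℤ) :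
    (Module.finrank K (formPi K e) : ℤ) = ∑ l, max 0 (e l + 1) := by
  rw [(formPiEquiv e).finrank_eq, Module.finrank_pi_fintype]
  push_cast
  simp_rw [finrank_form]

lemma finrank_map_add_finrank_inf_ker {V W : Type*} [AddCommGroup V] [Module K V] [AddCommGroup W]
    [Module K W] (f : V →ₗ[K] W) (p : Submodule K V) [Module.Finite K p] :
    Module.finrank K (p.map f) + Module.finrank K (p ⊓ LinearMap.ker f : Submodule K V) =
      Module.finrank K p := by
  have h := LinearMap.finrank_range_add_finrank_ker (f.domRestrict p)
  rw [LinearMap.range_domRestrict] at h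
  rw [← h]
  congr 1
  rw [LinearMap.ker_domRestrict, ← Submodule.map_comap_subtype]
  exact (Submodule.equivSubtypeMap p _).finrank_eq.symm

lemma finrank_map_of_injOn {V W : Type*} [AddCommGroup V] [Module K V] [AddCommGroup W]
    [Module K W] (f : V →ₗ[K] W) (p : Submodule K V) [Module.Finite K p]
    (h : ∀ v ∈ p, f v = 0 → v = 0) : Module.finrank K (p.map f) = Module.finrank K p := by
  rw [← finrank_map_add_finrank_inf_ker f p]
  have : p ⊓ LinearMap.ker f = ⊥ := by
    rw [eq_bot_iff]
    rintro v ⟨hv, hv'⟩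
    exact h v hv hv'
  rw [this, finrank_bot, add_zero]

variable [Fintype ι] [Fintype κ] [Fintype τ]
  {A : Matrix ι κ (LineRing K)} {B : Matrix κ τ (LineRing K)} {α : ι → ℕ} {β : τ → ℕ}

/-- The rows of `A` are homogeneous of degrees `α_l`. -/
def RowForms (A : Matrix ι κ (LineRing K)) (α : ι → ℕ) : Prop :=
  ∀ l j, A l j ∈ form (Fin 2) K (α l)

/-- The columns of `B` are homogeneous of degrees `β_s`. -/
def ColForms (B : Matrix κ τ (LineRing K)) (β : τ → ℕ) : Prop :=
  ∀ j s, B j s ∈ form (Fin 2) K (β s)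

lemma RowForms.mulVec_mem (hA : RowForms A α) {d : ℤ} {v : κ → LineRing K}
    (hv : v ∈ formPi K fun _ => d) : A.mulVec v ∈ formPi K fun l => d + α l := by
  rw [mem_formPi] at hv ⊢
  exact fun l => Submodule.sum_mem _ fun j _ => mul_mem_form (hA l j) (hv j) (add_comm _ _)

lemma ColForms.mulVec_mem (hB : ColForms B β) {d : ℤ} {c : τ → LineRing K}
    (hc : c ∈ formPi K fun s => d - β s) : B.mulVec c ∈ formPi K fun _ => d := by
  rw [mem_formPi] at hc ⊢
  exact fun l => Submodule.sum_mem _ fun j _ => mul_mem_form (hB l j) (hc j) (by ring)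

lemma ColForms.vecMul_mem (hB : ColForms B β) {d : ℤ} {y : κ → LineRing K}
    (hy : y ∈ formPi K fun _ => d) : Matrix.vecMul y B ∈ formPi K fun s => d + β s := by
  rw [mem_formPi] at hy ⊢
  exact fun l => Submodule.sum_mem _ fun j _ => mul_mem_form (hy j) (hB j l) rfl

lemma IsLineExact.mul_eq_zero (h : IsLineExact A B) : A * B = 0 := by
  classical
  refine Matrix.toLin'.injective (LinearMap.ext fun c => ?_)
  rw [Matrix.toLin'_apply, ← Matrix.mulVec_mulVec, h.comp, map_zero, LinearMap.zero_apply]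

/-- The columns of `B` are homogeneous, so in any solution `c` only the components of degree `d -
β_s` contribute to degree `d`. -/
lemma IsLineExact.exact_form (h : IsLineExact A B) (hB : ColForms B β) {d : ℤ} {v : κ → LineRing K}
    (hv : v ∈ formPi K fun _ => d) (h0 : A.mulVec v = 0) :
    ∃ c ∈ formPi K (fun s => d - β s), v = B.mulVec c := by
  obtain ⟨c, rfl⟩ := h.exact v h0
  refine ⟨fun s => formProj (d - β s) (c s), mem_formPi.2 fun s => formProj_mem _ _, ?_⟩
  ext1 j
  rw [← formProj_of_mem (mem_formPi.1 hv j)]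
  simp only [Matrix.mulVec, dotProduct, map_sum]
  exact Finset.sum_congr rfl fun s _ => formProj_mul (hB j s) _ _

lemma IsLineExact.dual_form (h : IsLineExact A B) (hA : RowForms A α) {d : ℤ} {y : κ → LineRing K}
    (hy : y ∈ formPi K fun _ => d) (h0 : Matrix.vecMul y B = 0) :
    ∃ w ∈ formPi K (fun l => d - α l), y = Matrix.vecMul w A := by
  obtain ⟨w, rfl⟩ := h.dual_exact y h0
  refine ⟨fun s => formProj (d - α s) (w s), mem_formPi.2 fun s => formProj_mem _ _, ?_⟩
  ext1 j
  rw [← formProj_of_mem (mem_formPi.1 hy j)]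
  simp only [Matrix.vecMul, dotProduct, map_sum]
  refine Finset.sum_congr rfl fun s _ => ?_
  rw [mul_comm, formProj_mul (hA s j), mul_comm]

/-- For `d ≥ 2N` each entry of `q` is of the form `t^N a + u^N b`; the two summands lift separately,
and the degree `d` part of the lift suffices. -/
lemma IsLineExact.surj_form (h : IsLineExact A B) (hA : RowForms A α) :
    ∃ M : ℕ, ∀ d : ℤ, M ≤ d → ∀ q ∈ formPi K (fun l => d + α l),
      ∃ v ∈ formPi K (fun _ => d), A.mulVec v = q := by
  obtain ⟨N, hN⟩ := h.surj
  refine ⟨2 * N, fun d hd q hq => ?_⟩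
  have h1 : ∀ l, ∃ a b, q l = X 0 ^ N * a + X 1 ^ N * b := fun l =>
    exists_pow_mul_add_pow_mul (by push_cast at hd; omega) (mem_formPi.1 hq l)
  choose a b hab using h1
  obtain ⟨v, hv⟩ := hN 0 a
  obtain ⟨v', hv'⟩ := hN 1 b
  have hq' : A.mulVec (v + v') = q := by
    rw [Matrix.mulVec_add, hv, hv']
    ext1 l
    simp [hab]
  refine ⟨fun j => formProj d ((v + v') j), mem_formPi.2 fun s => formProj_mem _ _, ?_⟩
  ext1 l
  rw [← formProj_of_mem (mem_formPi.1 hq l), ← hq']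
  simp only [Matrix.mulVec, dotProduct, map_sum]
  refine Finset.sum_congr rfl fun s _ => ?_
  rw [formProj_mul (hA l s), add_sub_cancel_right]

/-- Multiplicativity of the rank and the degree in the exact sequence defined by `A` and `B`. -/
lemma IsLineExact.sum_eq_sum (h : IsLineExact A B) (hA : RowForms A α) (hB : ColForms B β)
    (hcard : Fintype.card κ = Fintype.card ι + Fintype.card τ) : ∑ s, (β s : ℤ) = ∑ l, (α l : ℤ) := by
  obtain ⟨M, hM⟩ := h.surj_form hA
  -- This degree is large enough for `A` to be surjective and for every `d - β_s` to be nonnegative,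
  -- so that no truncation occurs in the dimensions. The terms linear in `d` then cancel by `hcard`.
  set d : ℤ := M + ∑ s, β s with hd
  have hβ : ∀ s, (β s : ℤ) ≤ d := fun s => by
    have : β s ≤ ∑ s, β s := Finset.single_le_sum (by simp) (Finset.mem_univ s)
    rw [hd]
    zify at this
    push_cast
    omega
  have hd0 : 0 ≤ d := by positivity
  have h1 := finrank_map_add_finrank_inf_ker (K := K) (A.mulVecLin.restrictScalars K)
    (formPi K fun _ => d)
  have h2 : (formPi K fun _ => d).map (A.mulVecLin.restrictScalars K) =
      formPi K fun l => d + α l := by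
    ext q
    constructor
    · rintro ⟨v, hv, rfl⟩
      exact hA.mulVec_mem hv
    · intro hq
      have hs : (0 : ℤ) ≤ ∑ s, (β s : ℤ) := by positivity
      exact hM d (by rw [hd]; linarith) q hq
  have h3 : (formPi K fun _ => d) ⊓ LinearMap.ker (A.mulVecLin.restrictScalars K) =
      (formPi K fun s => d - β s).map (B.mulVecLin.restrictScalars K) := by
    ext v
    constructor
    · rintro ⟨hv, hv'⟩
      obtain ⟨c, hc, rfl⟩ := h.exact_form hB hv hv'
      exact ⟨c, hc, rfl⟩
    · rintro ⟨c, hc, rfl⟩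
      exact ⟨hB.mulVec_mem hc, h.comp c⟩
  rw [h2, h3, finrank_map_of_injOn _ _ fun c _ hc => h.inj c hc] at h1
  zify at h1
  rw [finrank_formPi, finrank_formPi, finrank_formPi,
    Finset.sum_congr rfl fun l _ => max_eq_right (by positivity : 0 ≤ d + α l + 1),
    Finset.sum_congr rfl fun s _ => max_eq_right (by linarith [hβ s] : 0 ≤ d - β s + 1),
    max_eq_right (by positivity)] at h1
  simp only [Finset.sum_add_distrib, Finset.sum_sub_distrib, Finset.sum_const, Finset.card_univ,
    hcard, nsmul_eq_mul] at h1
  push_cast at h1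
  linarith

end Homogeneous

end LineRope

namespace LineRope

open MvPolynomial Matrix

set_option linter.unusedSectionVars false

/-! ### The space of triples `(P, Q, ψ)` and its dimension -/

section Data

variable {K : Type*} [Field K] {ι κ τ : Type*} [Fintype ι] [Fintype κ] [Fintype τ]

/-- The space of triples `(P, Q, ψ)` that describe the global sections `φ` of the normal sheaf:
`φ(F_s) = P_s + ∑ Q_{s l} z_l` and `φ(x_i x_j) = ∑ (ψ_l)_{i j} z_l`. -/
noncomputable def normalData (A : Matrix ι κ (LineRing K)) (B : Matrix κ τ (LineRing K))
    (α : ι → ℕ) (β : τ → ℕ) :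
    Submodule K ((τ → LineRing K) × (τ × ι → LineRing K) × (ι → Matrix κ κ (LineRing K))) where
  carrier := {x | x.1 ∈ formPi K (fun s => (β s : ℤ) + 1) ∧
    x.2.1 ∈ formPi K (fun p => (α p.2 : ℤ) + β p.1) ∧
    (∀ l i j, x.2.2 l i j ∈ form (Fin 2) K (α l + 1)) ∧
    (∀ l, (x.2.2 l)ᵀ = x.2.2 l) ∧
    ∀ l, x.2.2 l * B = vecMulVec (A l) x.1}
  add_mem' := by
    rintro x y ⟨h1, h2, h3, h4, h5⟩ ⟨h1', h2', h3', h4', h5'⟩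
    refine ⟨add_mem h1 h1', add_mem h2 h2', fun l i j => add_mem (h3 l i j) (h3' l i j),
      fun l => ?_, fun l => ?_⟩
    · simp [h4, h4']
    · simp only [Prod.snd_add, Prod.fst_add, Pi.add_apply, Matrix.add_mul, h5, h5', vecMulVec_add]
  zero_mem' := ⟨zero_mem _, zero_mem _, fun l i j => zero_mem _, fun l => by simp, fun l => by
    ext; simp [vecMulVec_apply]⟩
  smul_mem' := by
    rintro c x ⟨h1, h2, h3, h4, h5⟩
    refine ⟨Submodule.smul_mem _ _ h1, Submodule.smul_mem _ _ h2,
      fun l i j => Submodule.smul_mem _ _ (h3 l i j), fun l => ?_, fun l => ?_⟩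
    · simp [h4]
    · refine (Matrix.smul_mul c (x.2.2 l) B).trans ?_
      rw [h5]
      ext; simp [vecMulVec_apply]

variable {A : Matrix ι κ (LineRing K)} {B : Matrix κ τ (LineRing K)} {α : ι → ℕ} {β : τ → ℕ}

/-- The rows of `A` are independent, so `A` cancels on the right, and after transposing `Aᵀ` cancels
on the left. -/
lemma IsLineExact.conj_eq_zero (h : IsLineExact A B) {N : Matrix ι ι (LineRing K)}
    (hN : Aᵀ * N * A = 0) : N = 0 := by
  have h1 : Aᵀ * N = 0 := funext fun i => h.dual_inj _ (congrFun hN i)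
  have h2 : Nᵀ * A = 0 := by
    rw [← Matrix.transpose_transpose A, ← Matrix.transpose_mul, h1, Matrix.transpose_zero]
  have h3 : Nᵀ = 0 := funext fun i => h.dual_inj _ (congrFun h2 i)
  rw [← Matrix.transpose_transpose N, h3, Matrix.transpose_zero]

/-- Dual exactness is used twice: the rows of `M` are combinations `W A` of the rows of `A`, and
symmetry of `M` gives `Wᵀ B = 0`, so that `Wᵀ = N A` as well. Symmetry of `N` follows from the
uniqueness in `conj_eq_zero`, in every characteristic. -/
lemma IsLineExact.exists_conj (h : IsLineExact A B) (hA : RowForms A α) {d : ℤ}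
    {M : Matrix κ κ (LineRing K)} (hM : ∀ i j, M i j ∈ form (Fin 2) K d) (hs : Mᵀ = M)
    (h0 : M * B = 0) : ∃ N : Matrix ι ι (LineRing K),
      (∀ h v, N h v ∈ form (Fin 2) K (d - α h - α v)) ∧ Nᵀ = N ∧ M = Aᵀ * N * A := by
  have h1 : ∀ i, ∃ w ∈ formPi K (fun l => d - α l), M i = vecMul w A := fun i =>
    h.dual_form hA (mem_formPi.2 (hM i)) (congrFun h0 i)
  choose W hWd hW using h1
  have hMW : M = Matrix.of W * A := funext hW
  have h2 : (Matrix.of W)ᵀ * B = 0 := by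
    have h3 : Bᵀ * Matrix.of W * A = 0 := by
      rw [Matrix.mul_assoc, ← hMW, ← hs, ← Matrix.transpose_mul, h0, Matrix.transpose_zero]
    have h4 : Bᵀ * Matrix.of W = 0 := funext fun i => h.dual_inj _ (congrFun h3 i)
    rw [← Matrix.transpose_transpose B, ← Matrix.transpose_mul, h4, Matrix.transpose_zero]
  have h5 : ∀ v, ∃ w ∈ formPi K (fun l => d - α v - α l), (Matrix.of W)ᵀ v = vecMul w A := fun v =>
    h.dual_form hA (mem_formPi.2 fun i => mem_formPi.1 (hWd i) v) (congrFun h2 v)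
  choose N hNd hN using h5
  have hWN : (Matrix.of W)ᵀ = Matrix.of N * A := funext hN
  have hMN : M = Aᵀ * (Matrix.of N)ᵀ * A := by
    rw [hMW, ← Matrix.transpose_mul, ← hWN, Matrix.transpose_transpose]
  have hsym : (Matrix.of N)ᵀ = Matrix.of N := by
    rw [← sub_eq_zero]
    apply h.conj_eq_zero
    rw [Matrix.mul_sub, Matrix.sub_mul, ← hMN, sub_eq_zero, ← hs, hMN]
    simp only [Matrix.transpose_mul, Matrix.transpose_transpose, Matrix.mul_assoc]
  exact ⟨Matrix.of N, fun l v => mem_formPi.1 (hNd l) v, hsym, hsym ▸ hMN⟩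

variable [LinearOrder ι]

/-- The symmetric matrix with the given upper triangle. -/
def symMatrix (N : {p : ι × ι // p.1 ≤ p.2} → LineRing K) : Matrix ι ι (LineRing K) :=
  fun h v => N ⟨(min h v, max h v), min_le_max⟩

lemma symMatrix_transpose (N : {p : ι × ι // p.1 ≤ p.2} → LineRing K) :
    (symMatrix N)ᵀ = symMatrix N := by
  ext h v
  simp only [Matrix.transpose_apply, symMatrix, min_comm, max_comm]

/-- The degrees of the parameters of the sections `φ` with `P = 0`. -/
def paramDegree (α : ι → ℕ) (β : τ → ℕ) : (τ × ι) ⊕ (ι × {p : ι × ι // p.1 ≤ p.2}) → ℤ :=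
  Sum.elim (fun p => (α p.2 : ℤ) + β p.1) fun p => (α p.1 : ℤ) + 1 - α p.2.1.1 - α p.2.1.2

/-- The parametrization of the sections `φ` with `P = 0`. -/
noncomputable def paramMap (A : Matrix ι κ (LineRing K)) :
    ((τ × ι) ⊕ (ι × {p : ι × ι // p.1 ≤ p.2}) → LineRing K) →ₗ[K]
      ((τ → LineRing K) × (τ × ι → LineRing K) × (ι → Matrix κ κ (LineRing K))) where
  toFun x := (0, fun p => x (Sum.inl p), fun l => Aᵀ * symMatrix (fun p => x (Sum.inr (l, p))) * A)
  map_add' x y := by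
    have h : ∀ l, symMatrix (fun p => (x + y) (Sum.inr (l, p))) =
      symMatrix (fun p => x (Sum.inr (l, p))) + symMatrix fun p => y (Sum.inr (l, p)) := fun _ => rfl
    refine Prod.ext (by simp) (Prod.ext rfl (funext fun l => ?_))
    simp only [h, Matrix.mul_add, Matrix.add_mul]
    rfl
  map_smul' c x := by
    have h : ∀ l, symMatrix (fun p => (c • x) (Sum.inr (l, p))) =
      c • symMatrix (fun p => x (Sum.inr (l, p))) := fun _ => rfl
    refine Prod.ext (by simp) (Prod.ext rfl (funext fun l => ?_))
    simp only [h, Matrix.mul_smul, Matrix.smul_mul]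
    rfl

lemma IsLineExact.paramMap_injective (h : IsLineExact A B) :
    Function.Injective (paramMap (τ := τ) A) := by
  rw [injective_iff_map_eq_zero]
  intro x hx
  ext1 (p | ⟨l, p⟩)
  · exact congrFun (congrArg (fun y => y.2.1) hx) p
  · have h1 := h.conj_eq_zero (congrFun (congrArg (fun y => y.2.2) hx) l)
    have h2 := congrFun (congrFun h1 p.1.1) p.1.2
    simpa [symMatrix, min_eq_left p.2, max_eq_right p.2] using h2

/-- For `P = 0` the relations reduce to `ψ_l B = 0`, which is the situation of `exists_conj`, and
they leave `Q` free. -/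
lemma IsLineExact.map_paramMap (h : IsLineExact A B) (hA : RowForms A α) :
    (formPi K (paramDegree α β)).map (paramMap A) =
      normalData A B α β ⊓ LinearMap.ker (LinearMap.fst K _ _) := by
  ext ⟨P, Q, ψ⟩
  constructor
  · rintro ⟨x, hx, hxe⟩
    obtain ⟨rfl, rfl, rfl⟩ : 0 = P ∧ (fun p => x (Sum.inl p)) = Q ∧
        (fun l => Aᵀ * symMatrix (fun p => x (Sum.inr (l, p))) * A) = ψ := by
      simpa [Prod.ext_iff, paramMap] using hxe
    rw [SetLike.mem_coe, mem_formPi] at hx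
    refine ⟨⟨zero_mem _, mem_formPi.2 fun p => hx (Sum.inl p), fun l i j => ?_, fun l => ?_,
      fun l => ?_⟩, rfl⟩
    · refine Submodule.sum_mem _ fun v _ => ?_
      refine mul_mem_form (a := α l + 1 - α v) (Submodule.sum_mem _ fun u _ => ?_) (hA v j) (by ring)
      refine mul_mem_form (hA u i) (hx (Sum.inr (l, _))) ?_
      simp only [paramDegree, Sum.elim_inr]
      -- The degree of the entry is symmetric in `u` and `v`, but is recorded through their minimum
      -- and maximum.
      rcases le_total u v with huv | huv
      · simp only [min_eq_left huv, max_eq_right huv]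
        ring
      · simp only [min_eq_right huv, max_eq_left huv]
        ring
    · simp only [Matrix.transpose_mul, Matrix.transpose_transpose, symMatrix_transpose,
        Matrix.mul_assoc]
    · simp only [Matrix.mul_assoc, h.mul_eq_zero, Matrix.mul_zero]
      ext; simp [vecMulVec_apply]
  · rintro ⟨⟨h1, h2, h3, h4, h5⟩, h6⟩
    obtain rfl : P = 0 := h6
    choose N hNd hNs hN using fun l => h.exists_conj hA (h3 l) (h4 l) ((h5 l).trans (by ext; simp [vecMulVec_apply]))
    refine ⟨Sum.elim Q fun p => N p.1 p.2.1.1 p.2.1.2, mem_formPi.2 ?_, ?_⟩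
    · rintro (p | p)
      · exact mem_formPi.1 h2 p
      · exact hNd p.1 _ _
    · refine Prod.ext rfl (Prod.ext rfl (funext fun l => ?_))
      have : symMatrix (fun p => N l p.1.1 p.1.2) = N l := by
        refine funext fun u => funext fun v => ?_
        simp only [symMatrix]
        rcases le_total u v with huv | huv
        · rw [min_eq_left huv, max_eq_right huv]
        · rw [min_eq_right huv, max_eq_left huv]
          exact congrFun (congrFun (hNs l) u) v
      simp only [paramMap, LinearMap.coe_mk, AddHom.coe_mk, Sum.elim_inr, this]
      exact (hN l).symm

/-- The map `λ ↦ Bᵗ λ`. -/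
noncomputable def rowMap (B : Matrix κ τ (LineRing K)) : (κ → LineRing K) →ₗ[K] (τ → LineRing K) :=
  B.vecMulLinear.restrictScalars K

/-- These are the sections given by the derivations `∑ y_j ∂/∂x_j` with `y_j` linear in `t, u`: they
send `x_i x_j` to `x_i y_j + y_i x_j` and `F_s` to `∑ y_j b_{js}`. The relation holds because `A B =
0`. -/
lemma IsLineExact.map_rowMap_le (h : IsLineExact A B) (hA : RowForms A α) (hB : ColForms B β) :
    (formPi K fun _ => 1).map (rowMap B) ≤
      (normalData A B α β).map (LinearMap.fst K _ _) := by
  rintro _ ⟨y, hy, rfl⟩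
  refine ⟨(vecMul y B, 0, fun l => vecMulVec (A l) y + vecMulVec y (A l)), ⟨?_, zero_mem _, ?_, ?_, ?_⟩, rfl⟩
  · simpa only [add_comm] using hB.vecMul_mem hy
  · intro l i j
    have hy' := mem_formPi.1 hy
    exact add_mem (mul_mem_form (hA l i) (hy' j) rfl) (mul_mem_form (hy' i) (hA l j) (add_comm _ _))
  · intro l
    rw [Matrix.transpose_add, Matrix.transpose_vecMulVec, Matrix.transpose_vecMulVec, add_comm]
  · intro l
    have h0 : vecMul (A l) B = 0 := congrFun h.mul_eq_zero l
    simp only [Matrix.add_mul, Matrix.vecMulVec_mul, h0]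
    ext; simp [vecMulVec_apply]

/-- A linear vector `y` killed by `B` is `w A` with `w_l` of degree `1 - α_l`, which is negative.
This is where `α_l ≥ 2` enters. -/
lemma IsLineExact.finrank_map_rowMap (h : IsLineExact A B) (hA : RowForms A α)
    (hα : ∀ l, 2 ≤ α l) :
    Module.finrank K ((formPi K fun _ => 1).map (rowMap B)) = 2 * Fintype.card κ := by
  rw [finrank_map_of_injOn]
  · zify
    rw [finrank_formPi]
    simp [mul_comm]
  · intro y hy hy0
    obtain ⟨w, hw, rfl⟩ := h.dual_form hA hy hy0
    have : w = 0 := by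
      ext1 l
      have := mem_formPi.1 hw l
      rw [form_of_neg (by have := hα l; omega)] at this
      exact this
    rw [this, zero_vecMul]

lemma IsLineExact.finite_normalData (h : IsLineExact A B) (hA : RowForms A α) :
    Module.Finite K (normalData A B α β) := by
  refine Module.Finite.of_fg (Submodule.fg_of_fg_map_of_fg_inf_ker (LinearMap.fst K _ _) ?_ ?_)
  · have : (normalData A B α β).map (LinearMap.fst K _ _) ≤ formPi K (fun s => (β s : ℤ) + 1) := by
      rintro _ ⟨x, hx, rfl⟩
      exact hx.1
    exact Submodule.FG.of_le (Module.Finite.iff_fg.1 inferInstance) this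
  · rw [← h.map_paramMap hA]
    exact (Module.Finite.iff_fg.1 inferInstance : (formPi K (paramDegree α β)).FG).map _

/-- Rank-nullity for `(P, Q, ψ) ↦ P`, whose kernel is parametrized injectively by forms of known
degrees. -/
lemma IsLineExact.finrank_normalData (h : IsLineExact A B) (hA : RowForms A α) :
    (Module.finrank K (normalData A B α β) : ℤ) =
      Module.finrank K ((normalData A B α β).map (LinearMap.fst K _ _)) +
      ((Fintype.card τ) * ∑ l, (α l : ℤ) + Fintype.card ι * ∑ s, (β s : ℤ) +
        Fintype.card τ * Fintype.card ι +
      ∑ l, ∑ p : {p : ι × ι // p.1 ≤ p.2}, max 0 ((α l : ℤ) - α p.1.1 - α p.1.2 + 2)) := by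
  have := h.finite_normalData (β := β) hA
  rw [← finrank_map_add_finrank_inf_ker (LinearMap.fst K _ _) (normalData A B α β),
    ← h.map_paramMap hA, finrank_map_of_injOn _ _ fun x _ hx =>
      (injective_iff_map_eq_zero _).1 h.paramMap_injective x hx]
  push_cast
  rw [finrank_formPi, Fintype.sum_sum_type, Fintype.sum_prod_type, Fintype.sum_prod_type]
  congr 2
  · simp only [paramDegree, Sum.elim_inl]
    have h1 : ∀ (s : τ) (l : ι), max 0 ((α l : ℤ) + β s + 1) = α l + β s + 1 := fun s l =>
      max_eq_right (by positivity)
    simp only [h1, Finset.sum_add_distrib, Finset.sum_const, Finset.card_univ, nsmul_eq_mul,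
      ← Finset.mul_sum]
    ring
  · simp only [paramDegree, Sum.elim_inr]
    refine Finset.sum_congr rfl fun l _ => Finset.sum_congr rfl fun p _ => ?_
    congr 1
    ring

end Data

end LineRope

namespace LineRope

open MvPolynomial Matrix

set_option linter.unusedSectionVars false

/-! ### The ring of twisted sections of `𝒪_C`, and jets along the line -/

section Thick

variable {K : Type*} [Field K] {r : ℕ} {ι τ : Type*} [Fintype ι] [Fintype τ]

/-- The ring `⨁ H⁰(C, 𝒪_C(d))`, where `𝒪_C` is the split extension of `𝒪_L` by a free module. -/
abbrev Thick (K ι : Type*) [Field K] : Type _ := TrivSqZeroExt (LineRing K) (ι → LineRing K)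

/-- The map `K[x, t, u] → ⨁ H⁰(C, 𝒪_C(d))`. -/
noncomputable def toThick (A : Matrix ι (Fin (r + 1)) (LineRing K)) :
    CoordRing K r →ₐ[K] Thick K ι :=
  aeval (Sum.elim (fun j => TrivSqZeroExt.inr fun l => A l j) fun i => TrivSqZeroExt.inl (X i))

/-- The first order jet along the line. -/
noncomputable abbrev jet : CoordRing K r →ₐ[K] Thick K (Fin (r + 1)) := toThick 1

variable (A : Matrix ι (Fin (r + 1)) (LineRing K))

lemma toThick_X_inl (j : Fin (r + 1)) :
    toThick A (X (Sum.inl j)) = TrivSqZeroExt.inr fun l => A l j := by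
  simp [toThick]

lemma toThick_X_inr (i : Fin 2) :
    toThick A (X (Sum.inr i) : CoordRing K r) = TrivSqZeroExt.inl (X i) := by
  simp [toThick]

lemma toThick_incl (p : LineRing K) : toThick A (incl K r p) = TrivSqZeroExt.inl p := by
  have h : (toThick A).comp (incl K r) =
      TrivSqZeroExt.inlAlgHom K (LineRing K) (ι → LineRing K) := by
    ext1 i
    simp [incl, toThick_X_inr]
  exact DFunLike.congr_fun h p

lemma jet_X_inl (j : Fin (r + 1)) :
    jet (K := K) (X (Sum.inl j)) = TrivSqZeroExt.inr (Pi.single j 1) := by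
  rw [jet, toThick_X_inl]
  congr 1
  ext1 l
  simp [Matrix.one_apply, Pi.single_apply]

lemma toThick_C (c : K) : toThick A (C c : CoordRing K r) = TrivSqZeroExt.inl (C c) := by
  have := toThick_incl A (C c : LineRing K)
  simpa [incl] using this

/-- The variables `x_j` go to square-zero elements with zero products, so the image of `F` depends
only on its first order Taylor expansion along `L`. -/
lemma toThick_eq (F : CoordRing K r) :
    toThick A F = TrivSqZeroExt.inl (jet F).fst + TrivSqZeroExt.inr (A.mulVec (jet F).snd) := by
  induction F using MvPolynomial.induction_on with
  | C c =>
    rw [toThick_C, toThick_C]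
    ext <;> simp
  | add p q hp hq =>
    rw [map_add, hp, hq]
    simp only [map_add, TrivSqZeroExt.fst_add, TrivSqZeroExt.snd_add, Matrix.mulVec_add,
      TrivSqZeroExt.inl_add, TrivSqZeroExt.inr_add]
    abel
  | mul_X p i hp =>
    rw [map_mul, hp, map_mul]
    rcases i with j | i
    · rw [toThick_X_inl, jet_X_inl]
      ext l
      · simp
      · simp [Matrix.mulVec_smul]
    · rw [toThick_X_inr, toThick_X_inr]
      ext l
      · simp
      · simp [Matrix.mulVec_smul]

lemma toThick_fst (F : CoordRing K r) : (toThick A F).fst = (jet F).fst := by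
  rw [toThick_eq]; simp

lemma toThick_snd (F : CoordRing K r) : (toThick A F).snd = A.mulVec (jet F).snd := by
  rw [toThick_eq]; simp

lemma sub_jet_mem_sq (F : CoordRing K r) :
    F - (incl K r (jet F).fst + ∑ j, X (Sum.inl j) * incl K r ((jet F).snd j)) ∈
      lineIdeal K r ^ 2 := by
  have hx : ∀ j : Fin (r + 1), (X (Sum.inl j) : CoordRing K r) ∈ lineIdeal K r :=
    fun j => Ideal.subset_span ⟨j, rfl⟩
  induction F using MvPolynomial.induction_on with
  | C c =>
    have h0 : incl K r (C c) = C c := by simp [incl]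
    rw [toThick_C, TrivSqZeroExt.fst_inl, TrivSqZeroExt.snd_inl, h0]
    simp
  | add p q hp hq =>
    convert add_mem hp hq using 1
    simp only [map_add, TrivSqZeroExt.fst_add, TrivSqZeroExt.snd_add, Pi.add_apply, mul_add,
      Finset.sum_add_distrib]
    ring
  | mul_X p i hp =>
    rcases i with j | i
    · have h1 : incl K r (jet (p * X (Sum.inl j))).fst = 0 := by simp [jet_X_inl]
      have h2 : ∑ i, X (Sum.inl i) * incl K r ((jet (p * X (Sum.inl j))).snd i) =
          X (Sum.inl j) * incl K r (jet p).fst := by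
        rw [Finset.sum_eq_single j]
        · simp [jet_X_inl]
        · intro i _ hi
          simp [jet_X_inl, hi]
        · simp
      rw [h1, h2, zero_add]
      have h3 : p * X (Sum.inl j) - X (Sum.inl j) * incl K r (jet p).fst =
        X (Sum.inl j) * (p - (incl K r (jet p).fst +
          ∑ j, X (Sum.inl j) * incl K r ((jet p).snd j))) +
        X (Sum.inl j) * ∑ j, X (Sum.inl j) * incl K r ((jet p).snd j) := by ring
      rw [h3]
      refine add_mem (Ideal.mul_mem_left _ _ hp) ?_
      rw [pow_two]
      exact Ideal.mul_mem_mul (hx j) (Ideal.sum_mem _ fun i _ => Ideal.mul_mem_right _ _ (hx i))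
    · convert Ideal.mul_mem_left _ (X (Sum.inr i)) hp using 1
      have h0 : incl K r (X i) = X (Sum.inr i) := by simp [incl]
      simp only [map_mul, toThick_X_inr, TrivSqZeroExt.fst_mul, TrivSqZeroExt.snd_mul,
        TrivSqZeroExt.fst_inl, TrivSqZeroExt.snd_inl, smul_zero, zero_add, op_smul_eq_smul,
        Pi.smul_apply, smul_eq_mul, h0, mul_sub, mul_add, Finset.mul_sum]
      congr 1
      · ring
      · congr 1
        · ring
        · exact Finset.sum_congr rfl fun _ _ => by ring

variable {A} {k : ℕ} {B : Matrix (Fin (r + 1)) (Fin k) (LineRing K)}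

lemma jet_formOfColumn (s : Fin k) :
    jet (formOfColumn B s) = TrivSqZeroExt.inr fun j => B j s := by
  have h : ∀ j, jet (X (Sum.inl j) * incl K r (B j s)) =
      TrivSqZeroExt.inr (Pi.single j (B j s)) := by
    intro j
    rw [map_mul, jet_X_inl, toThick_incl, TrivSqZeroExt.inr_mul_inl, op_smul_eq_smul,
      ← Pi.single_smul, smul_eq_mul, mul_one]
  simp only [formOfColumn, map_sum, h]
  rw [← TrivSqZeroExt.inr_sum, Finset.univ_sum_single fun j => B j s]

lemma jet_fst_of_mem {F : CoordRing K r} (hF : F ∈ lineIdeal K r) : (jet F).fst = 0 := by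
  have : lineIdeal K r ≤ RingHom.ker
      ((TrivSqZeroExt.fstHom K (LineRing K) (Fin (r + 1) → LineRing K)).comp jet) := by
    refine Ideal.span_le.2 ?_
    rintro _ ⟨j, rfl⟩
    simp [RingHom.mem_ker, jet_X_inl]
  exact this hF

/-- If `F` maps to zero, then modulo `I_L²` it is `∑ x_j v_j` with `A v = 0`. Exactness gives `v = B
c`, that is `F ≡ ∑ c_s F_s`. -/
lemma toThick_eq_zero_iff (h : IsLineExact A B) {F : CoordRing K r} :
    toThick A F = 0 ↔ F ∈ lineIdeal K r ^ 2 ⊔ Ideal.span (Set.range (formOfColumn B)) := by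
  constructor
  · intro h0
    have h1 : (jet F).fst = 0 := by rw [← toThick_fst A, h0]; rfl
    have h2 : A.mulVec (jet F).snd = 0 := by rw [← toThick_snd A, h0]; rfl
    obtain ⟨c, hc⟩ := h.exact _ h2
    have h3 := sub_jet_mem_sq F
    have h4 : ∑ j, X (Sum.inl j) * incl K r ((jet F).snd j) =
        ∑ s, incl K r (c s) * formOfColumn B s := by
      simp only [hc, Matrix.mulVec, dotProduct, map_sum, map_mul, formOfColumn, Finset.mul_sum]
      rw [Finset.sum_comm]
      exact Finset.sum_congr rfl fun _ _ => Finset.sum_congr rfl fun _ _ => by ring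
    rw [h1, map_zero, zero_add, h4] at h3
    rw [← sub_add_cancel F (∑ s, incl K r (c s) * formOfColumn B s)]
    refine add_mem (Ideal.mem_sup_left h3) (Ideal.mem_sup_right ?_)
    exact Ideal.sum_mem _ fun s _ => Ideal.mul_mem_left _ _ (Ideal.subset_span ⟨s, rfl⟩)
  · intro hF
    have : lineIdeal K r ^ 2 ⊔ Ideal.span (Set.range (formOfColumn B)) ≤
        RingHom.ker (toThick A) := by
      refine sup_le ?_ (Ideal.span_le.2 ?_)
      · rw [pow_two, lineIdeal, Ideal.span_mul_span', Ideal.span_le]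
        rintro _ ⟨_, ⟨i, rfl⟩, _, ⟨j, rfl⟩, rfl⟩
        rw [SetLike.mem_coe, RingHom.mem_ker]
        simp [toThick_X_inl]
      · rintro _ ⟨s, rfl⟩
        rw [SetLike.mem_coe, RingHom.mem_ker, toThick_eq, jet_formOfColumn]
        have h1 : A.mulVec (fun j => B j s) = 0 :=
          funext fun l => congrFun (congrFun h.mul_eq_zero l) s
        simp [h1]
    exact this hF

/-! ### The second order part -/

open Classical in
/-- The values on monomials of the map that sends `x_i x_j` to `ψ_{i j}` and that vanishes on
monomials of degree other than `2`. -/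
noncomputable def quadValue (ψ : ι → Matrix (Fin (r + 1)) (Fin (r + 1)) (LineRing K))
    (m : Fin (r + 1) →₀ ℕ) : ι → LineRing K :=
  if h : ∃ p : Fin (r + 1) × Fin (r + 1), m = Finsupp.single p.1 1 + Finsupp.single p.2 1 then
    fun l => ψ l h.choose.1 h.choose.2
  else 0

/-- The pair picked by choice is `(i, j)` or `(j, i)`; symmetry of `ψ` makes the two values equal.
-/
lemma quadValue_single_add_single
    {ψ : ι → Matrix (Fin (r + 1)) (Fin (r + 1)) (LineRing K)} (hψ : ∀ l, (ψ l)ᵀ = ψ l)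
    (i j : Fin (r + 1)) :
    quadValue ψ (Finsupp.single i 1 + Finsupp.single j 1) = fun l => ψ l i j := by
  have h : ∃ p : Fin (r + 1) × Fin (r + 1), Finsupp.single i 1 + Finsupp.single j 1 =
    Finsupp.single p.1 1 + Finsupp.single p.2 1 := ⟨(i, j), rfl⟩
  rw [quadValue, dif_pos h]
  have h1 := h.choose_spec
  rw [Finsupp.single_add_single_eq_single_add_single one_ne_zero one_ne_zero] at h1
  ext1 l
  rcases h1 with ⟨h1, h2⟩ | ⟨_, h1, h2⟩ | ⟨h1, h2, _⟩
  · rw [← h1, ← h2]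
  · rw [← h1, ← h2]
    exact (congrFun (congrFun (hψ l) i) j)
  · simp at h1

/-- The map that sends `x_i x_j` to `ψ_{i j}` and that vanishes on monomials of degree other
than `2` in the `x_j`. -/
noncomputable def quad (ψ : ι → Matrix (Fin (r + 1)) (Fin (r + 1)) (LineRing K)) :
    CoordRing K r →ₗ[K] (ι → LineRing K) :=
  (((basisMonomials (Fin (r + 1)) (LineRing K)).constr (LineRing K)
    (quadValue ψ)).restrictScalars K).comp (sumAlgEquiv K (Fin (r + 1)) (Fin 2)).toLinearMap

lemma jet_eq_coeff (F : CoordRing K r) :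
    (jet F).fst = coeff 0 (sumAlgEquiv K (Fin (r + 1)) (Fin 2) F) ∧
    ∀ j, (jet F).snd j = coeff (Finsupp.single j 1) (sumAlgEquiv K (Fin (r + 1)) (Fin 2) F) := by
  classical
  induction F using MvPolynomial.induction_on with
  | C c =>
    rw [toThick_C, sumAlgEquiv_C_inl]
    refine ⟨by simp, fun j => ?_⟩
    rw [coeff_C, if_neg (Ne.symm (Finsupp.single_ne_zero.2 one_ne_zero))]
    simp
  | add p q hp hq =>
    simp only [map_add, TrivSqZeroExt.fst_add, TrivSqZeroExt.snd_add, Pi.add_apply, coeff_add, hp.1,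
      hq.1, hp.2, hq.2, implies_true, and_self]
  | mul_X p i hp =>
    rcases i with i | i
    · rw [map_mul, map_mul, jet_X_inl, sumAlgEquiv_X_inl]
      refine ⟨by simp [coeff_mul_X'], fun j => ?_⟩
      rw [coeff_mul_X']
      by_cases hij : i = j
      · subst hij
        simp [hp.1]
      · simp [hp.1, hij, Ne.symm hij]
    · rw [map_mul, map_mul, toThick_X_inr, sumAlgEquiv_X_inr]
      rw [mul_comm _ (C _)]
      refine ⟨by rw [coeff_C_mul]; simp [hp.1, mul_comm], fun j => ?_⟩
      rw [coeff_C_mul]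
      simp [hp.2, mul_comm]

variable {ψ : ι → Matrix (Fin (r + 1)) (Fin (r + 1)) (LineRing K)}

lemma quad_incl_mul (p : LineRing K) (F : CoordRing K r) :
    quad ψ (incl K r p * F) = p • quad ψ F := by
  have h : sumAlgEquiv K (Fin (r + 1)) (Fin 2) (incl K r p) = C p := by
    have := DFunLike.congr_fun
      (sumAlgEquiv_comp_rename_inr (R := K) (S₁ := Fin (r + 1)) (S₂ := Fin 2)) p
    exact this
  simp only [quad, LinearMap.comp_apply, AlgEquiv.toLinearMap_apply, map_mul, h, ← smul_eq_C_mul,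
    LinearMap.restrictScalars_apply, map_smul]

/-- The part of `x_i F` quadratic in the `x_j` is `x_i` times the linear part of `F`. -/
lemma quad_X_inl_mul (hψ : ∀ l, (ψ l)ᵀ = ψ l) (i : Fin (r + 1)) (F : CoordRing K r) :
    quad ψ (X (Sum.inl i) * F) = fun l => ∑ j, ψ l i j * (jet F).snd j := by
  classical
  simp only [(jet_eq_coeff F).2, quad, LinearMap.comp_apply, AlgEquiv.toLinearMap_apply, map_mul,
    sumAlgEquiv_X_inl, LinearMap.restrictScalars_apply]
  generalize sumAlgEquiv K (Fin (r + 1)) (Fin 2) F = p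
  induction p using MvPolynomial.induction_on' with
  | monomial m a =>
    have h1 : X i * monomial m a = a • basisMonomials (Fin (r + 1)) (LineRing K)
        (Finsupp.single i 1 + m) := by
      rw [coe_basisMonomials, X, monomial_mul, one_mul, smul_monomial, smul_eq_mul, mul_one]
    rw [h1, map_smul, Module.Basis.constr_basis]
    by_cases hm : ∃ j, m = Finsupp.single j 1
    · obtain ⟨j, rfl⟩ := hm
      rw [quadValue_single_add_single hψ]
      ext1 l
      simp only [coeff_monomial, Pi.smul_apply, smul_eq_mul, Finsupp.single_left_inj one_ne_zero]
      simp [mul_comm]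
    · have h2 : quadValue ψ (Finsupp.single i 1 + m) = 0 := by
        rw [quadValue, dif_neg]
        rintro ⟨⟨u, v⟩, huv⟩
        apply hm
        have h3 : i = u ∨ i = v := by
          have := DFunLike.congr_fun huv i
          simp only [Finsupp.add_apply, Finsupp.single_apply, if_true] at this
          by_contra hcon
          push Not at hcon
          simp [hcon.1.symm, hcon.2.symm] at this
        rcases h3 with rfl | rfl
        · exact ⟨v, add_left_cancel huv⟩
        · rw [add_comm (Finsupp.single u 1)] at huv
          exact ⟨u, add_left_cancel huv⟩
      rw [h2]
      ext1 l
      rw [smul_zero, Pi.zero_apply, eq_comm]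
      refine Finset.sum_eq_zero fun j _ => ?_
      rw [coeff_monomial, if_neg fun h => hm ⟨j, h⟩, mul_zero]
  | add p q hp hq =>
    rw [mul_add, map_add, hp, hq]
    ext1 l
    simp only [Pi.add_apply, coeff_add, mul_add, Finset.sum_add_distrib]

/-- With subscripts for the degree in the `x_j`, `(aF)₂ = a₀F₂ + a₁F₁` because `F₀ = 0`. The term
`a₁F₁` is the failure of `quad` to be linear over the coordinate ring, compensated later by the
relation between `ψ` and `P`. -/
lemma quad_mul (hψ : ∀ l, (ψ l)ᵀ = ψ l) (a : CoordRing K r) {F : CoordRing K r}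
    (hF : (jet F).fst = 0) :
    quad ψ (a * F) = (jet a).fst • quad ψ F +
      fun l => ∑ i, (jet a).snd i * ∑ j, ψ l i j * (jet F).snd j := by
  induction a using MvPolynomial.induction_on generalizing F with
  | C c =>
    have h1 : (C c : CoordRing K r) = incl K r (C c) := by simp [incl]
    rw [h1, quad_incl_mul, toThick_incl]
    ext1 l
    simp
  | add p q hp hq =>
    rw [add_mul, map_add, hp hF, hq hF]
    ext1 l
    simp only [map_add, TrivSqZeroExt.fst_add, TrivSqZeroExt.snd_add, Pi.add_apply, Pi.smul_apply,
      add_mul, add_smul, Finset.sum_add_distrib]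
    abel
  | mul_X p i hp =>
    rcases i with i | i
    · have hXF : jet (X (Sum.inl i) * F) = 0 := by
        rw [map_mul, jet_X_inl]
        ext <;> simp [hF]
      rw [mul_assoc, hp (by rw [hXF]; rfl), hXF, quad_X_inl_mul hψ]
      ext1 l
      simp only [Pi.add_apply, Pi.smul_apply, map_mul, jet_X_inl]
      simp [Pi.single_apply]
    · have h1 : (X (Sum.inr i) : CoordRing K r) = incl K r (X i) := by simp [incl]
      have hXF : jet (X (Sum.inr i) * F) = TrivSqZeroExt.inl (X i) * jet F := by
        rw [map_mul, toThick_X_inr]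
      rw [mul_assoc, hp (by rw [hXF]; simp [hF]), hXF, h1, quad_incl_mul, ← h1, map_mul,
        toThick_X_inr]
      ext1 l
      simp only [Pi.add_apply, Pi.smul_apply]
      simp only [TrivSqZeroExt.fst_mul, TrivSqZeroExt.snd_mul, TrivSqZeroExt.fst_inl,
        TrivSqZeroExt.snd_inl, smul_zero, zero_add, add_zero, op_smul_eq_smul, Pi.smul_apply,
        smul_eq_mul, Pi.add_apply, Pi.zero_apply, mul_assoc]
      congr 1
      refine Finset.sum_congr rfl fun u _ => ?_
      simp only [Finset.mul_sum]
      exact Finset.sum_congr rfl fun v _ => by ring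

end Thick

end LineRope

namespace LineRope

open MvPolynomial Matrix

set_option linter.unusedSectionVars false

/-! ### The grading on the ring of sections -/

section Grading

variable {K : Type*} [Field K] {r : ℕ} {ι : Type*} [Fintype ι]

/-- The component `H⁰(C, 𝒪_C(d))` of degree `d`. -/
noncomputable def thickForm (α : ι → ℕ) (d : ℤ) : Submodule K (Thick K ι) where
  carrier := {x | x.fst ∈ form (Fin 2) K d ∧ ∀ l, x.snd l ∈ form (Fin 2) K (d - 1 + α l)}
  add_mem' hx hy := ⟨add_mem hx.1 hy.1, fun l => add_mem (hx.2 l) (hy.2 l)⟩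
  zero_mem' := ⟨zero_mem _, fun _ => zero_mem _⟩
  smul_mem' c _ hx := ⟨Submodule.smul_mem _ c hx.1, fun l => Submodule.smul_mem _ c (hx.2 l)⟩

/-- The projection to `H⁰(C, 𝒪_C(d))`. -/
noncomputable def thickProj (α : ι → ℕ) (d : ℤ) : Thick K ι →+ Thick K ι where
  toFun x := TrivSqZeroExt.inl (formProj d x.fst) +
    TrivSqZeroExt.inr fun l => formProj (d - 1 + α l) (x.snd l)
  map_add' x y := by ext <;> simp
  map_zero' := by ext <;> simp

variable {α : ι → ℕ} {A : Matrix ι (Fin (r + 1)) (LineRing K)}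

lemma thickProj_of_mem {d : ℤ} {x : Thick K ι} (hx : x ∈ thickForm α d) : thickProj α d x = x := by
  ext1
  · simp [thickProj, formProj_of_mem hx.1]
  · ext1 l
    simp [thickProj, formProj_of_mem (hx.2 l)]

lemma thickProj_of_mem_ne {d e : ℤ} {x : Thick K ι} (hx : x ∈ thickForm α d) (h : d ≠ e) :
    thickProj α e x = 0 := by
  ext1
  · simp [thickProj, formProj_of_mem_ne hx.1 h]
  · ext1 l
    simp [thickProj, formProj_of_mem_ne (hx.2 l) (by omega : d - 1 + α l ≠ e - 1 + α l)]

lemma thickForm_mul {a b c : ℤ} {x y : Thick K ι} (hx : x ∈ thickForm α a)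
    (hy : y ∈ thickForm α b) (h : a + b = c) : x * y ∈ thickForm α c := by
  refine ⟨?_, fun l => ?_⟩
  · rw [TrivSqZeroExt.fst_mul]
    exact mul_mem_form hx.1 hy.1 h
  · rw [TrivSqZeroExt.snd_mul, op_smul_eq_smul]
    exact add_mem (mul_mem_form hx.1 (hy.2 l) (by omega)) (mul_mem_form hy.1 (hx.2 l) (by omega))

lemma thickForm_pow {a : ℤ} {x : Thick K ι} (hx : x ∈ thickForm α a) (n : ℕ) :
    x ^ n ∈ thickForm α (n * a) := by
  induction n with
  | zero =>
    refine ⟨?_, fun l => by simp⟩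
    simpa using mem_form_natCast.2 (isHomogeneous_one (Fin 2) K)
  | succ n ih =>
    rw [pow_succ]
    exact thickForm_mul ih hx (by push_cast; ring)

/-- To show that a linear map is compatible with gradings it is enough to treat products of
variables. -/
lemma form_induction {σ : Type*} {P : ℤ → MvPolynomial σ K → Prop} (zero : ∀ d, P d 0)
    (add : ∀ d p q, P d p → P d q → P d (p + q)) (C : ∀ c : K, P 0 (C c))
    (mul_X : ∀ d p i, P d p → P (d + 1) (p * X i)) {d : ℤ} {F : MvPolynomial σ K}
    (hF : F ∈ form σ K d) : P d F := by
  have hmon : ∀ (m : σ →₀ ℕ) (c : K), P m.degree (monomial m c) := by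
    intro m c
    have h : ∃ e : ℤ, monomial m c ∈ form σ K e ∧ P e (monomial m c) := by
      refine induction_on_monomial (motive := fun p => ∃ e : ℤ, p ∈ form σ K e ∧ P e p)
        (fun a => ?_) (fun p n ih => ?_) m c
      · exact ⟨0, by simpa using mem_form_natCast.2 (isHomogeneous_C σ a), C a⟩
      · obtain ⟨e, he, he'⟩ := ih
        exact ⟨e + 1, mul_mem_form he (X_mem_form n) rfl, mul_X e p n he'⟩
    obtain ⟨e, he, he'⟩ := h
    by_cases hc : c = 0
    · subst hc
      rw [monomial_zero]
      exact zero _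
    · rwa [mem_form.1 he m (by classical rwa [coeff_monomial, if_pos rfl])]
  rw [F.as_sum]
  refine Finset.sum_induction _ (P d) (add d) (zero d) fun m hm => ?_
  rw [← mem_form.1 hF m (by simpa using hm)]
  exact hmon m _

/-- With `z_l` in degree `1 - α_l`, the image `∑ a_{lj} z_l` of `x_j` has degree one. -/
lemma toThick_mem (hA : RowForms A α) {d : ℤ} {F : CoordRing K r}
    (hF : F ∈ form (Fin (r + 1) ⊕ Fin 2) K d) : toThick A F ∈ thickForm α d := by
  refine form_induction (P := fun d F => toThick A F ∈ thickForm α d)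
    (fun d => by rw [map_zero]; exact zero_mem _)
    (fun d p q hp hq => by rw [map_add]; exact add_mem hp hq) (fun c => ?_)
    (fun d p i hp => ?_) hF
  · rw [toThick_C]
    refine ⟨?_, fun l => by simp⟩
    simpa using mem_form_natCast.2 (isHomogeneous_C (Fin 2) c)
  · rw [map_mul]
    refine thickForm_mul hp ?_ rfl
    rcases i with j | i
    · rw [toThick_X_inl]
      exact ⟨by simp, fun l => by simpa using hA l j⟩
    · rw [toThick_X_inr]
      exact ⟨by simpa using X_mem_form i, fun l => by simp⟩

lemma jet_mem {d : ℤ} {F : CoordRing K r} (hF : F ∈ form (Fin (r + 1) ⊕ Fin 2) K d) :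
    (jet F).fst ∈ form (Fin 2) K d ∧ ∀ j, (jet F).snd j ∈ form (Fin 2) K (d - 1) := by
  have h : RowForms (1 : Matrix (Fin (r + 1)) (Fin (r + 1)) (LineRing K)) fun _ => 0 := by
    intro l j
    rw [Matrix.one_apply]
    split_ifs
    · simpa using mem_form_natCast.2 (isHomogeneous_one (Fin 2) K)
    · exact zero_mem _
  have := toThick_mem h hF
  exact ⟨this.1, fun j => by simpa using this.2 j⟩

lemma quad_mem {ψ : ι → Matrix (Fin (r + 1)) (Fin (r + 1)) (LineRing K)}
    (hψ : ∀ l, (ψ l)ᵀ = ψ l) (hψd : ∀ l i j, ψ l i j ∈ form (Fin 2) K (α l + 1)) {d : ℤ}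
    {F : CoordRing K r} (hF : F ∈ form (Fin (r + 1) ⊕ Fin 2) K d) :
    ∀ l, quad ψ F l ∈ form (Fin 2) K (d - 1 + α l) := by
  -- Homogeneity of `F` is carried through the induction, since multiplication by `x_i` involves the
  -- degree of the linear part of `F`.
  refine (form_induction (P := fun d F => F ∈ form (Fin (r + 1) ⊕ Fin 2) K d ∧
    ∀ l, quad ψ F l ∈ form (Fin 2) K (d - 1 + α l))
    (fun d => by simp) (fun d p q hp hq => ⟨add_mem hp.1 hq.1, fun l => ?_⟩)
    (fun c => ⟨by simpa using mem_form_natCast.2 (isHomogeneous_C _ c), fun l => ?_⟩)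
    (fun d p i hp => ⟨mul_mem_form hp.1 (X_mem_form i) rfl, fun l => ?_⟩) hF).2
  · rw [map_add]
    exact add_mem (hp.2 l) (hq.2 l)
  · have h0 : quad ψ (C c : CoordRing K r) = 0 := by
      have h1 : (C c : CoordRing K r) = incl K r (C c) * 1 := by simp [incl]
      have h2 : quad ψ (1 : CoordRing K r) = 0 := by
        have h3 : (1 : MvPolynomial (Fin (r + 1)) (LineRing K)) = basisMonomials _ _ 0 := by
          rw [coe_basisMonomials]; rfl
        rw [quad, LinearMap.comp_apply, AlgEquiv.toLinearMap_apply, map_one, h3,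
          LinearMap.restrictScalars_apply, Module.Basis.constr_basis, quadValue, dif_neg]
        rintro ⟨p, hp⟩
        have := DFunLike.congr_fun hp p.1
        simp only [Finsupp.add_apply, Finsupp.single_eq_same, Finsupp.zero_apply] at this
        omega
      rw [h1, quad_incl_mul, h2, smul_zero]
    rw [h0]
    exact zero_mem _
  · rcases i with i | i
    · rw [mul_comm, quad_X_inl_mul hψ]
      exact Submodule.sum_mem _ fun j _ => mul_mem_form (hψd l i j) ((jet_mem hp.1).2 j) (by ring)
    · have h1 : (X (Sum.inr i) : CoordRing K r) = incl K r (X i) := by simp [incl]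
      rw [mul_comm, h1, quad_incl_mul]
      exact mul_mem_form (X_mem_form i) (hp.2 l) (by ring)

lemma toThick_formProj (hA : RowForms A α) (e : ℤ) (F : CoordRing K r) :
    toThick A (formProj e F) = thickProj α e (toThick A F) := by
  induction F using MvPolynomial.induction_on' with
  | monomial m a =>
    have hm := monomial_mem_form m a
    by_cases h : (m.degree : ℤ) = e
    · subst h
      rw [formProj_of_mem hm, thickProj_of_mem (toThick_mem hA hm)]
    · rw [formProj_of_mem_ne hm h, thickProj_of_mem_ne (toThick_mem hA hm) h, map_zero]
  | add p q hp hq => simp only [map_add, hp, hq]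

lemma exists_form_of_toThick_mem (hA : RowForms A α) {e : ℤ} {F : CoordRing K r}
    (hF : toThick A F ∈ thickForm α e) :
    ∃ G ∈ form (Fin (r + 1) ⊕ Fin 2) K e, toThick A G = toThick A F :=
  ⟨formProj e F, formProj_mem _ _, by rw [toThick_formProj hA, thickProj_of_mem hF]⟩

variable {τ : Type*} [Fintype τ] {B : Matrix (Fin (r + 1)) τ (LineRing K)}

lemma toThick_sum (v : Fin (r + 1) → LineRing K) :
    toThick A (∑ j, X (Sum.inl j) * incl K r (v j)) = TrivSqZeroExt.inr (A.mulVec v) := by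
  simp only [map_sum, map_mul, toThick_X_inl, toThick_incl]
  ext1
  · simp [TrivSqZeroExt.fst_sum]
  · ext1 l
    simp [TrivSqZeroExt.snd_sum, Matrix.mulVec, dotProduct, mul_comm]

/-- The cokernel of the map to `⨁ H⁰(C, 𝒪_C(d))` is supported at the irrelevant ideal. -/
lemma IsLineExact.exists_pow_mul_mem_range (h : IsLineExact A B) (x : Thick K ι) {d : ℕ} (hd : 0 < d)
    {f : CoordRing K r} (hf : f ∈ form (Fin (r + 1) ⊕ Fin 2) K d) :
    ∃ (M : ℕ) (G : CoordRing K r), toThick A G = toThick A f ^ M * x := by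
  -- The ideal of all `a` that multiply `x` into the image. Its radical contains every variable:
  -- `x_j²` maps to zero, and powers of `t`, `u` make the `z`-part liftable through `A`. Forms of
  -- positive degree thus lie in the radical.
  let J : Ideal (CoordRing K r) :=
    { carrier := {a | ∃ G, toThick A G = toThick A a * x}
      add_mem' := by
        rintro a b ⟨G, hG⟩ ⟨H, hH⟩
        exact ⟨G + H, by rw [map_add, hG, hH, map_add, add_mul]⟩
      zero_mem' := ⟨0, by simp⟩
      smul_mem' := by
        rintro c a ⟨G, hG⟩
        exact ⟨c * G, by rw [map_mul, hG, smul_eq_mul, map_mul, mul_assoc]⟩ }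
  have hX : ∀ i, X i ∈ J.radical := by
    rintro (j | i)
    · refine ⟨2, 0, ?_⟩
      rw [map_pow, toThick_X_inl, pow_two, TrivSqZeroExt.inr_mul_inr, map_zero, zero_mul]
    · obtain ⟨N, hN⟩ := h.surj
      obtain ⟨v, hv⟩ := hN i x.snd
      refine ⟨N, incl K r (X i ^ N * x.fst) + ∑ j, X (Sum.inl j) * incl K r (v j), ?_⟩
      rw [map_add, toThick_sum, hv, toThick_incl, map_pow, toThick_X_inr, TrivSqZeroExt.inl_pow]
      ext1 <;> simp
  have hJ : f ∈ J.radical := by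
    rw [f.as_sum]
    refine Ideal.sum_mem _ fun m hm => ?_
    have h1 := mem_form.1 hf m (by simpa using hm)
    have h2 : m ≠ 0 := by
      rintro rfl
      simp at h1
      omega
    obtain ⟨i, hi⟩ := Finsupp.ne_iff.1 h2
    refine Ideal.mem_of_dvd _ ?_ (hX i)
    rw [X_dvd_monomial]
    exact Or.inr hi
  obtain ⟨M, G, hG⟩ := hJ
  exact ⟨M, G, by rw [hG, map_pow]⟩

lemma IsLineExact.exists_form_pow_mul (h : IsLineExact A B) (hA : RowForms A α) {d : ℕ} (hd : 0 < d)
    {f : CoordRing K r} (hf : f ∈ form (Fin (r + 1) ⊕ Fin 2) K d) {e : ℤ} {x : Thick K ι}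
    (hx : x ∈ thickForm α e) : ∃ (M : ℕ), ∃ G ∈ form (Fin (r + 1) ⊕ Fin 2) K (M * d + e),
      toThick A G = toThick A f ^ M * x := by
  obtain ⟨M, G, hG⟩ := h.exists_pow_mul_mem_range x hd hf
  obtain ⟨G', hG', hG''⟩ := exists_form_of_toThick_mem hA (e := M * d + e) (F := G) (by
    rw [hG]
    exact thickForm_mul (thickForm_pow (toThick_mem hA hf) M) hx rfl)
  exact ⟨M, G', hG', hG''.trans hG⟩

lemma toThick_X_inr_pow (i : Fin 2) (n : ℕ) :
    toThick A (X (Sum.inr i) : CoordRing K r) ^ n = TrivSqZeroExt.inl (X i ^ n) := by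
  rw [toThick_X_inr, TrivSqZeroExt.inl_pow]

lemma inl_mul_eq_zero {p : LineRing K} (hp : p ≠ 0) {x : Thick K ι}
    (h : TrivSqZeroExt.inl p * x = 0) : x = 0 := by
  ext1
  · have := congrArg TrivSqZeroExt.fst h
    simpa [hp] using this
  · ext1 l
    have := congrFun (congrArg TrivSqZeroExt.snd h) l
    simpa [hp] using this

lemma exists_eq_mul_of_inl_mul_eq {N M : ℕ} {x y : Thick K ι}
    (h : TrivSqZeroExt.inl (X 0 ^ N) * x = TrivSqZeroExt.inl (X 1 ^ M) * y) :
    ∃ c : Thick K ι, x = TrivSqZeroExt.inl (X 1 ^ M) * c ∧ y = TrivSqZeroExt.inl (X 0 ^ N) * c := by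
  have h1 := congrArg TrivSqZeroExt.fst h
  have h2 := congrArg TrivSqZeroExt.snd h
  obtain ⟨a, ha, ha'⟩ := exists_eq_mul_of_pow_mul_eq (K := K) (i := (0 : Fin 2)) (j := 1) (by decide)
    (N := N) (M := M) (p := x.fst) (q := y.fst) (by simpa using h1)
  obtain ⟨b, hb, hb'⟩ := exists_eq_smul_of_pow_smul_eq (K := K) (N := N) (M := M) (p := x.snd)
    (q := y.snd) (by simpa using h2)
  refine ⟨TrivSqZeroExt.inl a + TrivSqZeroExt.inr b, ?_, ?_⟩
  · ext1 <;> simp [ha, hb]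
  · ext1 <;> simp [ha', hb']

lemma mem_thickForm_of_inl_mul_mem {p : LineRing K} (hp0 : p ≠ 0) {b d : ℤ}
    (hp : p ∈ form (Fin 2) K b) {x : Thick K ι}
    (h : TrivSqZeroExt.inl p * x ∈ thickForm α d) : x ∈ thickForm α (d - b) := by
  refine ⟨mem_form_of_mul_mem hp hp0 (by simpa using h.1), fun l => ?_⟩
  have := mem_form_of_mul_mem hp hp0 (q := x.snd l) (d := d - 1 + α l) (by simpa using h.2 l)
  convert this using 2
  ring

end Grading

end LineRope

namespace LineRope

set_option linter.unusedSectionVars false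

/-! ### Charts of `C` inside localizations of `T`, and sections defined by homomorphisms -/

section Charts

variable {K R T : Type*} [Field K] [CommRing R] [Algebra K R] [CommRing T] [Algebra K T]
variable {𝒜 : ℕ → Submodule K R} [GradedAlgebra 𝒜] {I : Ideal R} {θ : R →ₐ[K] T}

/-- For `I = ker θ`, the map from the coordinate ring of `C` on `D₊(f)` to `T_f`. -/
noncomputable def chartToAway (hI : ∀ F, F ∈ I ↔ θ F = 0) (f : R) :
    (ChartRing 𝒜 f ⧸ chartIdeal 𝒜 I f) →+* Localization.Away (θ f) :=
  Ideal.Quotient.lift _ ((Localization.awayMap θ.toRingHom f).comp (algebraMap _ _)) fun a ha => by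
    have h : I.map (algebraMap R (Localization.Away f)) ≤
        RingHom.ker (Localization.awayMap θ.toRingHom f) := by
      rw [Ideal.map_le_iff_le_comap]
      intro F hF
      rw [Ideal.mem_comap, RingHom.mem_ker, Localization.awayMap, IsLocalization.Away.map,
        IsLocalization.map_eq]
      have : θ.toRingHom F = 0 := (hI F).1 hF
      rw [this, map_zero]
    exact h ha

/-- The element `F / f ^ n` of `I_(f)`. -/
noncomputable def chartElt (f : PosHomog 𝒜) (n : ℕ) (F : R) (hF : F ∈ I) (hd : F ∈ 𝒜 (n • f.deg)) :
    chartIdeal 𝒜 I f.val :=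
  ⟨HomogeneousLocalization.Away.mk 𝒜 f.mem n F hd, by
    rw [mem_chartIdeal, HomogeneousLocalization.Away.val_mk, Localization.mk_eq_mk',
      IsLocalization.mk'_mem_map_algebraMap_iff]
    exact ⟨1, one_mem _, by simpa using hF⟩⟩

lemma val_mk_mul_pow {f : R} {d : ℕ} (hf : f ∈ 𝒜 d) (n : ℕ) (F : R) (hF : F ∈ 𝒜 (n • d)) :
    (HomogeneousLocalization.Away.mk 𝒜 hf n F hF).val * algebraMap R (Localization.Away f) f ^ n =
      algebraMap R (Localization.Away f) F := by
  rw [HomogeneousLocalization.Away.val_mk, ← map_pow, Localization.mk_eq_mk']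
  exact IsLocalization.mk'_spec _ _ _

lemma isUnit_algebraMap_away {S : Type*} [CommRing S] (f : S) :
    IsUnit (algebraMap S (Localization.Away f) f) :=
  IsLocalization.Away.algebraMap_isUnit f

lemma chartRing_ext {f : R} {a b : ChartRing 𝒜 f} {n : ℕ}
    (h : a.val * algebraMap R (Localization.Away f) f ^ n =
      b.val * algebraMap R (Localization.Away f) f ^ n) : a = b :=
  HomogeneousLocalization.val_injective _ (((isUnit_algebraMap_away f).pow n).mul_right_cancel h)

/-- Fractions are handled throughout by equations cleared of the denominator `f ^ n`, a unit in the
localization. -/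
lemma chartToAway_mk_mul_pow (hI : ∀ F, F ∈ I ↔ θ F = 0) {f : R} {a : ChartRing 𝒜 f} {n : ℕ} {x : R}
    (h : a.val * algebraMap R (Localization.Away f) f ^ n = algebraMap R (Localization.Away f) x) :
    chartToAway hI f (Ideal.Quotient.mk _ a) * algebraMap T (Localization.Away (θ f)) (θ f) ^ n =
      algebraMap T (Localization.Away (θ f)) (θ x) := by
  have key : ∀ y, Localization.awayMap θ.toRingHom f (algebraMap R _ y) =
      algebraMap T (Localization.Away (θ f)) (θ y) := fun y => by
    rw [Localization.awayMap, IsLocalization.Away.map, IsLocalization.map_eq]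
    rfl
  rw [← key, ← key, ← h, map_mul, map_pow]
  rfl

/-- If `θ x` is killed by `θ f ^ m`, then `f ^ m x` lies in `ker θ = I`, so `x / f ^ n` already lies
in the chart ideal. -/
lemma chartToAway_injective (hI : ∀ F, F ∈ I ↔ θ F = 0) (f : PosHomog 𝒜) :
    Function.Injective (chartToAway (𝒜 := 𝒜) hI f.val) := by
  rw [injective_iff_map_eq_zero]
  intro b hb
  obtain ⟨a, rfl⟩ := Ideal.Quotient.mk_surjective b
  obtain ⟨n, x, hx, rfl⟩ := HomogeneousLocalization.Away.mk_surjective 𝒜 f.mem a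
  have h := chartToAway_mk_mul_pow hI (val_mk_mul_pow f.mem n x hx)
  rw [hb, zero_mul, eq_comm, IsLocalization.map_eq_zero_iff (Submonoid.powers (θ f.val))] at h
  obtain ⟨⟨_, m, rfl⟩, hm⟩ := h
  rw [Ideal.Quotient.eq_zero_iff_mem, mem_chartIdeal, HomogeneousLocalization.Away.val_mk,
    Localization.mk_eq_mk', IsLocalization.mk'_mem_map_algebraMap_iff]
  refine ⟨f.val ^ m, ⟨m, rfl⟩, ?_⟩
  rw [hI, map_mul, map_pow]
  exact hm

lemma exists_chartToAway_eq (hI : ∀ F, F ∈ I ↔ θ F = 0) (f : PosHomog 𝒜) {m M : ℕ} {y : T} {G : R}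
    (hG : G ∈ 𝒜 ((M + m) • f.deg)) (hGy : θ G = θ f.val ^ M * y) :
    ∃ b, chartToAway (𝒜 := 𝒜) hI f.val b * algebraMap T _ (θ f.val) ^ m = algebraMap T _ y := by
  refine ⟨Ideal.Quotient.mk _ (HomogeneousLocalization.Away.mk 𝒜 f.mem _ G hG), ?_⟩
  have h := chartToAway_mk_mul_pow hI (val_mk_mul_pow f.mem _ G hG)
  rw [hGy, map_mul, map_pow, pow_add, mul_left_comm] at h
  exact ((isUnit_algebraMap_away (θ f.val)).pow M).mul_left_cancel h

lemma map_val_eq {S : Type*} [CommRing S] (φ : R →+* S) {f g h : PosHomog 𝒜}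
    (hx : h.val = f.val * g.val) : φ h.val = φ f.val * φ g.val := by
  rw [hx, map_mul]

lemma algebraMap_val_eq {f g h : PosHomog 𝒜} (hx : h.val = f.val * g.val) :
    algebraMap T (Localization.Away (θ h.val)) (θ h.val) =
      algebraMap T _ (θ f.val) * algebraMap T _ (θ g.val) :=
  map_val_eq ((algebraMap T (Localization.Away (θ h.val))).comp θ.toRingHom) hx

/-- The restriction map `T_f → T_h`, `h = f g`. -/
noncomputable def awayRes {f g h : PosHomog 𝒜} (hx : h.val = f.val * g.val) :
    Localization.Away (θ f.val) →+* Localization.Away (θ h.val) :=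
  IsLocalization.Away.lift (θ f.val) (g := algebraMap T (Localization.Away (θ h.val))) (by
    have := isUnit_algebraMap_away (θ h.val)
    rw [algebraMap_val_eq hx] at this
    exact isUnit_of_mul_isUnit_left this)

lemma awayRes_algebraMap {f g h : PosHomog 𝒜} (hx : h.val = f.val * g.val) (y : T) :
    awayRes (θ := θ) hx (algebraMap T _ y) = algebraMap T _ y :=
  IsLocalization.Away.lift_eq _ _ _

lemma val_restrict_mul_pow {f g h : PosHomog 𝒜} (hx : h.val = f.val * g.val)
    {a : ChartRing 𝒜 f.val} {n : ℕ} {x : R}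
    (ha : a.val * algebraMap R (Localization.Away f.val) f.val ^ n = algebraMap R _ x) :
    (restrict hx a).val * algebraMap R (Localization.Away h.val) h.val ^ n =
      algebraMap R _ (x * g.val ^ n) := by
  have key : ∀ ψ : Localization.Away f.val →+* Localization.Away h.val,
      ψ.comp (algebraMap R _) = algebraMap R _ →
      ψ a.val * algebraMap R (Localization.Away h.val) h.val ^ n =
      algebraMap R _ (x * g.val ^ n) := by
    intro ψ hψ
    have h2 : ∀ y, algebraMap R (Localization.Away h.val) y = ψ (algebraMap R _ y) := fun y => by
      rw [← hψ]; rfl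
    have h3 := congrArg ψ ha
    rw [map_mul, map_pow, ← h2, ← h2] at h3
    rw [map_mul, map_pow, ← h3, map_val_eq (algebraMap R (Localization.Away h.val)) hx, mul_pow,
      mul_assoc]
  rw [restrict, HomogeneousLocalization.val_awayMap]
  exact key _ (IsLocalization.lift_comp _)

lemma chartToAway_restrictQuot (hI : ∀ F, F ∈ I ↔ θ F = 0) {f g h : PosHomog 𝒜}
    (hx : h.val = f.val * g.val) (b : ChartRing 𝒜 f.val ⧸ chartIdeal 𝒜 I f.val) :
    chartToAway hI h.val (restrictQuot I hx b) = awayRes hx (chartToAway hI f.val b) := by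
  obtain ⟨a, rfl⟩ := Ideal.Quotient.mk_surjective b
  obtain ⟨n, x, hxd, rfl⟩ := HomogeneousLocalization.Away.mk_surjective 𝒜 f.mem a
  have h1 := val_mk_mul_pow f.mem n x hxd
  have h2 := congrArg (awayRes hx) (chartToAway_mk_mul_pow hI h1)
  have h3 := chartToAway_mk_mul_pow hI (val_restrict_mul_pow hx h1)
  rw [map_mul, map_pow, awayRes_algebraMap, awayRes_algebraMap] at h2
  rw [map_mul, map_pow, map_mul, map_pow, ← h2, mul_assoc, ← mul_pow, ← map_mul, ← map_mul,
    ← hx] at h3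
  exact ((isUnit_algebraMap_away (θ h.val)).pow n).mul_right_cancel h3

/-- An element of `I_(f)` is of the form `F / f ^ n` with `F ∈ I` homogeneous. -/
lemma exists_eq_chartElt (f : PosHomog 𝒜) (a : chartIdeal 𝒜 I f.val) :
    ∃ (n : ℕ) (F : R) (hF : F ∈ I) (hd : F ∈ 𝒜 (n • f.deg)), a = chartElt f n F hF hd := by
  obtain ⟨a, ha⟩ := a
  obtain ⟨n, x, hx, rfl⟩ := HomogeneousLocalization.Away.mk_surjective 𝒜 f.mem a
  rw [mem_chartIdeal, HomogeneousLocalization.Away.val_mk,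
    Localization.mk_eq_mk', IsLocalization.mk'_mem_map_algebraMap_iff] at ha
  obtain ⟨_, ⟨N, rfl⟩, hN⟩ := ha
  -- Numerator and denominator are multiplied by the `f ^ N` that brings the numerator into `I`.
  have hd : f.val ^ N * x ∈ 𝒜 ((N + n) • f.deg) := by
    rw [add_smul]
    exact SetLike.mul_mem_graded (SetLike.pow_mem_graded N f.mem) hx
  refine ⟨N + n, f.val ^ N * x, hN, hd, Subtype.ext (chartRing_ext (n := N + n) ?_)⟩
  rw [chartElt, val_mk_mul_pow, pow_add, mul_left_comm, val_mk_mul_pow, map_mul, map_pow]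

/-! ### From homomorphisms `I → T` to sections of the normal sheaf -/

variable (𝒜 I θ) in
/-- The homogeneous homomorphisms `I → T` of degree `0`. -/
def gradedHoms (𝒯 : ℕ → Submodule K T) : Submodule K (I →ₗ[K] T) where
  carrier := {Φ | (∀ (a : R) (F : I), Φ (a • F) = θ a * Φ F) ∧
    ∀ n (F : I), F.1 ∈ 𝒜 n → Φ F ∈ 𝒯 n}
  add_mem' := by
    rintro Φ Ψ ⟨h1, h2⟩ ⟨h1', h2'⟩
    exact ⟨fun a F => by simp only [LinearMap.add_apply, h1, h1', mul_add],
      fun n F hF => add_mem (h2 n F hF) (h2' n F hF)⟩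
  zero_mem' := ⟨fun a F => by simp, fun n F hF => zero_mem _⟩
  smul_mem' := by
    rintro c Φ ⟨h1, h2⟩
    exact ⟨fun a F => by simp only [LinearMap.smul_apply, h1, mul_smul_comm],
      fun n F hF => Submodule.smul_mem _ _ (h2 n F hF)⟩

variable {𝒯 : ℕ → Submodule K T}

/-- `b` is the value at `a` of the section defined by `Φ`. -/
def IsChartValue (hI : ∀ F, F ∈ I ↔ θ F = 0) (Φ : gradedHoms 𝒜 I θ 𝒯) (f : R)
    (a : ChartRing 𝒜 f) (b : ChartRing 𝒜 f ⧸ chartIdeal 𝒜 I f) : Prop :=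
  ∀ (m : ℕ) (F : I), a.val * algebraMap R (Localization.Away f) f ^ m = algebraMap R _ F.1 →
    chartToAway hI f b * algebraMap T _ (θ f) ^ m = algebraMap T _ (Φ.1 F)

/-- One representation of `a` is enough: two of them agree after multiplication by a power of `f`,
and `Φ` is linear over `R`. -/
lemma isChartValue_of_rep (hI : ∀ F, F ∈ I ↔ θ F = 0) {Φ : gradedHoms 𝒜 I θ 𝒯} {f : R}
    {a : ChartRing 𝒜 f} {b : ChartRing 𝒜 f ⧸ chartIdeal 𝒜 I f} {m : ℕ} {F : I}
    (h : a.val * algebraMap R (Localization.Away f) f ^ m = algebraMap R _ F.1)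
    (hb : chartToAway hI f b * algebraMap T _ (θ f) ^ m = algebraMap T _ (Φ.1 F)) :
    IsChartValue hI Φ f a b := by
  intro m' F' h'
  have h1 : algebraMap R (Localization.Away f) (f ^ m * F'.1) = algebraMap R _ (f ^ m' * F.1) := by
    rw [map_mul, map_mul, ← h, ← h', map_pow, map_pow]
    ring
  obtain ⟨⟨_, c, rfl⟩, hc⟩ := (IsLocalization.eq_iff_exists (Submonoid.powers f) _).1 h1
  have h2 : (f ^ c * f ^ m) • F' = (f ^ c * f ^ m') • F := Subtype.ext (by
    simpa [mul_assoc] using hc)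
  have h3 := congrArg Φ.1 h2
  rw [Φ.2.1, Φ.2.1] at h3
  have h4 := congrArg (algebraMap T (Localization.Away (θ f))) h3
  simp only [map_mul, map_pow, ← hb] at h4
  have hu := isUnit_algebraMap_away (θ f)
  refine ((hu.pow c).mul (hu.pow m)).mul_left_cancel ?_
  rw [h4]
  ring

lemma IsChartValue.eq {hI : ∀ F, F ∈ I ↔ θ F = 0} {Φ : gradedHoms 𝒜 I θ 𝒯} {f : PosHomog 𝒜}
    {a : chartIdeal 𝒜 I f.val} {b b' : ChartRing 𝒜 f.val ⧸ chartIdeal 𝒜 I f.val}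
    (h : IsChartValue hI Φ f.val a b) (h' : IsChartValue hI Φ f.val a b') : b = b' := by
  obtain ⟨n, F, hF, hd, rfl⟩ := exists_eq_chartElt f a
  have h1 := h n ⟨F, hF⟩ (val_mk_mul_pow f.mem n F hd)
  rw [← h' n ⟨F, hF⟩ (val_mk_mul_pow f.mem n F hd)] at h1
  exact chartToAway_injective hI f (((isUnit_algebraMap_away (θ f.val)).pow n).mul_right_cancel h1)

/-- Elements of `T` of degree `n` are, up to powers of `f`, in the image of `θ`. -/
def LiftsAway (𝒜 : ℕ → Submodule K R) (θ : R →ₐ[K] T) (𝒯 : ℕ → Submodule K T) : Prop :=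
  ∀ (f : PosHomog 𝒜) (m : ℕ), ∀ y ∈ 𝒯 (m • f.deg),
    ∃ M, ∃ G ∈ 𝒜 ((M + m) • f.deg), θ G = θ f.val ^ M * y

lemma LiftsAway.exists_isChartValue (hT : LiftsAway 𝒜 θ 𝒯) (hI : ∀ F, F ∈ I ↔ θ F = 0)
    (Φ : gradedHoms 𝒜 I θ 𝒯) (f : PosHomog 𝒜) (a : chartIdeal 𝒜 I f.val) :
    ∃ b, IsChartValue hI Φ f.val a b := by
  obtain ⟨n, F, hF, hd, rfl⟩ := exists_eq_chartElt f a
  obtain ⟨M, G, hG, hGy⟩ := hT f n _ (Φ.2.2 _ ⟨F, hF⟩ hd)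
  obtain ⟨b, hb⟩ := exists_chartToAway_eq hI f hG hGy
  exact ⟨b, isChartValue_of_rep hI (val_mk_mul_pow f.mem n F hd) hb⟩

lemma IsChartValue.add {hI : ∀ F, F ∈ I ↔ θ F = 0} {Φ : gradedHoms 𝒜 I θ 𝒯} {f : PosHomog 𝒜}
    {a a' : chartIdeal 𝒜 I f.val} {b b' : ChartRing 𝒜 f.val ⧸ chartIdeal 𝒜 I f.val}
    (h : IsChartValue hI Φ f.val a b) (h' : IsChartValue hI Φ f.val a' b') :
    IsChartValue hI Φ f.val (a + a' : chartIdeal 𝒜 I f.val) (b + b') := by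
  obtain ⟨n, F, hF, hd, rfl⟩ := exists_eq_chartElt f a
  obtain ⟨n', F', hF', hd', rfl⟩ := exists_eq_chartElt f a'
  have h1 := val_mk_mul_pow f.mem n F hd
  have h1' := val_mk_mul_pow f.mem n' F' hd'
  have h2 := h n ⟨F, hF⟩ h1
  have h2' := h' n' ⟨F', hF'⟩ h1'
  refine isChartValue_of_rep hI (m := n + n')
    (F := f.val ^ n' • (⟨F, hF⟩ : I) + f.val ^ n • (⟨F', hF'⟩ : I)) ?_ ?_
  · simp only [Submodule.coe_add, chartElt, HomogeneousLocalization.val_add, Submodule.coe_smul,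
      smul_eq_mul, map_add, map_mul, map_pow, ← h1, ← h1']
    ring
  · rw [map_add, map_add, Φ.2.1, Φ.2.1, map_add, map_mul, map_mul, ← h2, ← h2', map_pow, map_pow,
      map_pow, map_pow]
    ring

lemma IsChartValue.smul {hI : ∀ F, F ∈ I ↔ θ F = 0} {Φ : gradedHoms 𝒜 I θ 𝒯} {f : PosHomog 𝒜}
    {a : chartIdeal 𝒜 I f.val} {b : ChartRing 𝒜 f.val ⧸ chartIdeal 𝒜 I f.val}
    (h : IsChartValue hI Φ f.val a b) (c : ChartRing 𝒜 f.val) :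
    IsChartValue hI Φ f.val (c • a : chartIdeal 𝒜 I f.val) (c • b) := by
  obtain ⟨n, F, hF, hd, rfl⟩ := exists_eq_chartElt f a
  obtain ⟨n', x, hx, rfl⟩ := HomogeneousLocalization.Away.mk_surjective 𝒜 f.mem c
  have h1 := val_mk_mul_pow f.mem n F hd
  have h1' := val_mk_mul_pow f.mem n' x hx
  have h2 := h n ⟨F, hF⟩ h1
  have h2' := chartToAway_mk_mul_pow hI h1'
  refine isChartValue_of_rep hI (m := n + n') (F := x • (⟨F, hF⟩ : I)) ?_ ?_
  · simp only [Submodule.coe_smul, smul_eq_mul, map_mul, chartElt, HomogeneousLocalization.val_mul,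
      ← h1, ← h1']
    ring
  · have h3 : ∀ c : ChartRing 𝒜 f.val, c • b = Ideal.Quotient.mk (chartIdeal 𝒜 I f.val) c * b := by
      obtain ⟨b, rfl⟩ := Ideal.Quotient.mk_surjective b
      exact fun c => rfl
    rw [Φ.2.1, map_mul, ← h2, ← h2', h3, map_mul]
    ring

/-- The linear map `I_(f) → R_(f) / I_(f)` defined by `Φ`. -/
noncomputable def chartHom (hT : LiftsAway 𝒜 θ 𝒯) (hI : ∀ F, F ∈ I ↔ θ F = 0)
    (Φ : gradedHoms 𝒜 I θ 𝒯) (f : PosHomog 𝒜) :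
    chartIdeal 𝒜 I f.val →ₗ[ChartRing 𝒜 f.val] (ChartRing 𝒜 f.val ⧸ chartIdeal 𝒜 I f.val) where
  toFun a := (hT.exists_isChartValue hI Φ f a).choose
  map_add' a a' := (hT.exists_isChartValue hI Φ f (a + a')).choose_spec.eq
    ((hT.exists_isChartValue hI Φ f a).choose_spec.add
      (hT.exists_isChartValue hI Φ f a').choose_spec)
  map_smul' c a := (hT.exists_isChartValue hI Φ f (c • a)).choose_spec.eq
    ((hT.exists_isChartValue hI Φ f a).choose_spec.smul c)

lemma isChartValue_chartHom (hT : LiftsAway 𝒜 θ 𝒯) (hI : ∀ F, F ∈ I ↔ θ F = 0)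
    (Φ : gradedHoms 𝒜 I θ 𝒯) (f : PosHomog 𝒜) (a : chartIdeal 𝒜 I f.val) :
    IsChartValue hI Φ f.val a (chartHom hT hI Φ f a) :=
  (hT.exists_isChartValue hI Φ f a).choose_spec

lemma chartToAway_smul (hI : ∀ F, F ∈ I ↔ θ F = 0) (f : PosHomog 𝒜) (c : K)
    (b : ChartRing 𝒜 f.val ⧸ chartIdeal 𝒜 I f.val) :
    chartToAway hI f.val (c • b) = algebraMap T _ (algebraMap K T c) * chartToAway hI f.val b := by
  have h1 : c • b = Ideal.Quotient.mk _ (algebraMap K (ChartRing 𝒜 f.val) c) * b := by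
    obtain ⟨a, rfl⟩ := Ideal.Quotient.mk_surjective b
    rw [← map_mul]
    exact congrArg (Ideal.Quotient.mk (chartIdeal 𝒜 I f.val)) (Algebra.smul_def c a)
  have h2 : (algebraMap K (ChartRing 𝒜 f.val) c).val *
      algebraMap R (Localization.Away f.val) f.val ^ 0 = algebraMap R _ (algebraMap K R c) := by
    rw [pow_zero, mul_one]
    rfl
  have h3 := chartToAway_mk_mul_pow hI h2
  rw [pow_zero, mul_one, AlgHom.commutes] at h3
  rw [h1, map_mul, h3]

lemma IsChartValue.add_hom {hI : ∀ F, F ∈ I ↔ θ F = 0} {Φ Ψ : gradedHoms 𝒜 I θ 𝒯}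
    {f : PosHomog 𝒜} {a : ChartRing 𝒜 f.val} {b b' : ChartRing 𝒜 f.val ⧸ chartIdeal 𝒜 I f.val}
    (h : IsChartValue hI Φ f.val a b) (h' : IsChartValue hI Ψ f.val a b') :
    IsChartValue hI (Φ + Ψ) f.val a (b + b') := fun m F hF => by
  rw [map_add, add_mul, h m F hF, h' m F hF, ← map_add]
  rfl

lemma IsChartValue.smul_hom {hI : ∀ F, F ∈ I ↔ θ F = 0} {Φ : gradedHoms 𝒜 I θ 𝒯}
    {f : PosHomog 𝒜} {a : ChartRing 𝒜 f.val} {b : ChartRing 𝒜 f.val ⧸ chartIdeal 𝒜 I f.val}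
    (h : IsChartValue hI Φ f.val a b) (c : K) : IsChartValue hI (c • Φ) f.val a (c • b) :=
  fun m F hF => by
    rw [chartToAway_smul, mul_assoc, h m F hF, ← map_mul, ← Algebra.smul_def]
    rfl

lemma chartHom_restrict (hT : LiftsAway 𝒜 θ 𝒯) (hI : ∀ F, F ∈ I ↔ θ F = 0)
    (Φ : gradedHoms 𝒜 I θ 𝒯) {f g h : PosHomog 𝒜} (hx : h.val = f.val * g.val)
    (a : chartIdeal 𝒜 I f.val) :
    chartHom hT hI Φ h (restrictIdeal I hx a) = restrictQuot I hx (chartHom hT hI Φ f a) := by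
  obtain ⟨n, F, hF, hd, rfl⟩ := exists_eq_chartElt f a
  have h1 := val_mk_mul_pow f.mem n F hd
  have h2 := isChartValue_chartHom hT hI Φ f (chartElt f n F hF hd) n ⟨F, hF⟩ h1
  -- On the smaller chart, `F / f ^ n = g ^ n F / h ^ n`.
  refine (isChartValue_chartHom hT hI Φ h _).eq (isChartValue_of_rep hI (m := n)
    (F := g.val ^ n • (⟨F, hF⟩ : I)) ?_ ?_)
  · refine (val_restrict_mul_pow hx h1).trans ?_
    rw [mul_comm]
    rfl
  · have h3 := congrArg (awayRes hx) h2
    rw [map_mul, ← chartToAway_restrictQuot, map_pow, awayRes_algebraMap, awayRes_algebraMap] at h3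
    rw [Φ.2.1, map_mul, ← h3, algebraMap_val_eq hx, mul_pow, map_pow, map_pow]
    ring

/-- The section of the normal sheaf defined by a homogeneous homomorphism `I → T`. -/
noncomputable def sectionOfHom (hT : LiftsAway 𝒜 θ 𝒯) (hI : ∀ F, F ∈ I ↔ θ F = 0) :
    gradedHoms 𝒜 I θ 𝒯 →ₗ[K] gradedNormalSections 𝒜 I where
  toFun Φ := ⟨chartHom hT hI Φ, fun _ _ _ hx a => chartHom_restrict hT hI Φ hx a⟩
  map_add' Φ Ψ := Subtype.ext (funext fun f => LinearMap.ext fun a =>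
    (isChartValue_chartHom hT hI (Φ + Ψ) f a).eq
      ((isChartValue_chartHom hT hI Φ f a).add_hom (isChartValue_chartHom hT hI Ψ f a)))
  map_smul' c Φ := Subtype.ext (funext fun f => LinearMap.ext fun a =>
    (isChartValue_chartHom hT hI (c • Φ) f a).eq
      ((isChartValue_chartHom hT hI Φ f a).smul_hom c))

lemma sectionOfHom_chartElt (hT : LiftsAway 𝒜 θ 𝒯) (hI : ∀ F, F ∈ I ↔ θ F = 0)
    (Φ : gradedHoms 𝒜 I θ 𝒯) (f : PosHomog 𝒜) (n : ℕ) (F : R) (hF : F ∈ I)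
    (hd : F ∈ 𝒜 (n • f.deg)) :
    chartToAway hI f.val ((sectionOfHom hT hI Φ).1 f (chartElt f n F hF hd)) *
      algebraMap T _ (θ f.val) ^ n = algebraMap T _ (Φ.1 ⟨F, hF⟩) :=
  isChartValue_chartHom hT hI Φ f _ n ⟨F, hF⟩ (val_mk_mul_pow f.mem n F hd)

end Charts

end LineRope

namespace LineRope

set_option linter.unusedSectionVars false

/-! ### Values of a section on the charts -/

section ChartValues

variable {K R T : Type*} [Field K] [CommRing R] [Algebra K R] [CommRing T] [Algebra K T]
variable {𝒜 : ℕ → Submodule K R} [GradedAlgebra 𝒜] {I : Ideal R} {θ : R →ₐ[K] T}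

/-- The value of a section of the normal sheaf at `F ∈ I` homogeneous, on `D₊(f)`. -/
noncomputable def chartVal (hI : ∀ F, F ∈ I ↔ θ F = 0) (φ : gradedNormalSections 𝒜 I)
    (f : PosHomog 𝒜) (n : ℕ) (F : R) (hF : F ∈ I) (hd : F ∈ 𝒜 (n • f.deg)) :
    Localization.Away (θ f.val) :=
  chartToAway hI f.val (φ.1 f (chartElt f n F hF hd)) * algebraMap T _ (θ f.val) ^ n

variable {hI : ∀ F, F ∈ I ↔ θ F = 0} {φ : gradedNormalSections 𝒜 I} {f : PosHomog 𝒜}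

lemma chartVal_add {n : ℕ} {F G : R} (hF : F ∈ I) (hG : G ∈ I) (hFd : F ∈ 𝒜 (n • f.deg))
    (hGd : G ∈ 𝒜 (n • f.deg)) :
    chartVal hI φ f n (F + G) (add_mem hF hG) (add_mem hFd hGd) =
      chartVal hI φ f n F hF hFd + chartVal hI φ f n G hG hGd := by
  have h : chartElt f n (F + G) (add_mem hF hG) (add_mem hFd hGd) =
      chartElt f n F hF hFd + chartElt f n G hG hGd := by
    refine Subtype.ext (chartRing_ext (n := n) ?_)
    rw [Submodule.coe_add, HomogeneousLocalization.val_add, add_mul]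
    simp only [chartElt]
    rw [val_mk_mul_pow, val_mk_mul_pow, val_mk_mul_pow, map_add]
  rw [chartVal, h, map_add, map_add, add_mul, chartVal, chartVal]

lemma chartVal_mul {n m : ℕ} {a F : R} (ha : a ∈ 𝒜 (n • f.deg)) (hF : F ∈ I)
    (hd : F ∈ 𝒜 (m • f.deg)) (hd' : a * F ∈ 𝒜 ((n + m) • f.deg)) :
    chartVal hI φ f (n + m) (a * F) (I.mul_mem_left a hF) hd' =
      algebraMap T _ (θ a) * chartVal hI φ f m F hF hd := by
  have h : chartElt f (n + m) (a * F) (I.mul_mem_left a hF) hd' =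
      HomogeneousLocalization.Away.mk 𝒜 f.mem n a ha • chartElt f m F hF hd := by
    refine Subtype.ext (chartRing_ext (n := n + m) ?_)
    rw [Submodule.coe_smul, smul_eq_mul, HomogeneousLocalization.val_mul, pow_add]
    simp only [chartElt]
    rw [← pow_add, val_mk_mul_pow, pow_add, mul_mul_mul_comm, val_mk_mul_pow, val_mk_mul_pow, map_mul]
  have h2 : ∀ (c : ChartRing 𝒜 f.val) (b : ChartRing 𝒜 f.val ⧸ chartIdeal 𝒜 I f.val),
      c • b = Ideal.Quotient.mk (chartIdeal 𝒜 I f.val) c * b := by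
    intro c b
    obtain ⟨b, rfl⟩ := Ideal.Quotient.mk_surjective b
    rfl
  rw [chartVal, h, map_smul, h2, map_mul, chartVal,
    ← chartToAway_mk_mul_pow hI (val_mk_mul_pow f.mem n a ha), pow_add]
  ring

lemma chartVal_eq_zero_iff {n : ℕ} {F : R} {hF : F ∈ I} {hd : F ∈ 𝒜 (n • f.deg)} :
    chartVal hI φ f n F hF hd = 0 ↔ φ.1 f (chartElt f n F hF hd) = 0 := by
  rw [chartVal, ((isUnit_algebraMap_away (θ f.val)).pow n).mul_left_eq_zero,
    map_eq_zero_iff _ (chartToAway_injective hI f)]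

lemma exists_chartVal_mul_pow_eq (n : ℕ) (F : R) (hF : F ∈ I) (hd : F ∈ 𝒜 (n • f.deg)) :
    ∃ (N : ℕ), ∃ G ∈ 𝒜 (N • f.deg), chartVal hI φ f n F hF hd * algebraMap T _ (θ f.val) ^ N =
      algebraMap T _ (θ f.val ^ n * θ G) := by
  obtain ⟨a, ha⟩ := Ideal.Quotient.mk_surjective (φ.1 f (chartElt f n F hF hd))
  obtain ⟨N, G, hG, rfl⟩ := HomogeneousLocalization.Away.mk_surjective 𝒜 f.mem a
  refine ⟨N, G, hG, ?_⟩
  rw [chartVal, ← ha, map_mul, ← chartToAway_mk_mul_pow hI (val_mk_mul_pow f.mem N G hG), map_pow]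
  ring

lemma chartVal_sectionOfHom {𝒯 : ℕ → Submodule K T} (hT : LiftsAway 𝒜 θ 𝒯)
    (Φ : gradedHoms 𝒜 I θ 𝒯) (n : ℕ) (F : R) (hF : F ∈ I) (hd : F ∈ 𝒜 (n • f.deg)) :
    chartVal hI (sectionOfHom hT hI Φ) f n F hF hd = algebraMap T _ (Φ.1 ⟨F, hF⟩) :=
  sectionOfHom_chartElt hT hI Φ f n F hF hd

/-- The product of two homogeneous elements of positive degree. -/
def PosHomog.mul (f g : PosHomog 𝒜) : PosHomog 𝒜 where
  deg := f.deg + g.deg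
  val := f.val * g.val
  deg_pos := Nat.add_pos_left f.deg_pos _
  mem := SetLike.mul_mem_graded f.mem g.mem

lemma chartVal_sub {ψ : gradedNormalSections 𝒜 I} {n : ℕ} {F : R} (hF : F ∈ I)
    (hd : F ∈ 𝒜 (n • f.deg)) : chartVal hI (φ - ψ) f n F hF hd =
      chartVal hI φ f n F hF hd - chartVal hI ψ f n F hF hd := by
  have h : (φ - ψ).1 f (chartElt f n F hF hd) =
    φ.1 f (chartElt f n F hF hd) - ψ.1 f (chartElt f n F hF hd) := rfl
  rw [chartVal, h, map_sub, sub_mul, chartVal, chartVal]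

/-- For `f`, `g` of degree `1`, the values on `D₊(f)` and `D₊(g)` agree on `D₊(f g)`. -/
lemma awayRes_chartVal {f g h : PosHomog 𝒜} (hf : f.deg = 1) (hfg : h.val = f.val * g.val)
    (hgf : h.val = g.val * f.val) (hh : h.deg = 2) {n : ℕ} {F : R} (hF : F ∈ I)
    (hd : F ∈ 𝒜 (n • f.deg)) (hd' : F ∈ 𝒜 (n • g.deg)) :
    awayRes hfg (chartVal hI φ f n F hF hd) = awayRes hgf (chartVal hI φ g n F hF hd') := by
  have h1 := φ.2 f g h hfg (chartElt f n F hF hd)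
  have h2 := φ.2 g f h hgf (chartElt g n F hF hd')
  have hcd : f.val ^ (2 * n) ∈ 𝒜 (n • h.deg) := by
    have := SetLike.pow_mem_graded (2 * n) f.mem
    rw [hf] at this
    rw [hh]
    convert this using 2
    simp [mul_comm]
  -- Since `h = f g`, one has `F / g ^ n = (f ^ (2n) / h ^ n) (F / f ^ n)`; the coefficient has
  -- degree zero because `deg h = 2`.
  have h3 : restrictIdeal I hgf (chartElt g n F hF hd') =
      HomogeneousLocalization.Away.mk 𝒜 h.mem n (f.val ^ (2 * n)) hcd •
        restrictIdeal I hfg (chartElt f n F hF hd) := by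
    refine Subtype.ext (chartRing_ext (n := n + n) ?_)
    have e1 := val_restrict_mul_pow hgf (val_mk_mul_pow g.mem n F hd')
    have e2 := val_restrict_mul_pow hfg (val_mk_mul_pow f.mem n F hd)
    have e3 := val_mk_mul_pow h.mem n (f.val ^ (2 * n)) hcd
    rw [Submodule.coe_smul, smul_eq_mul, HomogeneousLocalization.val_mul, pow_add]
    rw [mul_mul_mul_comm, ← mul_assoc]
    simp only [restrictIdeal, chartElt] at e1 e2 ⊢
    rw [e1, e2, e3, map_mul, map_mul, map_pow, map_pow, map_pow,
      map_val_eq (algebraMap R (Localization.Away h.val)) hfg]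
    ring
  rw [h3, map_smul, h1] at h2
  have h4 : ∀ (c : ChartRing 𝒜 h.val) (b : ChartRing 𝒜 h.val ⧸ chartIdeal 𝒜 I h.val),
      c • b = Ideal.Quotient.mk (chartIdeal 𝒜 I h.val) c * b := by
    intro c b
    obtain ⟨b, rfl⟩ := Ideal.Quotient.mk_surjective b
    rfl
  have h5 := congrArg (chartToAway hI h.val) h2
  rw [h4, map_mul, chartToAway_restrictQuot, chartToAway_restrictQuot] at h5
  have h6 := chartToAway_mk_mul_pow hI (val_mk_mul_pow h.mem n (f.val ^ (2 * n)) hcd)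
  have hu := (isUnit_algebraMap_away (θ h.val)).pow n
  have hv : IsUnit (algebraMap T (Localization.Away (θ h.val)) (θ f.val) ^ n) := by
    rw [algebraMap_val_eq hfg, mul_pow] at hu
    exact isUnit_of_mul_isUnit_left hu
  refine hv.mul_left_cancel ?_
  rw [chartVal, chartVal, map_mul, map_mul, map_pow, map_pow, awayRes_algebraMap,
    awayRes_algebraMap, ← h5]
  rw [map_pow, map_pow, algebraMap_val_eq hfg] at h6
  linear_combination
    -(awayRes hfg (chartToAway hI f.val (φ.1 f (chartElt f n F hF hd)))) * h6

/-- Sections of the normal sheaf are determined by their restriction to one chart `D₊(t)`, if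
`t` is a nonzerodivisor of degree `1`. -/
lemma eq_zero_of_chart_eq_zero (hI : ∀ F, F ∈ I ↔ θ F = 0) {t : PosHomog 𝒜} (ht : t.deg = 1)
    (hreg : ∀ y, θ t.val * y = 0 → y = 0) (h0 : φ.1 t = 0) : φ = 0 := by
  refine Subtype.ext (funext fun f => LinearMap.ext fun a => ?_)
  have hreg' : ∀ n y, θ t.val ^ n * y = 0 → y = 0 := by
    intro n
    induction n with
    | zero => intro y hy; simpa using hy
    | succ n ih =>
      intro y hy
      rw [pow_succ, mul_assoc] at hy
      exact hreg _ (ih _ hy)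
  set h := f.mul t with hh
  have hft : h.val = f.val * t.val := rfl
  have htf : h.val = t.val * f.val := mul_comm _ _
  -- On `D₊(f t)` each element is `F / h ^ m = (t ^ e / h ^ m) (F / t ^ e)` with `e` the degree of
  -- `F`, hence a multiple of a restriction from `D₊(t)`, where `φ` vanishes.
  have key : ∀ a', φ.1 h a' = 0 := by
    intro a'
    obtain ⟨m, F, hF, hd, rfl⟩ := exists_eq_chartElt h a'
    set e := m • h.deg with he
    have hd' : F ∈ 𝒜 (e • t.deg) := by
      rw [ht, smul_eq_mul, mul_one]
      exact hd
    have hcd : t.val ^ e ∈ 𝒜 (m • h.deg) := by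
      have := SetLike.pow_mem_graded e t.mem
      rwa [ht, smul_eq_mul, mul_one] at this
    have h3 : chartElt h m F hF hd =
        HomogeneousLocalization.Away.mk 𝒜 h.mem m (t.val ^ e) hcd •
          restrictIdeal I htf (chartElt t e F hF hd') := by
      refine Subtype.ext (chartRing_ext (n := m + e) ?_)
      have e1 := val_mk_mul_pow h.mem m F hd
      have e2 := val_restrict_mul_pow htf (val_mk_mul_pow t.mem e F hd')
      have e3 := val_mk_mul_pow h.mem m (t.val ^ e) hcd
      rw [Submodule.coe_smul, smul_eq_mul, HomogeneousLocalization.val_mul, pow_add]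
      rw [mul_mul_mul_comm, ← mul_assoc]
      simp only [restrictIdeal, chartElt] at e1 e2 ⊢
      rw [e1, e2, e3, map_mul, map_pow, map_pow,
        map_val_eq (algebraMap R (Localization.Away h.val)) htf]
      ring
    rw [h3, map_smul, φ.2 t f h htf, h0]
    simp
  have h1 := φ.2 f t h hft a
  rw [key] at h1
  have h2 := congrArg (chartToAway hI h.val) h1
  rw [map_zero, chartToAway_restrictQuot] at h2
  refine chartToAway_injective hI f ?_
  change chartToAway hI f.val (φ.1 f a) = chartToAway hI f.val 0
  rw [map_zero]
  obtain ⟨⟨y, _, n, rfl⟩, hy⟩ := IsLocalization.surj (Submonoid.powers (θ f.val))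
    (chartToAway hI f.val (φ.1 f a))
  have h3 := congrArg (awayRes hft) hy
  simp only [map_mul, awayRes_algebraMap, ← h2, zero_mul] at h3
  obtain ⟨⟨_, c, rfl⟩, hc⟩ := (IsLocalization.map_eq_zero_iff (Submonoid.powers (θ h.val)) _ _).1 h3.symm
  -- As `θ t` is a nonzerodivisor, an element of `T_f` that vanishes in `T_{ft}` is already zero.
  have h4 : θ f.val ^ c * y = 0 := by
    apply hreg' c
    rw [← mul_assoc, ← mul_pow, ← map_mul, mul_comm t.val, ← hft]
    exact hc
  have h5 : algebraMap T (Localization.Away (θ f.val)) y = 0 :=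
    (IsLocalization.map_eq_zero_iff (Submonoid.powers (θ f.val)) _ _).2 ⟨⟨_, c, rfl⟩, h4⟩
  rw [h5] at hy
  simp only [map_pow] at hy
  exact (((isUnit_algebraMap_away (θ f.val)).pow n).mul_left_eq_zero).1 hy

end ChartValues

end LineRope

namespace LineRope

open MvPolynomial Matrix

set_option linter.unusedSectionVars false

attribute [local instance] MvPolynomial.gradedAlgebra

/-! ### The homomorphism `I → T` defined by a triple -/

section DataToSections

variable {K : Type*} [Field K] {r k : ℕ} {ι : Type*} [Fintype ι]
variable {A : Matrix ι (Fin (r + 1)) (LineRing K)} {B : Matrix (Fin (r + 1)) (Fin k) (LineRing K)}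
variable {α : ι → ℕ} {β : Fin k → ℕ} {I : Ideal (CoordRing K r)}

lemma IsLineExact.liftsAway (h : IsLineExact A B) (hA : RowForms A α) :
    LiftsAway (homogeneousSubmodule (Fin (r + 1) ⊕ Fin 2) K) (toThick A)
      fun n => thickForm α (n : ℤ) := by
  intro f m y hy
  obtain ⟨M, G, hG, hGy⟩ := h.exists_form_pow_mul hA f.deg_pos (mem_form_natCast.2 f.mem) hy
  refine ⟨M, G, ?_, hGy⟩
  rw [← form_natCast]
  convert hG using 2
  simp only [smul_eq_mul]
  push_cast
  ring

lemma exists_colCoord (h : IsLineExact A B) (hI : ∀ F, F ∈ I ↔ toThick A F = 0) (F : I) :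
    ∃ c, (jet F.1).snd = B.mulVec c := by
  refine h.exact _ ?_
  rw [← toThick_snd, (hI F.1).1 F.2, TrivSqZeroExt.snd_zero]

lemma jet_fst_eq_zero (hI : ∀ F, F ∈ I ↔ toThick A F = 0) (F : I) : (jet F.1).fst = 0 := by
  rw [← toThick_fst A, (hI F.1).1 F.2, TrivSqZeroExt.fst_zero]

/-- The coefficients of the linear part of `F ∈ I` with respect to the columns of `B`. -/
noncomputable def colCoord (h : IsLineExact A B) (hI : ∀ F, F ∈ I ↔ toThick A F = 0) :
    I →ₗ[K] (Fin k → LineRing K) where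
  toFun F := (exists_colCoord h hI F).choose
  map_add' F G := by
    rw [← sub_eq_zero]
    apply h.inj
    rw [Matrix.mulVec_sub, Matrix.mulVec_add, ← (exists_colCoord h hI F).choose_spec,
      ← (exists_colCoord h hI G).choose_spec, ← (exists_colCoord h hI (F + G)).choose_spec]
    simp
  map_smul' c F := by
    rw [← sub_eq_zero]
    apply h.inj
    rw [Matrix.mulVec_sub, RingHom.id_apply, Matrix.mulVec_smul,
      ← (exists_colCoord h hI F).choose_spec, ← (exists_colCoord h hI (c • F)).choose_spec]
    simp

lemma jet_snd_eq (h : IsLineExact A B) (hI : ∀ F, F ∈ I ↔ toThick A F = 0) (F : I) :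
    (jet F.1).snd = B.mulVec (colCoord h hI F) :=
  (exists_colCoord h hI F).choose_spec

lemma colCoord_eq (h : IsLineExact A B) (hI : ∀ F, F ∈ I ↔ toThick A F = 0) {F : I}
    {c : Fin k → LineRing K} (hc : (jet F.1).snd = B.mulVec c) : colCoord h hI F = c := by
  rw [← sub_eq_zero]
  apply h.inj
  rw [Matrix.mulVec_sub, ← jet_snd_eq, hc, sub_self]

lemma colCoord_smul (h : IsLineExact A B) (hI : ∀ F, F ∈ I ↔ toThick A F = 0) (a : CoordRing K r)
    (F : I) : colCoord h hI (a • F) = (jet a).fst • colCoord h hI F := by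
  apply colCoord_eq
  rw [Matrix.mulVec_smul, ← jet_snd_eq, Submodule.coe_smul, smul_eq_mul, map_mul,
    TrivSqZeroExt.snd_mul, jet_fst_eq_zero hI F]
  simp

lemma colCoord_mem (h : IsLineExact A B) (hI : ∀ F, F ∈ I ↔ toThick A F = 0) (hB : ColForms B β)
    {d : ℤ} {F : I} (hF : F.1 ∈ form (Fin (r + 1) ⊕ Fin 2) K d) (s : Fin k) :
    colCoord h hI F s ∈ form (Fin 2) K (d - 1 - β s) := by
  obtain ⟨c, hc, hc'⟩ := h.exact_form hB (mem_formPi.2 (jet_mem hF).2) (by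
    rw [← toThick_snd, (hI F.1).1 F.2, TrivSqZeroExt.snd_zero])
  rw [colCoord_eq h hI hc']
  exact mem_formPi.1 hc s

/-- The homomorphism `I → ⨁ H⁰(C, 𝒪_C(d))` defined by `(P, Q, ψ)`. -/
noncomputable def dataFun (h : IsLineExact A B) (hI : ∀ F, F ∈ I ↔ toThick A F = 0)
    (x : (Fin k → LineRing K) × (Fin k × ι → LineRing K) ×
      (ι → Matrix (Fin (r + 1)) (Fin (r + 1)) (LineRing K))) (F : I) : Thick K ι :=
  TrivSqZeroExt.inl (∑ s, colCoord h hI F s * x.1 s) +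
    TrivSqZeroExt.inr fun l => ∑ s, colCoord h hI F s * x.2.1 (s, l) + quad x.2.2 F.1 l

/-- In the product in `T` the `z`-part of `a` meets the `S`-part of the value at `F`. The relation
`ψ_l B = A_l Pᵀ` says exactly that this equals the extra term of `quad_mul`. -/
lemma dataFun_smul (h : IsLineExact A B) (hI : ∀ F, F ∈ I ↔ toThick A F = 0)
    {x : (Fin k → LineRing K) × (Fin k × ι → LineRing K) ×
      (ι → Matrix (Fin (r + 1)) (Fin (r + 1)) (LineRing K))}
    (hx : x ∈ normalData A B α β) (a : CoordRing K r) (F : I) :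
    dataFun h hI x (a • F) = toThick A a * dataFun h hI x F := by
  obtain ⟨-, -, -, hsym, hrel⟩ := hx
  have key : ∀ l, ∑ i, (jet a).snd i * ∑ j, x.2.2 l i j * (jet F.1).snd j =
      (∑ s, colCoord h hI F s * x.1 s) * A.mulVec (jet a).snd l := by
    intro l
    have h1 : ∀ i, ∑ j, x.2.2 l i j * (jet F.1).snd j = A l i * ∑ s, colCoord h hI F s * x.1 s := by
      intro i
      have h2 : (x.2.2 l).mulVec (jet F.1).snd i =
          (vecMulVec (A l) x.1).mulVec (colCoord h hI F) i := by
        rw [← hrel l, jet_snd_eq h hI, Matrix.mulVec_mulVec]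
      refine h2.trans ?_
      simp only [Matrix.mulVec, dotProduct, vecMulVec_apply, Finset.mul_sum]
      exact Finset.sum_congr rfl fun _ _ => by ring
    simp only [h1, Matrix.mulVec, dotProduct, Finset.mul_sum]
    refine Finset.sum_congr rfl fun i _ => ?_
    rw [Finset.sum_mul]
    exact Finset.sum_congr rfl fun _ _ => by ring
  ext1
  · rw [TrivSqZeroExt.fst_mul, toThick_fst]
    simp only [dataFun, colCoord_smul, TrivSqZeroExt.fst_add, TrivSqZeroExt.fst_inl,
      TrivSqZeroExt.fst_inr, add_zero, Pi.smul_apply, smul_eq_mul, Finset.mul_sum, mul_assoc]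
  · ext1 l
    rw [TrivSqZeroExt.snd_mul, toThick_fst, toThick_snd, op_smul_eq_smul]
    have h3 : quad x.2.2 (a * F.1) l = (jet a).fst * quad x.2.2 F.1 l +
        (∑ s, colCoord h hI F s * x.1 s) * A.mulVec (jet a).snd l := by
      rw [quad_mul hsym a (jet_fst_eq_zero hI F), ← key]
      rfl
    simp only [dataFun, colCoord_smul, TrivSqZeroExt.snd_add, TrivSqZeroExt.snd_inl,
      TrivSqZeroExt.snd_inr, TrivSqZeroExt.fst_add, TrivSqZeroExt.fst_inl,
      TrivSqZeroExt.fst_inr, add_zero, zero_add, Pi.smul_apply, smul_eq_mul, Pi.add_apply,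
      Submodule.coe_smul, h3, mul_add, mul_assoc, ← Finset.mul_sum, Pi.zero_apply]
    ring

lemma dataFun_mem (h : IsLineExact A B) (hI : ∀ F, F ∈ I ↔ toThick A F = 0) (hB : ColForms B β)
    {x : (Fin k → LineRing K) × (Fin k × ι → LineRing K) ×
      (ι → Matrix (Fin (r + 1)) (Fin (r + 1)) (LineRing K))}
    (hx : x ∈ normalData A B α β) {d : ℤ} {F : I}
    (hF : F.1 ∈ form (Fin (r + 1) ⊕ Fin 2) K d) : dataFun h hI x F ∈ thickForm α d := by
  obtain ⟨hP, hQ, hψ, hsym, -⟩ := hx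
  have hc := colCoord_mem h hI hB hF
  constructor
  · simp only [dataFun, TrivSqZeroExt.fst_add, TrivSqZeroExt.fst_inl,
      TrivSqZeroExt.fst_inr, add_zero]
    exact Submodule.sum_mem _ fun s _ => mul_mem_form (hc s) (mem_formPi.1 hP s) (by ring)
  · intro l
    simp only [dataFun, TrivSqZeroExt.snd_add, TrivSqZeroExt.snd_inl,
      TrivSqZeroExt.snd_inr, zero_add]
    refine add_mem ?_ (quad_mem hsym hψ hF l)
    exact Submodule.sum_mem _ fun s _ => mul_mem_form (hc s) (mem_formPi.1 hQ (s, l)) (by ring)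

lemma quadValue_add (ψ ψ' : ι → Matrix (Fin (r + 1)) (Fin (r + 1)) (LineRing K)) :
    quadValue (ψ + ψ') = quadValue ψ + quadValue ψ' := by
  ext1 m
  rw [Pi.add_apply]
  unfold quadValue
  split_ifs
  · rfl
  · simp

lemma quadValue_smul (c : K) (ψ : ι → Matrix (Fin (r + 1)) (Fin (r + 1)) (LineRing K)) :
    quadValue (c • ψ) = c • quadValue ψ := by
  ext1 m
  rw [Pi.smul_apply]
  unfold quadValue
  split_ifs
  · rfl
  · simp

lemma quad_add (ψ ψ' : ι → Matrix (Fin (r + 1)) (Fin (r + 1)) (LineRing K)) (F : CoordRing K r) :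
    quad (ψ + ψ') F = quad ψ F + quad ψ' F := by
  simp only [quad, quadValue_add, LinearMap.comp_apply, LinearMap.restrictScalars_apply, map_add,
    LinearMap.add_apply]

lemma quad_smul (c : K) (ψ : ι → Matrix (Fin (r + 1)) (Fin (r + 1)) (LineRing K))
    (F : CoordRing K r) : quad (c • ψ) F = c • quad ψ F := by
  simp only [quad, quadValue_smul, LinearMap.comp_apply, LinearMap.restrictScalars_apply,
    Module.Basis.constr_apply, Finsupp.sum, Pi.smul_apply, Finset.smul_sum]
  exact Finset.sum_congr rfl fun _ _ => smul_comm _ _ _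

/-- The homogeneous homomorphism `I → ⨁ H⁰(C, 𝒪_C(d))` defined by `(P, Q, ψ)`. -/
noncomputable def dataHom (h : IsLineExact A B) (hI : ∀ F, F ∈ I ↔ toThick A F = 0)
    (hB : ColForms B β) : normalData A B α β →ₗ[K]
      gradedHoms (homogeneousSubmodule (Fin (r + 1) ⊕ Fin 2) K) I (toThick A)
        fun n => thickForm α (n : ℤ) where
  toFun x := ⟨{ toFun := dataFun h hI x.1
                map_add' := fun F G => by
                  ext1
                  · simp [dataFun, add_mul, Finset.sum_add_distrib]
                  · ext1 l
                    simp [dataFun, add_mul, Finset.sum_add_distrib]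
                    ring
                map_smul' := fun c F => by
                  ext1
                  · simp [dataFun, Finset.smul_sum]
                  · ext1 l
                    simp [dataFun, Finset.smul_sum] },
    fun a F => dataFun_smul h hI x.2 a F,
    fun n F hF => dataFun_mem h hI hB x.2 (mem_form_natCast.2 hF)⟩
  map_add' x y := by
    refine Subtype.ext (LinearMap.ext fun F => ?_)
    change dataFun h hI (x.1 + y.1) F = dataFun h hI x.1 F + dataFun h hI y.1 F
    ext1
    · simp [dataFun, mul_add, Finset.sum_add_distrib]
    · ext1 l
      simp [dataFun, mul_add, Finset.sum_add_distrib, quad_add]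
      ring
  map_smul' c x := by
    refine Subtype.ext (LinearMap.ext fun F => ?_)
    change dataFun h hI (c • x.1) F = c • dataFun h hI x.1 F
    ext1
    · simp [dataFun, Finset.smul_sum]
    · ext1 l
      simp [dataFun, Finset.smul_sum, quad_smul]

lemma dataFun_formOfColumn (h : IsLineExact A B) (hI : ∀ F, F ∈ I ↔ toThick A F = 0)
    {x : (Fin k → LineRing K) × (Fin k × ι → LineRing K) ×
      (ι → Matrix (Fin (r + 1)) (Fin (r + 1)) (LineRing K))}
    (hx : x ∈ normalData A B α β) (s : Fin k) (hs : formOfColumn B s ∈ I) :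
    dataFun h hI x ⟨formOfColumn B s, hs⟩ =
      TrivSqZeroExt.inl (x.1 s) + TrivSqZeroExt.inr fun l => x.2.1 (s, l) := by
  have h1 : colCoord h hI ⟨formOfColumn B s, hs⟩ = Pi.single s 1 := by
    apply colCoord_eq
    rw [jet_formOfColumn]
    ext1 j
    simp
  have h2 : quad x.2.2 (formOfColumn B s) = 0 := by
    rw [formOfColumn, map_sum]
    refine Finset.sum_eq_zero fun j _ => ?_
    rw [quad_X_inl_mul hx.2.2.2.1, toThick_incl]
    ext1 l
    simp
  rw [dataFun, h1, h2]
  ext1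
  · simp [Pi.single_apply]
  · ext1 l
    simp [Pi.single_apply]

lemma dataFun_X_mul_X (h : IsLineExact A B) (hI : ∀ F, F ∈ I ↔ toThick A F = 0)
    {x : (Fin k → LineRing K) × (Fin k × ι → LineRing K) ×
      (ι → Matrix (Fin (r + 1)) (Fin (r + 1)) (LineRing K))}
    (hx : x ∈ normalData A B α β) (i j : Fin (r + 1))
    (hs : (X (Sum.inl i) * X (Sum.inl j) : CoordRing K r) ∈ I) :
    dataFun h hI x ⟨_, hs⟩ = TrivSqZeroExt.inr fun l => x.2.2 l i j := by
  have h1 : colCoord h hI ⟨_, hs⟩ = 0 := by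
    apply colCoord_eq
    rw [map_mul, jet_X_inl, jet_X_inl, TrivSqZeroExt.inr_mul_inr, Matrix.mulVec_zero,
      TrivSqZeroExt.snd_zero]
  rw [dataFun, h1, quad_X_inl_mul hx.2.2.2.1, jet_X_inl]
  ext1
  · simp
  · ext1 l
    simp [Pi.single_apply]

end DataToSections

end LineRope

namespace LineRope

open MvPolynomial Matrix

set_option linter.unusedSectionVars false

attribute [local instance] MvPolynomial.gradedAlgebra

/-! ### Values over all of `C`, and the classification of sections -/

section Gluing

variable {K : Type*} [Field K] {r k : ℕ} {ι : Type*} [Fintype ι]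
variable {A : Matrix ι (Fin (r + 1)) (LineRing K)} {B : Matrix (Fin (r + 1)) (Fin k) (LineRing K)}
variable {α : ι → ℕ} {β : Fin k → ℕ} {I : Ideal (CoordRing K r)}

/-- The chart `D₊(t)`, respectively `D₊(u)`. -/
noncomputable def varChart (K : Type*) [Field K] (r : ℕ) (i : Fin 2) :
    PosHomog (homogeneousSubmodule (Fin (r + 1) ⊕ Fin 2) K) :=
  ⟨1, X (Sum.inr i), Nat.one_pos, isHomogeneous_X K _⟩

lemma toThick_varChart_mul_eq_zero (i : Fin 2) (y : Thick K ι)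
    (hy : toThick A (varChart K r i).val * y = 0) : y = 0 := by
  rw [varChart, toThick_X_inr] at hy
  exact inl_mul_eq_zero (X_ne_zero i) hy

lemma algebraMap_away_injective_of_regular {T : Type*} [CommRing T] {t : T}
    (ht : ∀ y, t * y = 0 → y = 0) : Function.Injective (algebraMap T (Localization.Away t)) := by
  refine IsLocalization.injective _ (M := Submonoid.powers t) ?_
  rw [Submonoid.powers_le, mem_nonZeroDivisors_iff]
  exact ⟨fun y hy => ht y hy, fun y hy => ht y (by rw [mul_comm]; exact hy)⟩

/-- The section `φ` maps `F ∈ I`, homogeneous of degree `n`, to `c`. -/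
def GlobalValue (hI : ∀ F, F ∈ I ↔ toThick A F = 0) (φ : normalSections I) (n : ℕ)
    (F : CoordRing K r) (c : Thick K ι) : Prop :=
  ∃ (hF : F ∈ I) (hd : F ∈ homogeneousSubmodule (Fin (r + 1) ⊕ Fin 2) K n), ∀ i,
    chartVal hI φ (varChart K r i) n F hF (by simpa [varChart] using hd) =
      algebraMap _ (Localization.Away (toThick A (varChart K r i).val)) c

variable {hI : ∀ F, F ∈ I ↔ toThick A F = 0} {φ ψ : normalSections I}

lemma GlobalValue.eq {n : ℕ} {F : CoordRing K r} {c c' : Thick K ι} (h : GlobalValue hI φ n F c)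
    (h' : GlobalValue hI φ n F c') : c = c' := by
  obtain ⟨hF, hd, h⟩ := h
  obtain ⟨hF', hd', h'⟩ := h'
  exact algebraMap_away_injective_of_regular (toThick_varChart_mul_eq_zero 0)
    ((h 0).symm.trans (h' 0))

lemma GlobalValue.add {n : ℕ} {F F' : CoordRing K r} {c c' : Thick K ι}
    (h : GlobalValue hI φ n F c) (h' : GlobalValue hI φ n F' c') :
    GlobalValue hI φ n (F + F') (c + c') := by
  obtain ⟨hF, hd, h⟩ := h
  obtain ⟨hF', hd', h'⟩ := h'
  exact ⟨add_mem hF hF', add_mem hd hd', fun i => (chartVal_add hF hF' (by simpa [varChart] using hd)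
    (by simpa [varChart] using hd')).trans (by rw [h, h', map_add])⟩

lemma GlobalValue.mul {n m : ℕ} {a F : CoordRing K r} {c : Thick K ι}
    (ha : a ∈ homogeneousSubmodule (Fin (r + 1) ⊕ Fin 2) K m)
    (h : GlobalValue hI φ n F c) : GlobalValue hI φ (m + n) (a * F) (toThick A a * c) := by
  obtain ⟨hF, hd, h⟩ := h
  refine ⟨I.mul_mem_left a hF, SetLike.mul_mem_graded ha hd, fun i => ?_⟩
  rw [map_mul, ← h, ← chartVal_mul]
  simpa [varChart] using ha

lemma GlobalValue.zero (hI : ∀ F, F ∈ I ↔ toThick A F = 0) (φ : normalSections I) (n : ℕ) :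
    GlobalValue hI φ n 0 0 := by
  refine ⟨zero_mem _, zero_mem _, fun i => ?_⟩
  rw [map_zero, chartVal_eq_zero_iff]
  convert map_zero (φ.1 (varChart K r i))
  refine Subtype.ext (chartRing_ext (n := n) ?_)
  simp only [chartElt]
  rw [val_mk_mul_pow]
  simp

lemma GlobalValue.sum {κ : Type*} (s : Finset κ) {n : ℕ} {F : κ → CoordRing K r}
    {c : κ → Thick K ι} (h : ∀ j ∈ s, GlobalValue hI φ n (F j) (c j)) :
    GlobalValue hI φ n (∑ j ∈ s, F j) (∑ j ∈ s, c j) := by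
  classical
  induction s using Finset.induction_on with
  | empty => simpa using GlobalValue.zero hI φ n
  | insert j s hj ih =>
    rw [Finset.sum_insert hj, Finset.sum_insert hj]
    exact (h j (Finset.mem_insert_self _ _)).add (ih fun i hi => h i (Finset.mem_insert_of_mem hi))

lemma GlobalValue.sub {n : ℕ} {F : CoordRing K r} {c c' : Thick K ι} (h : GlobalValue hI φ n F c)
    (h' : GlobalValue hI ψ n F c') : GlobalValue hI (φ - ψ) n F (c - c') := by
  obtain ⟨hF, hd, h⟩ := h
  obtain ⟨hF', hd', h'⟩ := h'
  exact ⟨hF, hd, fun i => by rw [chartVal_sub, h, h', map_sub]⟩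

lemma eq_algebraMap_of_mul_pow_eq {T : Type*} [CommRing T] {t x c : T} {N : ℕ}
    {v : Localization.Away t} (hv : v * algebraMap T _ t ^ N = algebraMap T _ x)
    (hx : x = t ^ N * c) : v = algebraMap T _ c := by
  refine ((isUnit_algebraMap_away t).pow N).mul_right_cancel ?_
  rw [hv, hx, map_mul, map_pow, mul_comm]

/-- The values on `D₊(t)` and `D₊(u)` are fractions over `T` that agree on `D₊(tu)`. Since `t` and
`u` are coprime, they come from one element of `T`. -/
lemma exists_globalValue (hA : RowForms A α) (hI : ∀ F, F ∈ I ↔ toThick A F = 0)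
    (φ : normalSections I) {n : ℕ} {F : CoordRing K r} (hF : F ∈ I)
    (hd : F ∈ homogeneousSubmodule (Fin (r + 1) ⊕ Fin 2) K n) :
    ∃ c ∈ thickForm α (n : ℤ), GlobalValue hI φ n F c := by
  have hd' : ∀ i, F ∈ homogeneousSubmodule (Fin (r + 1) ⊕ Fin 2) K (n • (varChart K r i).deg) :=
    fun i => by simpa [varChart] using hd
  obtain ⟨N, G, hG, hN⟩ := exists_chartVal_mul_pow_eq (hI := hI) (φ := φ) n F hF (hd' 0)
  obtain ⟨M, H, hH, hM⟩ := exists_chartVal_mul_pow_eq (hI := hI) (φ := φ) n F hF (hd' 1)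
  set t := varChart K r 0
  set u := varChart K r 1
  set h := t.mul u
  have htu : h.val = t.val * u.val := rfl
  have hut : h.val = u.val * t.val := mul_comm _ _
  have hglue := awayRes_chartVal (hI := hI) (φ := φ) rfl htu hut rfl hF (hd' 0) (hd' 1)
  have hN' := congrArg (awayRes htu) hN
  have hM' := congrArg (awayRes hut) hM
  rw [map_mul, map_pow, awayRes_algebraMap, awayRes_algebraMap] at hN' hM'
  rw [← hglue] at hM'
  have hreg : ∀ y, toThick A h.val * y = 0 → y = 0 := by
    intro y hy
    rw [htu, map_mul, mul_assoc] at hy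
    exact toThick_varChart_mul_eq_zero 1 _ (toThick_varChart_mul_eq_zero 0 _ hy)
  have hcross : toThick A t.val ^ N * (toThick A u.val ^ n * toThick A H) =
      toThick A u.val ^ M * (toThick A t.val ^ n * toThick A G) := by
    apply algebraMap_away_injective_of_regular hreg
    rw [map_mul, map_mul (algebraMap _ _) (toThick A u.val ^ M), ← hN', ← hM', map_pow, map_pow]
    ring
  have ht : ∀ m, toThick A t.val ^ m = TrivSqZeroExt.inl (X 0 ^ m) := toThick_X_inr_pow 0
  have hu : ∀ m, toThick A u.val ^ m = TrivSqZeroExt.inl (X 1 ^ m) := toThick_X_inr_pow 1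
  rw [ht N, hu M] at hcross
  obtain ⟨c, hc, hc'⟩ := exists_eq_mul_of_inl_mul_eq hcross
  rw [← ht N] at hc'
  rw [← hu M] at hc
  have h0 := eq_algebraMap_of_mul_pow_eq hN hc'
  have h1 := eq_algebraMap_of_mul_pow_eq hM hc
  refine ⟨c, ?_, hF, hd, Fin.forall_fin_two.2 ⟨h0, h1⟩⟩
  -- The degree of `c` is found after multiplication by `t ^ N`, where it is that of `t ^ n G`.
  have h1 : TrivSqZeroExt.inl (X 0 ^ N) * c ∈ thickForm α ((n : ℤ) + N) := by
    rw [← ht N, ← hc']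
    refine thickForm_mul (a := n) (b := N) ?_ ?_ rfl
    · have := thickForm_pow (toThick_mem hA (X_mem_form (Sum.inr 0))) n
      rw [mul_one] at this
      exact this
    · refine toThick_mem hA (mem_form_natCast.2 ?_)
      simpa [t, varChart] using hG
  have h2 := mem_thickForm_of_inl_mul_mem (pow_ne_zero N (X_ne_zero 0)) (X_pow_mem_form 0 N) h1
  simpa using h2

lemma globalValue_sectionOfHom (h : IsLineExact A B) (hA : RowForms A α)
    (Φ : gradedHoms (homogeneousSubmodule (Fin (r + 1) ⊕ Fin 2) K) I (toThick A)
        fun n => thickForm α (n : ℤ)) {n : ℕ} {F : CoordRing K r} (hF : F ∈ I)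
    (hd : F ∈ homogeneousSubmodule (Fin (r + 1) ⊕ Fin 2) K n) :
    GlobalValue hI (sectionOfHom (h.liftsAway hA) hI Φ) n F (Φ.1 ⟨F, hF⟩) :=
  ⟨hF, hd, fun _ => chartVal_sectionOfHom _ _ _ _ _ _⟩

/-- Values exist only for homogeneous elements, so the induction on the span follows all homogeneous
components of `F` at once and expands coefficients into monomials. -/
lemma eq_zero_of_globalValue {S : Set (CoordRing K r)} (hS : I = Ideal.span S)
    (hSd : ∀ F ∈ S, ∃ n : ℕ, GlobalValue hI φ n F 0) : φ = 0 := by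
  have key : ∀ F ∈ I, ∀ n : ℕ, GlobalValue hI φ n (formProj (n : ℤ) F) 0 := by
    intro F hF
    rw [hS] at hF
    induction hF using Submodule.span_induction with
    | mem F hF =>
      intro n
      obtain ⟨m, hm⟩ := hSd F hF
      have hmd : F ∈ form _ K (m : ℤ) := mem_form_natCast.2 hm.2.1
      by_cases hnm : m = n
      · subst hnm
        rwa [formProj_of_mem hmd]
      · rw [formProj_of_mem_ne hmd (by omega)]
        exact GlobalValue.zero hI φ n
    | zero => intro n; rw [map_zero]; exact GlobalValue.zero hI φ n
    | add F G _ _ h h' =>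
      intro n
      rw [map_add]
      simpa using (h n).add (h' n)
    | smul a F _ h =>
      intro n
      rw [smul_eq_mul, a.as_sum, Finset.sum_mul, map_sum]
      have : GlobalValue hI φ n (∑ m ∈ a.support, formProj (n : ℤ) (monomial m (coeff m a) * F))
          (∑ m ∈ a.support, 0) := by
        refine GlobalValue.sum _ fun m _ => ?_
        rw [formProj_mul (monomial_mem_form m _)]
        rcases le_or_gt m.degree n with hmn | hmn
        · obtain ⟨e, rfl⟩ := Nat.exists_eq_add_of_le hmn
          have h1 := (h e).mul (isHomogeneous_monomial (coeff m a) rfl :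
            monomial m (coeff m a) ∈ homogeneousSubmodule _ K m.degree)
          rw [mul_zero] at h1
          convert h1 using 3
          push_cast
          rw [add_sub_cancel_left]
        · have : formProj ((n : ℤ) - m.degree) F = 0 := by
            have := formProj_mem ((n : ℤ) - m.degree) F
            rwa [form_of_neg (by omega), Submodule.mem_bot] at this
          rw [this, mul_zero]
          exact GlobalValue.zero hI φ n
      simpa using this
  refine eq_zero_of_chart_eq_zero hI (t := varChart K r 0) rfl (toThick_varChart_mul_eq_zero 0) ?_
  refine LinearMap.ext fun a => ?_
  obtain ⟨n, F, hF, hd, rfl⟩ := exists_eq_chartElt _ a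
  have hd' : F ∈ form _ K (n : ℤ) := by
    rw [mem_form_natCast]
    simpa [varChart] using hd
  obtain ⟨_, _, h⟩ := key F hF n
  have h0 := h 0
  rw [map_zero, chartVal_eq_zero_iff] at h0
  simp only [formProj_of_mem hd'] at h0
  exact h0

/-- The columns of `A` are not all proportional to a fixed vector. -/
lemma IsLineExact.eq_zero_of_proportional [Nontrivial ι] (h : IsLineExact A B)
    {c : Fin (r + 1) → LineRing K} (hc : ∀ l i j, A l i * c j = A l j * c i) : c = 0 := by
  classical
  ext1 j
  by_contra hj
  obtain ⟨l, l', hl⟩ := exists_pair_ne ι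
  have h1 : A l j = 0 := by
    -- Proportionality makes every 2-by-2 minor of rows `l`, `l'` with column `j` vanish;
    -- independence of the rows then forces `A l j = 0`, and proportionality kills the whole row
    -- `l`.
    have hw := h.dual_inj (Pi.single l (A l' j) - Pi.single l' (A l j)) (by
      ext1 i
      rw [Matrix.sub_vecMul, Pi.sub_apply]
      simp only [Matrix.single_vecMul, Pi.smul_apply, Matrix.row_apply, smul_eq_mul, Pi.zero_apply]
      refine mul_right_cancel₀ hj ?_
      rw [sub_mul, mul_assoc, mul_assoc, hc l i j, hc l' i j]
      ring)
    have := congrFun hw l'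
    simpa [hl, hl.symm] using this
  have h2 := h.dual_inj (Pi.single l 1) (by
    ext1 i
    simp only [Matrix.single_vecMul, Pi.smul_apply, Matrix.row_apply, smul_eq_mul, one_mul,
      Pi.zero_apply]
    refine mul_right_cancel₀ hj ?_
    rw [hc l i j, h1, zero_mul, zero_mul])
  have := congrFun h2 l
  simp at this

lemma lineIdeal_sq : lineIdeal K r ^ 2 =
    Ideal.span (Set.range fun p : Fin (r + 1) × Fin (r + 1) =>
      (X (Sum.inl p.1) * X (Sum.inl p.2) : CoordRing K r)) := by
  rw [pow_two, lineIdeal, Ideal.span_mul_span']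
  congr 1
  ext F
  simp [Set.mem_mul]

lemma formOfColumn_mem (hB : ColForms B β) (s : Fin k) :
    formOfColumn B s ∈ homogeneousSubmodule (Fin (r + 1) ⊕ Fin 2) K (β s + 1) := by
  refine Submodule.sum_mem _ fun j _ => ?_
  have h : (X (Sum.inl j) * incl K r (B j s) : CoordRing K r).IsHomogeneous (1 + β s) :=
    (isHomogeneous_X K _).mul (IsHomogeneous.rename_isHomogeneous (mem_form_natCast.1 (hB j s)))
  rw [add_comm 1 (β s)] at h
  exact h

/-- The sections of the normal sheaf are classified by `normalData`. -/
noncomputable def sectionOfData (h : IsLineExact A B) (hA : RowForms A α) (hB : ColForms B β)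
    (hI : ∀ F, F ∈ I ↔ toThick A F = 0) : normalData A B α β →ₗ[K] normalSections I :=
  (sectionOfHom (h.liftsAway hA) hI).comp (dataHom h hI hB)

lemma globalValue_formOfColumn (h : IsLineExact A B) (hA : RowForms A α) (hB : ColForms B β)
    (hI : ∀ F, F ∈ I ↔ toThick A F = 0) (x : normalData A B α β) (s : Fin k)
    (hs : formOfColumn B s ∈ I) :
    GlobalValue hI (sectionOfData h hA hB hI x) (β s + 1) (formOfColumn B s)
      (TrivSqZeroExt.inl (x.1.1 s) + TrivSqZeroExt.inr (fun l => x.1.2.1 (s, l)) : Thick K ι) := by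
  have h1 := globalValue_sectionOfHom (hI := hI) h hA (dataHom h hI hB x) hs (formOfColumn_mem hB s)
  have h2 : (dataHom h hI hB x).1 ⟨formOfColumn B s, hs⟩ = _ := dataFun_formOfColumn h hI x.2 s hs
  rw [h2] at h1
  exact h1

lemma globalValue_X_mul_X (h : IsLineExact A B) (hA : RowForms A α) (hB : ColForms B β)
    (hI : ∀ F, F ∈ I ↔ toThick A F = 0) (x : normalData A B α β) (i j : Fin (r + 1))
    (hs : (X (Sum.inl i) * X (Sum.inl j) : CoordRing K r) ∈ I) :
    GlobalValue hI (sectionOfData h hA hB hI x) 2 (X (Sum.inl i) * X (Sum.inl j))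
      (TrivSqZeroExt.inr fun l => x.1.2.2 l i j) := by
  have h1 := globalValue_sectionOfHom (hI := hI) h hA (dataHom h hI hB x) hs
    ((isHomogeneous_X K _).mul (isHomogeneous_X K _))
  have h2 : (dataHom h hI hB x).1 ⟨X (Sum.inl i) * X (Sum.inl j), hs⟩ = _ :=
    dataFun_X_mul_X h hI x.2 i j hs
  rw [h2] at h1
  exact h1

/-- A section is determined by its values on the generators `x_i x_j` and `F_s`. Conversely the
values of any section satisfy the conditions on a triple, by the syzygies `x_i (x_j x_m) = x_j (x_i
x_m)` and `x_i F_s = ∑ b_{js} x_i x_j`. -/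
theorem sectionOfData_bijective [Nontrivial ι] (h : IsLineExact A B) (hA : RowForms A α)
    (hB : ColForms B β) (hI : ∀ F, F ∈ I ↔ toThick A F = 0)
    (hIeq : I = lineIdeal K r ^ 2 ⊔ Ideal.span (Set.range (formOfColumn B))) :
    Function.Bijective (sectionOfData h hA hB hI) := by
  have hFs : ∀ s, formOfColumn B s ∈ I := fun s => by
    rw [hIeq]
    exact Ideal.mem_sup_right (Ideal.subset_span ⟨s, rfl⟩)
  have hXX : ∀ i j, (X (Sum.inl i) * X (Sum.inl j) : CoordRing K r) ∈ I := fun i j => by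
    rw [hIeq, lineIdeal_sq]
    exact Ideal.mem_sup_left (Ideal.subset_span ⟨(i, j), rfl⟩)
  have hXXd : ∀ i j, (X (Sum.inl i) * X (Sum.inl j) : CoordRing K r) ∈
      homogeneousSubmodule (Fin (r + 1) ⊕ Fin 2) K 2 := fun i j =>
    (isHomogeneous_X K _).mul (isHomogeneous_X K _)
  constructor
  · rw [injective_iff_map_eq_zero]
    intro x hx
    have hF := fun s => globalValue_formOfColumn h hA hB hI x s (hFs s)
    have hX := fun i j => globalValue_X_mul_X h hA hB hI x i j (hXX i j)
    rw [hx, ← map_zero (sectionOfData h hA hB hI)] at hF hX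
    have hF' := fun s => (hF s).eq (globalValue_formOfColumn h hA hB hI 0 s (hFs s))
    have hX' := fun i j => (hX i j).eq (globalValue_X_mul_X h hA hB hI 0 i j (hXX i j))
    refine Subtype.ext (Prod.ext (funext fun s => ?_) (Prod.ext (funext fun p => ?_)
      (funext fun l => funext fun i => funext fun j => ?_)))
    · simpa using congrArg TrivSqZeroExt.fst (hF' s)
    · simpa using congrFun (congrArg TrivSqZeroExt.snd (hF' p.1)) p.2
    · simpa using congrFun (congrArg TrivSqZeroExt.snd (hX' i j)) l
  · intro φ
    choose c hcd hc using fun s => exists_globalValue hA hI φ (hFs s) (formOfColumn_mem hB s)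
    choose y hyd hy using fun i j => exists_globalValue hA hI φ (hXX i j) (hXXd i j)
    have hsym : ∀ i j, y i j = y j i := fun i j => (hy i j).eq (by
      rw [mul_comm]
      exact hy j i)
    -- The first syzygy makes each column of `A` proportional to the `S`-parts of `φ(x_j x_m)`, for
    -- `m` fixed. With at least two independent rows these parts must vanish.
    have hy0 : ∀ j m, (y j m).fst = 0 := by
      intro j m
      have hrel : ∀ i j, toThick A (X (Sum.inl i)) * y j m = toThick A (X (Sum.inl j)) * y i m := by
        intro i j
        refine ((hy j m).mul (isHomogeneous_X K (Sum.inl i))).eq ?_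
        rw [mul_left_comm]
        exact (hy i m).mul (isHomogeneous_X K (Sum.inl j))
      refine congrFun (h.eq_zero_of_proportional (c := fun j => (y j m).fst) fun l i j => ?_) j
      have := congrFun (congrArg TrivSqZeroExt.snd (hrel i j)) l
      simpa [toThick_X_inl, mul_comm] using this
    -- The second syzygy; its `z_l`-component is the relation `ψ_l B = A_l Pᵀ`.
    have hrel : ∀ i s, toThick A (X (Sum.inl i)) * c s =
        ∑ j, TrivSqZeroExt.inl (B j s) * y i j := by
      intro i s
      refine ((hc s).mul (isHomogeneous_X K (Sum.inl i))).eq ?_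
      have h1 : X (Sum.inl i) * formOfColumn B s =
          ∑ j, incl K r (B j s) * (X (Sum.inl i) * X (Sum.inl j)) := by
        rw [formOfColumn, Finset.mul_sum]
        exact Finset.sum_congr rfl fun _ _ => by ring
      rw [h1]
      refine GlobalValue.sum _ fun j _ => ?_
      have h2 := (hy i j).mul (a := incl K r (B j s))
        (IsHomogeneous.rename_isHomogeneous (mem_form_natCast.1 (hB j s)))
      rw [toThick_incl] at h2
      rwa [show 1 + (β s + 1) = β s + 2 by ring]
    let x : normalData A B α β := ⟨(fun s => (c s).fst, fun p => (c p.1).snd p.2,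
      fun l i j => (y i j).snd l), by
        refine ⟨mem_formPi.2 fun s => by simpa using (hcd s).1,
          mem_formPi.2 fun p => by simpa [add_comm] using (hcd p.1).2 p.2, fun l i j => ?_,
          fun l => ?_, fun l => ?_⟩
        · have := (hyd i j).2 l
          convert this using 2
          push_cast
          ring
        · refine funext fun i => funext fun j => ?_
          exact congrArg (fun z => z.snd l) (hsym j i)
        · refine funext fun i => funext fun s => ?_
          have := congrFun (congrArg TrivSqZeroExt.snd (hrel i s)) l
          rw [TrivSqZeroExt.snd_sum, Finset.sum_apply] at this
          simp only [toThick_X_inl, TrivSqZeroExt.snd_mul, TrivSqZeroExt.fst_inr,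
            TrivSqZeroExt.snd_inr, zero_smul, zero_add, op_smul_eq_smul, Pi.smul_apply,
            TrivSqZeroExt.fst_inl, TrivSqZeroExt.snd_inl, smul_zero, add_zero, smul_eq_mul] at this
          rw [vecMulVec_apply, mul_comm, this]
          exact Matrix.mul_apply.trans (Finset.sum_congr rfl fun j _ => mul_comm _ _)⟩
    refine ⟨x, ?_⟩
    rw [← sub_eq_zero]
    refine eq_zero_of_globalValue (hI := hI)
      (S := Set.range (fun p : Fin (r + 1) × Fin (r + 1) =>
        (X (Sum.inl p.1) * X (Sum.inl p.2) : CoordRing K r)) ∪ Set.range (formOfColumn B)) ?_ ?_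
    · rw [Ideal.span_union, ← lineIdeal_sq, hIeq]
    · rintro _ (⟨⟨i, j⟩, rfl⟩ | ⟨s, rfl⟩)
      · refine ⟨2, ?_⟩
        have h1 := (globalValue_X_mul_X h hA hB hI x i j (hXX i j)).sub (hy i j)
        convert h1 using 1
        rw [eq_comm, sub_eq_zero]
        ext1
        · simpa using (hy0 i j).symm
        · rfl
      · refine ⟨β s + 1, ?_⟩
        have h1 := (globalValue_formOfColumn h hA hB hI x s (hFs s)).sub (hc s)
        convert h1 using 1
        rw [eq_comm, sub_eq_zero]
        exact TrivSqZeroExt.inl_fst_add_inr_snd_eq (c s)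

end Gluing

end LineRope

namespace LineRope

open MvPolynomial Matrix

set_option linter.unusedSectionVars false

attribute [local instance] MvPolynomial.gradedAlgebra

/-! ### Restriction of values to the line -/

section Restriction

variable {K : Type*} [Field K] {r k : ℕ} {ι : Type*} [Fintype ι]
variable {A : Matrix ι (Fin (r + 1)) (LineRing K)} {B : Matrix (Fin (r + 1)) (Fin k) (LineRing K)}
variable {α : ι → ℕ} {β : Fin k → ℕ} {I : Ideal (CoordRing K r)}

/-- A value of a section and its restriction to the line determine each other's constant term. -/
lemma GlobalValue.fst_eq {hI : ∀ F, F ∈ I ↔ toThick A F = 0} {φ : normalSections I} {n : ℕ}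
    {F : CoordRing K r} {c : Thick K ι} (h : GlobalValue hI φ n F c) {hIL : I ≤ lineIdeal K r}
    {P : LineRing K} {i : Fin 2}
    (hP : ValueOnChart hIL φ n F (incl K r P) (X (Sum.inr i))) : c.fst = P := by
  obtain ⟨hF, hd, hv⟩ := h
  obtain ⟨hf, hFd, hPd, hmem, hP⟩ := hP
  have hv := hv i
  have hd' : F ∈ homogeneousSubmodule (Fin (r + 1) ⊕ Fin 2) K (n • (varChart K r i).deg) := by
    simpa [varChart] using hd
  set f : PosHomog (homogeneousSubmodule (Fin (r + 1) ⊕ Fin 2) K) := varChart K r i with hf'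
  obtain ⟨a, ha⟩ := Ideal.Quotient.mk_surjective
    (φ.1 f (chartElt f n F hF hd'))
  obtain ⟨N, G, hG, rfl⟩ := HomogeneousLocalization.Away.mk_surjective _ f.mem a
  have h1 : toThick A f.val ^ N * c = toThick A f.val ^ n * toThick A G := by
    apply algebraMap_away_injective_of_regular (toThick_varChart_mul_eq_zero i)
    rw [map_mul, ← hv, chartVal, ← ha, map_mul, map_pow, map_pow,
      ← chartToAway_mk_mul_pow hI (val_mk_mul_pow f.mem N G hG)]
    ring
  have h2 : Ideal.Quotient.factor (chartIdeal_mono _ hIL f.val)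
      (φ.1 f (chartElt f n F hF hd')) =
      Ideal.Quotient.mk (chartIdeal (homogeneousSubmodule _ K) (lineIdeal K r) f.val)
        (HomogeneousLocalization.Away.mk _ f.mem n (incl K r P) hPd) := hP
  rw [← ha, Ideal.Quotient.factor_mk, Ideal.Quotient.eq, mem_chartIdeal,
    HomogeneousLocalization.val_sub] at h2
  have h3 : algebraMap (CoordRing K r) (Localization.Away f.val)
      (f.val ^ n * G - f.val ^ N * incl K r P) ∈
      (lineIdeal K r).map (algebraMap _ (Localization.Away f.val)) := by
    convert Ideal.mul_mem_right (algebraMap _ (Localization.Away f.val) (f.val ^ (n + N))) _ h2 using 1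
    rw [map_sub, map_mul, map_mul, ← val_mk_mul_pow f.mem N G hG,
      ← val_mk_mul_pow f.mem n (incl K r P) hPd, map_pow, map_pow, map_pow]
    ring
  obtain ⟨_, ⟨M, rfl⟩, hM⟩ :=
    (IsLocalization.algebraMap_mem_map_algebraMap_iff (Submonoid.powers f.val) _ _ _).1 h3
  -- Equality on `L` means that, denominators cleared, the difference lies in `I_L`, hence has no
  -- constant term in the `x_j`.
  have h4 : (toThick A (f.val ^ M * (f.val ^ n * G - f.val ^ N * incl K r P))).fst = 0 := by
    rw [toThick_fst]
    exact jet_fst_of_mem hM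
  have hX : ∀ m, toThick A f.val ^ m = TrivSqZeroExt.inl (X i ^ m) := toThick_X_inr_pow i
  have hX0 : ∀ m, (X i ^ m : LineRing K) ≠ 0 := fun m => pow_ne_zero m (X_ne_zero i)
  rw [map_mul, map_sub, map_mul, map_mul, map_pow, map_pow, map_pow, ← h1, toThick_incl, hX, hX] at h4
  simp only [TrivSqZeroExt.fst_mul, TrivSqZeroExt.fst_sub, TrivSqZeroExt.fst_inl, mul_eq_zero, hX0,
    false_or, ← mul_sub] at h4
  exact sub_eq_zero.1 h4

/-- If a section satisfies the row condition, its components are rows of linear forms times `B`. -/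
lemma exists_linear_of_eq_mulVec (hB : ColForms B β) {P : Fin k → LineRing K}
    (hP : P ∈ formPi K fun s => (β s : ℤ) + 1) {lam : Fin (r + 1) → LineRing K}
    (h : P = Bᵀ.mulVec lam) : P ∈ (formPi K fun _ => 1).map (rowMap B) := by
  refine ⟨fun j => formProj 1 (lam j), mem_formPi.2 fun j => formProj_mem _ _, ?_⟩
  ext1 s
  rw [← formProj_of_mem (mem_formPi.1 hP s), h, Matrix.mulVec_transpose]
  change Matrix.vecMul _ B s = _
  simp only [Matrix.vecMul, dotProduct, map_sum]
  refine Finset.sum_congr rfl fun j _ => ?_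
  rw [mul_comm (lam j), formProj_mul (hB j s), add_sub_cancel_left, mul_comm]

end Restriction

/-! ### The Hilbert function and the genus -/

section Hilbert

variable {K : Type*} [Field K] {r : ℕ} {ι : Type*} [Fintype ι] {k : ℕ}
variable {A : Matrix ι (Fin (r + 1)) (LineRing K)} {B : Matrix (Fin (r + 1)) (Fin k) (LineRing K)}
variable {α : ι → ℕ} {I : Ideal (CoordRing K r)}

/-- Elements of `thickForm` are pairs of a form and a vector of forms. -/
noncomputable def thickFormEquiv (α : ι → ℕ) (d : ℤ) :
    thickForm (K := K) α d ≃ₗ[K] form (Fin 2) K d × formPi K fun l => d - 1 + (α l : ℤ) where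
  toFun x := (⟨x.1.fst, x.2.1⟩, ⟨x.1.snd, mem_formPi.2 x.2.2⟩)
  map_add' _ _ := rfl
  map_smul' _ _ := rfl
  invFun w := ⟨TrivSqZeroExt.inl w.1.1 + TrivSqZeroExt.inr w.2.1, by
    refine ⟨?_, fun l => ?_⟩
    · simp
    · simpa using mem_formPi.1 w.2.2 l⟩
  left_inv x := Subtype.ext (TrivSqZeroExt.inl_fst_add_inr_snd_eq x.1)
  right_inv w := by
    refine Prod.ext (Subtype.ext ?_) (Subtype.ext ?_) <;> simp

lemma finrank_thickForm (α : ι → ℕ) (d : ℤ) : (Module.finrank K (thickForm (K := K) α d) : ℤ) =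
    max 0 (d + 1) + ∑ l, max 0 (d + α l) := by
  rw [(thickFormEquiv α d).finrank_eq, Module.finrank_prod]
  push_cast
  rw [finrank_form, finrank_formPi]
  congr 1
  exact Finset.sum_congr rfl fun l _ => by ring_nf

lemma IsLineExact.map_toThick (h : IsLineExact A B) (hA : RowForms A α) :
    ∃ M : ℕ, ∀ m : ℕ, M ≤ m → (homogeneousSubmodule (Fin (r + 1) ⊕ Fin 2) K m).map
      (toThick A).toLinearMap = thickForm α (m : ℤ) := by
  obtain ⟨M, hM⟩ := h.surj_form hA
  -- The bound moves by one because the coefficients of the `x_j` in a form of degree `m` have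
  -- degree `m - 1`.
  refine ⟨M + 1, fun m hm => le_antisymm ?_ fun x hx => ?_⟩
  · rintro _ ⟨F, hF, rfl⟩
    exact toThick_mem hA (mem_form_natCast.2 hF)
  · obtain ⟨v, -, hv⟩ := hM ((m : ℤ) - 1) (by omega) x.snd (mem_formPi.2 hx.2)
    have hG : toThick A (incl K r x.fst + ∑ j, X (Sum.inl j) * incl K r (v j)) = x := by
      rw [map_add, toThick_incl, toThick_sum, hv, TrivSqZeroExt.inl_fst_add_inr_snd_eq]
    obtain ⟨G, hGm, hG'⟩ := exists_form_of_toThick_mem hA (hG.symm ▸ hx)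
    exact ⟨G, mem_form_natCast.1 hGm, hG'.trans hG⟩

lemma hilbertFunction_eq_finrank_map (hI : ∀ F, F ∈ I ↔ toThick A F = 0) (m : ℕ) :
    hilbertFunction I m = Module.finrank K
      ((homogeneousSubmodule (Fin (r + 1) ⊕ Fin 2) K m).map (toThick A).toLinearMap) := by
  have hfin : Module.Finite K (homogeneousSubmodule (Fin (r + 1) ⊕ Fin 2) K m) := by
    rw [← form_natCast]
    infer_instance
  have h1 := finrank_map_add_finrank_inf_ker (Ideal.Quotient.mkₐ K I).toLinearMap
    (homogeneousSubmodule (Fin (r + 1) ⊕ Fin 2) K m)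
  have h2 := finrank_map_add_finrank_inf_ker (toThick A).toLinearMap
    (homogeneousSubmodule (Fin (r + 1) ⊕ Fin 2) K m)
  have h3 : LinearMap.ker (Ideal.Quotient.mkₐ K I).toLinearMap =
      LinearMap.ker (toThick A).toLinearMap := by
    ext F
    rw [LinearMap.mem_ker, LinearMap.mem_ker]
    exact Ideal.Quotient.eq_zero_iff_mem.trans (hI F)
  rw [h3] at h1
  exact Nat.add_right_cancel (h1.trans h2.symm)

/-- For large `m` the Hilbert function is `(m + 1) + ∑ (m + α_l)`; its constant term is compared
with `1 - g`. -/
lemma IsLineExact.sum_eq_neg_genus (h : IsLineExact A B) (hA : RowForms A α)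
    (hI : ∀ F, F ∈ I ↔ toThick A F = 0) {d : ℕ} {g : ℤ} (hdg : HasDegreeAndGenus I d g)
    (hd : d = Fintype.card ι + 1) : ∑ l, (α l : ℤ) = -g := by
  obtain ⟨M, hM⟩ := h.map_toThick hA
  obtain ⟨N, hN⟩ := Filter.eventually_atTop.1 hdg
  have h1 := hN (max M N) (le_max_right _ _)
  rw [hilbertFunction_eq_finrank_map hI, hM _ (le_max_left _ _), finrank_thickForm,
    max_eq_right (by positivity)] at h1
  have h2 : ∀ l, max 0 (((max M N : ℕ) : ℤ) + α l) = (max M N : ℕ) + α l := fun l =>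
    max_eq_right (by positivity)
  simp only [h2, Finset.sum_add_distrib, Finset.sum_const, Finset.card_univ, nsmul_eq_mul] at h1
  rw [hd] at h1
  push_cast at h1
  linarith

end Hilbert

/-! ### The final dimension count -/

section Dimension

variable {K : Type*} [Field K] {r k : ℕ}

lemma IsAssociated.isLineExact {I : Ideal (CoordRing K r)} {α : Fin (r - k + 1) → ℕ}
    {β : Fin k → ℕ} {A : Matrix (Fin (r - k + 1)) (Fin (r + 1)) (LineRing K)}
    {B : Matrix (Fin (r + 1)) (Fin k) (LineRing K)} (hAB : IsAssociated I α β A B) :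
    IsLineExact A B :=
  isLineExact_of_localized hAB.injective hAB.exact hAB.surjective

lemma sum_subtype_le_eq_sum_Ici {ι M : Type*} [Fintype ι] [LinearOrder ι] [LocallyFiniteOrderTop ι]
    [AddCommMonoid M] (f : ι → ι → M) :
    ∑ p : {p : ι × ι // p.1 ≤ p.2}, f p.1.1 p.1.2 = ∑ h, ∑ v ∈ Finset.Ici h, f h v := by
  rw [Finset.sum_sigma', eq_comm]
  refine Finset.sum_bij (fun a ha => ⟨(a.1, a.2), by simpa using ha⟩) (by simp) ?_ ?_ (by simp)
  · rintro ⟨a, b⟩ _ ⟨c, d⟩ _ h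
    simpa using h
  · rintro ⟨⟨a, b⟩, h⟩ -
    exact ⟨⟨a, b⟩, by simpa using h, rfl⟩

end Dimension

end LineRope

open LineRope in
theorem mainTheorem9 {K : Type*} [Field K] (r k : ℕ) (g : ℤ)
    (I : Ideal (CoordRing K r)) (hI : IsRope I)
    (hdeg : 2 < r + 2 - k) (hdg : HasDegreeAndGenus I (r + 2 - k) g)
    (α : Fin (r - k + 1) → ℕ) (β : Fin k → ℕ)
    (A : Matrix (Fin (r - k + 1)) (Fin (r + 1)) (LineRing K))
    (B : Matrix (Fin (r + 1)) (Fin k) (LineRing K))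
    (hAB : IsAssociated I α β A B) (hα : ∀ l, 2 ≤ α l) :
    Module.Finite K (normalSections I) ∧
    expectedDim r k g α ≤ (Module.finrank K (normalSections I) : ℤ) ∧
    ((∀ φ : normalSections I, SatisfiesRowCondition hI β B φ) →
      (Module.finrank K (normalSections I) : ℤ) = expectedDim r k g α) := by
  have h := hAB.isLineExact
  have hA : RowForms A α := fun l j => mem_form_natCast.2 (hAB.degA l j)
  have hB : ColForms B β := fun j s => mem_form_natCast.2 (hAB.degB j s)
  have hker : ∀ F, F ∈ I ↔ toThick A F = 0 := fun F => by
    rw [toThick_eq_zero_iff h, ← hAB.ideal_eq]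
  -- Degree greater than two means that `A` has at least two rows.
  have : Nontrivial (Fin (r - k + 1)) := Fin.nontrivial_iff_two_le.2 (by omega)
  let e := LinearEquiv.ofBijective (sectionOfData h hA hB hker)
    (sectionOfData_bijective h hA hB hker hAB.ideal_eq)
  have hfin := h.finite_normalData (β := β) hA
  have hg : ∑ l, (α l : ℤ) = -g := h.sum_eq_neg_genus hA hker hdg (by simp; omega)
  have hβ : ∑ s, (β s : ℤ) = -g := (h.sum_eq_sum hA hB (by simp; omega)).trans hg
  -- The excess over `E` is the dimension of the space of all `P` minus the `2(r+1)` accounted for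
  -- by `Bᵀ λ`. Both assertions follow from this formula.
  have hdim : (Module.finrank K (normalSections I) : ℤ) = expectedDim r k g α +
      (Module.finrank K ((normalData A B α β).map (LinearMap.fst K _ _)) - 2 * (r + 1)) := by
    rw [← e.finrank_eq, h.finrank_normalData hA, hg, hβ, expectedDim]
    simp_rw [← sum_subtype_le_eq_sum_Ici]
    simp only [Fintype.card_fin]
    -- This removes the truncated subtraction `r - k` before the integer identity is checked.
    obtain ⟨c, rfl⟩ : ∃ c, r = k + c := ⟨r - k, by omega⟩
    have hc : ((k + c - k + 1 : ℕ) : ℤ) = c + 1 := by simp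
    rw [hc]
    push_cast
    ring
  have hrow := h.finrank_map_rowMap hA hα
  rw [Fintype.card_fin] at hrow
  refine ⟨Module.Finite.equiv e, ?_, fun hφ => ?_⟩
  · have := Submodule.finrank_mono (h.map_rowMap_le hA hB)
    omega
  · have heq : (normalData A B α β).map (LinearMap.fst K _ _) =
        (formPi K fun _ => 1).map (rowMap B) := by
      refine le_antisymm ?_ (h.map_rowMap_le hA hB)
      rintro _ ⟨x, hx, rfl⟩
      obtain ⟨P, hP, lam, hlam⟩ := hφ (sectionOfData h hA hB hker ⟨x, hx⟩)
      -- The components given by the row condition are those of the triple; comparison on the chart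
      -- `D₊(t)` alone suffices.
      have hPx : x.1 = P := funext fun s => by
        have hs : formOfColumn B s ∈ I := by
          rw [hAB.ideal_eq]
          exact Ideal.mem_sup_right (Ideal.subset_span ⟨s, rfl⟩)
        simpa using (globalValue_formOfColumn h hA hB hker ⟨x, hx⟩ s hs).fst_eq (hP s 0)
      exact exists_linear_of_eq_mulVec hB hx.1 (hPx.trans hlam)
    rw [hdim, heq, hrow]
    push_cast
    ring
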